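/- Let $H$ be a separable real Hilbert space with $H\neq\{0\}$ (in particular, $H$ may be infinite dimensional), and let $\mu$ be a Radon measure on $H$, that is, a Borel measure which is finite on compact sets, outer regular on Borel sets, and inner regular by compact sets on open sets. $B(x,r)$ denotes the closed ball. Let $X\subset H$ be a set with $\mu(H\setminus X)=0$, let $k_0\in\mathbb{Z}$ and $\lambda_2>1$, and let $X_{k_0}\subset X_{k_0+1}\subset\cdots$ be nested sets such that, for every $k\ge k_0$, $X_k$ is a maximal $2^{-k}$-net of $X$: $X_k\subset X$, distinct points of $X_k$ are at distance at least $2^{-k}$, and every point of $X$ is within distance $2^{-k}$ of $X_k$. Let $$\mathcal{C}^\mu=\bigcup_{k\ge k_0}\{B(y,\lambda_2 2^{-k}):y\in X_k\}$$ be the associated multiresolution family of balls. For a bounded Borel set $E\subset H$ let $$\beta_2^2(\mu,E)=\inf_\ell \frac{1}{\mu(E)}\int_E\left(\frac{\operatorname{dist}(x,\ell)}{\operatorname{diam}E}\right)^2 d\mu(x),$$ where the infimum is over all straight lines $\ell$ in $H$, and $\beta_2^2(\mu,E)=0$ if $\mu(E)=0$ or $\mu(E)=\infty$. Define $$\hat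 J_2(\mu,x)=\sum_{B\in\mathcal{C}^\mu,\ \operatorname{radius}(B)\le 1}\beta_2^2(\mu,2B)\,\frac{\operatorname{diam}B}{\mu(B)}\,\chi_B(x)\in[0,\infty],\qquad x\in H,$$ where $2B$ is the ball with the same center as $B$ and twice the radius, with the conventions $a/0=\infty$ for $a>0$, $a/\infty=0$ for $0\le a<\infty$, and $0\cdot\infty=0$. Then the measure $$\mu\llcorner\left\{x\in H:\ \limsup_{r\downarrow0}\frac{\mu(B(x,2r))}{\mu(B(x,r))}<\infty\ \text{ and }\ \hat J_2(\mu,x)<\infty\right\}$$ (with $0/0=0$ in the quotient) is $1$-rectifiable, i.e. there are countably many rectifiable curves (compact, connected sets of finite one-dimensional Hausdorff measure) $\Gamma_1,\Gamma_2,\dots$ whose union has a complement of measure zero for it. -/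

import Mathlib

open MeasureTheory Metric Set Filter Topology
open scoped ENNReal

/-- A rectifiable curve: a compact connected set of finite length, that is, of finite
one-dimensional Hausdorff measure. -/
def IsRectifiableCurve {H : Type*} [MetricSpace H] [MeasurableSpace H] [BorelSpace H]
    (Γ : Set H) : Prop :=
  IsCompact Γ ∧ IsConnected Γ ∧ Measure.hausdorffMeasure 1 Γ < ∞

/-- `μ` is carried by the family `N` of sets: countably many members of `N` cover `μ`-almost
everything. -/
def IsCarriedBy {H : Type*} [MeasurableSpace H] (μ : Measure H) (N : Set (Set H)) : Prop :=
  ∃ S : Set (Set H), S.Countable ∧ S ⊆ N ∧ μ (⋃₀ S)ᶜ = 0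

/-- A measure is `1`-rectifiable if it is carried by rectifiable curves. -/
def IsOneRectifiable {H : Type*} [MetricSpace H] [MeasurableSpace H] [BorelSpace H]
    (μ : Measure H) : Prop :=
  IsCarriedBy μ {Γ : Set H | IsRectifiableCurve Γ}

/-- `μ` is doubling at the point `x`: `limsup_{r ↓ 0} μ(B(x, 2r)) / μ(B(x, r)) < ∞`. -/
def IsDoublingAt {H : Type*} [MetricSpace H] [MeasurableSpace H] (μ : Measure H) (x : H) : Prop :=
  limsup (fun r : ℝ => μ (closedBall x (2 * r)) / μ (closedBall x r)) (𝓝[>] 0) < ∞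

/-- `N` is a maximal `ε`-net of `X`: an `ε`-separated subset of `X` such that every point of `X`
is within `ε` of it. (A subset that is maximal among those whose distinct points are at distance
at least `ε`, and one that is maximal among those whose distinct points are at distance greater
than `ε`, both have these properties.) -/
structure IsMaximalNet {H : Type*} [MetricSpace H] (ε : ℝ) (X N : Set H) : Prop where
  subset : N ⊆ X
  separated : ∀ x ∈ N, ∀ y ∈ N, x ≠ y → ε ≤ dist x y
  covers : ∀ x ∈ X, ∃ y ∈ N, dist x y ≤ ε

/-- The data of a multiresolution family of balls for the measure `μ`: a set `X` carrying `μ`,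
an initial scale `k₀`, nested maximal `2^{-k}`-nets of `X` for `k ≥ k₀`, and a dilation factor
`lam > 1`. The balls of the family are the closed balls `B(y, lam 2^{-k})` with `k ≥ k₀` and
`y ∈ net k`. -/
structure MultiresolutionFamily {H : Type*} [MetricSpace H] [MeasurableSpace H]
    (μ : Measure H) where
  X : Set H
  carries : μ Xᶜ = 0
  k₀ : ℤ
  lam : ℝ
  one_lt_lam : 1 < lam
  net : ℤ → Set H
  isMaximalNet : ∀ k, k₀ ≤ k → IsMaximalNet ((2 : ℝ) ^ (-k)) X (net k)
  nested : ∀ k, k₀ ≤ k → net k ⊆ net (k + 1)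

/-- The radius `lam 2^{-k}` of the balls of generation `k`. -/
noncomputable def MultiresolutionFamily.radius {H : Type*} [MetricSpace H] [MeasurableSpace H]
    {μ : Measure H} (F : MultiresolutionFamily μ) (k : ℤ) : ℝ :=
  F.lam * (2 : ℝ) ^ (-k)

/-- The pairs (generation, centre) of the balls of the family with radius at most `r`. In a
nontrivial real normed space a ball determines its centre and its radius, so that these pairs
correspond bijectively to the balls. -/
def MultiresolutionFamily.balls {H : Type*} [MetricSpace H] [MeasurableSpace H]
    {μ : Measure H} (F : MultiresolutionFamily μ) (r : ℝ) : Set (ℤ × H) :=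
  {p | F.k₀ ≤ p.1 ∧ p.2 ∈ F.net p.1 ∧ F.radius p.1 ≤ r}

open Classical in
/-- The square of the `L²` beta number,
`β₂(μ, E)² = inf_ℓ ∫_E (dist(x, ℓ) / diam E)² dμ(x) / μ(E)`, the infimum over all lines `ℓ`,
with value `0` if `μ(E) = 0`. (If `μ(E) = ∞`, the division in `[0, ∞]` gives the value `0`.) -/
noncomputable def betaTwoSq {H : Type*} [NormedAddCommGroup H] [InnerProductSpace ℝ H]
    [MeasurableSpace H] (μ : Measure H) (E : Set H) : ℝ≥0∞ :=
  if μ E = 0 then 0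
  else ⨅ (ℓ : AffineSubspace ℝ H) (_ : Module.finrank ℝ ℓ.direction = 1),
    (∫⁻ x in E, ENNReal.ofReal ((infDist x (ℓ : Set H) / diam E) ^ 2) ∂μ) / μ E

/-- The `L²` density adapted Jones function
`Ĵ₂(μ, r, x) = ∑ β₂(μ, 2B)² (diam B / μ(B)) χ_B(x)`, the sum over the balls `B` of the family
with radius at most `r`. -/
noncomputable def jonesFunction {H : Type*} [NormedAddCommGroup H] [InnerProductSpace ℝ H]
    [MeasurableSpace H] (μ : Measure H) (F : MultiresolutionFamily μ) (r : ℝ) (x : H) : ℝ≥0∞ :=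
  ∑' p : F.balls r,
    (closedBall p.1.2 (F.radius p.1.1)).indicator
      (fun _ => betaTwoSq μ (closedBall p.1.2 (2 * F.radius p.1.1)) *
        (ENNReal.ofReal (diam (closedBall p.1.2 (F.radius p.1.1))) /
          μ (closedBall p.1.2 (F.radius p.1.1)))) x

/-! Up to null sets, the set in question is a countable union of pieces `E₀ ⊆ X` of finite measure
on which `μ` is doubling at dyadic scales with uniform constants and the Jones function is bounded.
On such pieces a traveling salesman construction produces curves of bounded length through finer and
finer nets, and a weak limit of these curves contains the set that the nets approximate.

From the measure to nets. Integrating the Jones function over `E₀` bounds the sum of β₂²(2B) diam B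
· μ(B ∩ E₀)/μ(B). For balls near the density points `E₁` of `E₀` the last ratio is bounded below, so
β₂²(2B) diam B is summable over these balls (`GoodPieces.tsum_beta_ne_top`). Since the nets are
nested, a chosen point remains in all later nets and has to be close, on average, to the lines of
all smaller balls. Near a density point of `E₁` such a point is found in `E₁` by averaging: its
`tailCost` is at most a multiple of the mean over a ball of the scale at which the point enters.
After an exchange of sums one must bound, for a fixed ball B, the sum of μ(2B)/μ(B(v,r)) over the
new points v near B of larger scales r. Doubling alone does not make this sum geometric. But a new
point and its predecessor are two separated points near B, so the measure of balls about B then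
drops by a definite proportion within a fixed number of scales; hence the reciprocals of these
measures telescope (`GoodPieces.measure_drop`, `sum_ratio_le`, `GoodPieces.sum_measure_ratio_le`).

From nets to length. Projection to a line is a coordinate on a separated set, isometric up to an
error quadratic in the distances to the line (`dist_le_abs_inner_sub_add`). On each net, of scale r,
take a spanning edge set minimal for the weight ℓ + min(ℓ, R) with R = 16Mr. At a flat vertex
minimality allows at most one short edge on each side; if there are two, every new point nearest to
this vertex can be inserted into one of them at the cost of the coordinate error. The other new
points become leaves. Since the number of vertices is at most the number of edges plus one, the
missing short edges at flat vertices are paid for by the long edges, up to a constant and to the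
errors at vertices that are not flat. When r is halved, each long edge loses the weight 8Mr, exactly
what its share of the leaves costs (`NetStep.exists_spans`). The remaining increments are a
geometric series and the summable errors, so the lengths stay bounded.

In the limit, tours of bounded length are 1-Lipschitz maps of one interval. Pointwise weak limits
along an ultrafilter are again 1-Lipschitz, and their image is a compact curve containing the limit
set, even when bounded sets are not precompact (`exists_isRectifiableCurve_of_approx`). -/

/-! ### Finite edge sets in a metric space -/

/-- The length of an edge. -/
noncomputable def edgeLength {X : Type*} [MetricSpace X] (e : Sym2 X) : ℝ :=
  Sym2.lift ⟨fun x y : X => dist x y, dist_comm⟩ e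

@[simp] theorem edgeLength_mk {X : Type*} [MetricSpace X] (x y : X) :
    edgeLength s(x, y) = dist x y := rfl

theorem edgeLength_nonneg {X : Type*} [MetricSpace X] (e : Sym2 X) : 0 ≤ edgeLength e := by
  induction e using Sym2.ind with
  | _ x y => exact dist_nonneg

/-- `x` and `y` are joined by a chain of edges of `S`. -/
def EdgeJoined {X : Type*} (S : Finset (Sym2 X)) (x y : X) : Prop :=
  Relation.EqvGen (fun x y => s(x, y) ∈ S) x y

theorem EdgeJoined.refl {X : Type*} (S : Finset (Sym2 X)) (x : X) : EdgeJoined S x x :=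
  Relation.EqvGen.refl x

theorem EdgeJoined.symm {X : Type*} {S : Finset (Sym2 X)} {x y : X} (h : EdgeJoined S x y) :
    EdgeJoined S y x :=
  Relation.EqvGen.symm _ _ h

theorem EdgeJoined.trans {X : Type*} {S : Finset (Sym2 X)} {x y z : X} (h : EdgeJoined S x y)
    (h' : EdgeJoined S y z) : EdgeJoined S x z :=
  Relation.EqvGen.trans _ _ _ h h'

theorem EdgeJoined.of_mem {X : Type*} {S : Finset (Sym2 X)} {x y : X} (h : s(x, y) ∈ S) :
    EdgeJoined S x y :=
  Relation.EqvGen.rel _ _ h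

/-- When edges are replaced, it suffices to reconnect the two ends of each old edge. -/
theorem EdgeJoined.of_edges {X : Type*} {S T : Finset (Sym2 X)} {x y : X} (h : EdgeJoined S x y)
    (hST : ∀ a b, s(a, b) ∈ S → EdgeJoined T a b) : EdgeJoined T x y := by
  induction h with
  | rel x y h => exact hST x y h
  | refl x => exact .refl T x
  | symm x y _ ih => exact ih.symm
  | trans x y z _ _ ih ih' => exact ih.trans ih'

theorem EdgeJoined.mono {X : Type*} {S T : Finset (Sym2 X)} (hST : S ⊆ T) {x y : X}
    (h : EdgeJoined S x y) : EdgeJoined T x y :=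
  h.of_edges fun _ _ h => .of_mem (hST h)

/-- An edge set joins any two points of `V`. -/
def Spans {X : Type*} (S : Finset (Sym2 X)) (V : Finset X) : Prop :=
  ∀ x ∈ V, ∀ y ∈ V, EdgeJoined S x y

/-- If no edge left `W`, membership in `W` would be constant along chains. -/
theorem EdgeJoined.exists_crossing {X : Type*} {S : Finset (Sym2 X)} {x y : X} (h : EdgeJoined S x y)
    {W : Finset X} (hx : x ∈ W) (hy : y ∉ W) : ∃ a ∈ W, ∃ b ∉ W, s(a, b) ∈ S := by
  by_contra! hcon
  have key : ∀ a b, EdgeJoined S a b → (a ∈ W ↔ b ∈ W) := by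
    intro a b hab
    induction hab with
    | rel x y h =>
      constructor
      · intro hx; by_contra hy; exact hcon x hx y hy h
      · intro hy; by_contra hx; exact hcon y hy x hx (Sym2.eq_swap ▸ h)
    | refl x => exact Iff.rfl
    | symm x y _ ih => exact ih.symm
    | trans x y z _ _ ih ih' => exact ih.trans ih'
  exact hy ((key x y h).1 hx)

/-- Induction principle: a spanned vertex set is built from any of its points by adding one vertex
and one new edge at a time. -/
theorem Spans.growth {X : Type*} [DecidableEq X] {S : Finset (Sym2 X)} {V : Finset X}
    (hS : Spans S V) (hSV : S ⊆ V.sym2) {v : X} (hv : v ∈ V)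
    (P : Finset X → Finset (Sym2 X) → Prop) (h0 : P {v} ∅)
    (hstep : ∀ W T a b, T ⊆ S → a ∈ W → b ∉ W → s(a, b) ∈ S → s(a, b) ∉ T → P W T →
      P (insert b W) (insert s(a, b) T)) : ∃ T ⊆ S, P V T := by
  -- Induction on the size of the part `W` reached so far. Keeping `T ⊆ W.sym2` guarantees that an
  -- edge leaving `W` is new.
  have key : ∀ n, n + 1 ≤ V.card →
      ∃ W T, W ⊆ V ∧ v ∈ W ∧ W.card = n + 1 ∧ T ⊆ S ∧ T ⊆ W.sym2 ∧ P W T := by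
    intro n
    induction n with
    | zero =>
      intro _
      exact ⟨{v}, ∅, by simpa using hv, by simp, by simp, by simp, by simp, h0⟩
    | succ n ih =>
      intro hn
      obtain ⟨W, T, hWV, hvW, hW, hTS, hTW, hP⟩ := ih (by omega)
      obtain ⟨y, hyV, hyW⟩ : ∃ y ∈ V, y ∉ W := by
        by_contra! hcon
        have := Finset.card_le_card (show V ⊆ W from hcon)
        omega
      obtain ⟨a, ha, b, hb, hab⟩ := (hS v hv y hyV).exists_crossing hvW hyW
      have hbV : b ∈ V := (Finset.mk_mem_sym2_iff.1 (hSV hab)).2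
      refine ⟨insert b W, insert s(a, b) T, Finset.insert_subset hbV hWV,
        Finset.mem_insert_of_mem hvW, by rw [Finset.card_insert_of_notMem hb, hW],
        Finset.insert_subset hab hTS, ?_, hstep W T a b hTS ha hb hab ?_ hP⟩
      · refine Finset.insert_subset ?_ (hTW.trans (Finset.sym2_mono (Finset.subset_insert _ _)))
        simp [ha]
      · intro h
        exact hb (Finset.mk_mem_sym2_iff.1 (hTW h)).2
  obtain ⟨W, T, hWV, -, hW, hTS, -, hP⟩ := key (V.card - 1)
    (by have := Finset.card_pos.2 ⟨v, hv⟩; omega)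
  have hWV' : W = V := Finset.eq_of_subset_of_card_le hWV
    (by have := Finset.card_pos.2 ⟨v, hv⟩; omega)
  exact ⟨T, hTS, hWV' ▸ hP⟩

/-- As in a tree, every vertex after the first brings an edge of its own. -/
theorem Spans.card_le {X : Type*} [DecidableEq X] {S : Finset (Sym2 X)} {V : Finset X}
    (hS : Spans S V) (hSV : S ⊆ V.sym2) : V.card ≤ S.card + 1 := by
  rcases V.eq_empty_or_nonempty with rfl | ⟨v, hv⟩
  · simp
  obtain ⟨T, hTS, hT⟩ := hS.growth hSV hv (fun W T => W.card ≤ T.card + 1) (by simp) (by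
    intro W T a b _ _ hb _ hab ih
    simp only [Finset.card_insert_of_notMem hb, Finset.card_insert_of_notMem hab]
    omega)
  exact hT.trans (by have := Finset.card_le_card hTS; omega)

/-! ### Tours -/

theorem lipschitz_one_glue {Y : Type*} [PseudoMetricSpace Y] {f : ℝ → Y} (c : ℝ)
    (h₁ : ∀ s t, s ≤ t → t ≤ c → dist (f s) (f t) ≤ t - s)
    (h₂ : ∀ s t, c ≤ s → s ≤ t → dist (f s) (f t) ≤ t - s) :
    ∀ s t, s ≤ t → dist (f s) (f t) ≤ t - s := by
  intro s t hst
  rcases le_total t c with h | h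
  · exact h₁ s t hst h
  rcases le_total c s with h' | h'
  · exact h₂ s t h' hst
  · have := dist_triangle (f s) (f c) (f t)
    have := h₁ s c h' le_rfl
    have := h₂ c t le_rfl h
    linarith

/-- A tour of length `ℓ` can be enlarged by a detour to a further point. -/
theorem exists_detour {E : Type*} [NormedAddCommGroup E] [NormedSpace ℝ E] {f : ℝ → E} {ℓ c : ℝ}
    (hf : ∀ s t, s ≤ t → dist (f s) (f t) ≤ t - s) (hc : c ∈ Icc 0 ℓ) (b : E) :
    ∃ g : ℝ → E, (∀ s t, s ≤ t → dist (g s) (g t) ≤ t - s) ∧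
      f '' Icc 0 ℓ ⊆ g '' Icc 0 (ℓ + 2 * dist (f c) b) ∧
      b ∈ g '' Icc 0 (ℓ + 2 * dist (f c) b) := by
  set d := dist (f c) b with hd
  have hd0 : 0 ≤ d := dist_nonneg
  rcases hd0.eq_or_lt with h0 | hpos
  · refine ⟨f, hf, by rw [← h0]; simp, ?_⟩
    rw [← h0]
    have : f c = b := dist_eq_zero.1 (h0.symm)
    exact ⟨c, by simpa using hc, this⟩
  set u : E := d⁻¹ • (b - f c) with hu
  have hun : ‖u‖ = 1 := by
    rw [hu, norm_smul, norm_inv, Real.norm_of_nonneg hd0, ← dist_eq_norm, dist_comm, ← hd,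
      inv_mul_cancel₀ hpos.ne']
  have hdu : d • u = b - f c := by rw [hu, smul_inv_smul₀ hpos.ne']
  -- At unit speed: `f` up to time `c`, then straight to `b` and back in time `2 * d`, then `f` with
  -- this delay.
  set g : ℝ → E := fun t => if t ≤ c then f t else if t ≤ c + 2 * d then
    f c + (d - |t - (c + d)|) • u else f (t - 2 * d) with hg
  have g1 : ∀ t, t ≤ c → g t = f t := fun t ht => by simp [hg, ht]
  have g2 : ∀ t, c ≤ t → t ≤ c + 2 * d → g t = f c + (d - |t - (c + d)|) • u := by
    intro t ht ht'
    rcases ht.eq_or_lt with h | h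
    · subst h
      have : c - (c + d) = -d := by ring
      simp [hg, this, abs_of_nonneg hd0]
    · simp [hg, not_le.2 h, ht']
  have g3 : ∀ t, c + 2 * d ≤ t → g t = f (t - 2 * d) := by
    intro t ht
    rcases ht.eq_or_lt with h | h
    · rw [g2 t (by linarith) h.symm.le, ← h]
      have : c + 2 * d - (c + d) = d := by ring
      have h' : c + 2 * d - 2 * d = c := by ring
      simp [this, abs_of_nonneg hd0]
    · simp [hg, not_le.2 h, not_le.2 (show c < t by linarith)]
  refine ⟨g, ?_, ?_, ?_⟩
  · refine lipschitz_one_glue c ?_ ?_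
    · intro s t hst ht
      rw [g1 s (hst.trans ht), g1 t ht]
      exact hf s t hst
    · intro s t hs hst
      rw [← abs_of_nonneg (sub_nonneg.2 hst)]
      -- Composition with `max c` freezes the map before `c`, so that the gluing at `c + 2 * d` can
      -- be done on the whole line.
      have := lipschitz_one_glue (f := fun t => g (max c t)) (c + 2 * d) ?_ ?_ s t hst
      · rw [abs_of_nonneg (sub_nonneg.2 hst)]
        simpa [max_eq_right hs, max_eq_right (hs.trans hst)] using this
      · intro s t hst ht
        have hs' := max_le (show c ≤ c + 2 * d by linarith) (hst.trans ht)
        have ht' := max_le (show c ≤ c + 2 * d by linarith) ht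
        rw [g2 _ (le_max_left _ _) hs', g2 _ (le_max_left _ _) ht', dist_add_left, dist_eq_norm,
          ← sub_smul, norm_smul, hun, mul_one, Real.norm_eq_abs]
        have h1 : d - |max c s - (c + d)| - (d - |max c t - (c + d)|) =
          |max c t - (c + d)| - |max c s - (c + d)| := by ring
        rw [h1]
        refine (abs_abs_sub_abs_le_abs_sub _ _).trans ?_
        have h2 : max c t - (c + d) - (max c s - (c + d)) = max c t - max c s := by ring
        rw [h2, abs_of_nonneg (sub_nonneg.2 (max_le_max_left _ hst))]
        rcases le_total c s with h | h
        · rw [max_eq_right h, max_eq_right (h.trans hst)]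
        · rw [max_eq_left h]
          rcases le_total c t with h' | h'
          · rw [max_eq_right h']; linarith
          · rw [max_eq_left h']; linarith
      · intro s t hs hst
        rw [max_eq_right (by linarith), max_eq_right (by linarith), g3 s hs, g3 t (hs.trans hst)]
        have := hf (s - 2 * d) (t - 2 * d) (by linarith)
        linarith
  · rintro _ ⟨t, ht, rfl⟩
    rcases le_total t c with h | h
    · exact ⟨t, ⟨ht.1, by linarith [ht.2]⟩, g1 t h⟩
    · refine ⟨t + 2 * d, ⟨by linarith [ht.1], by linarith [ht.2]⟩, ?_⟩
      rw [g3 _ (by linarith)]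
      congr 1
      ring
  · refine ⟨c + d, ⟨by linarith [hc.1], by linarith [hc.2]⟩, ?_⟩
    rw [g2 _ (by linarith) (by linarith), sub_self, abs_zero, sub_zero, hdu]
    abel

/-- A set spanned by edges of total length `ℓ` is contained in a tour of length `2ℓ`. -/
theorem Spans.exists_tour {E : Type*} [NormedAddCommGroup E] [NormedSpace ℝ E]
    {S : Finset (Sym2 E)} {V : Finset E} (hS : Spans S V) (hSV : S ⊆ V.sym2)
    (hV : V.Nonempty) : ∃ f : ℝ → E, (∀ s t, s ≤ t → dist (f s) (f t) ≤ t - s) ∧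
      (V : Set E) ⊆ f '' Icc 0 (2 * ∑ e ∈ S, edgeLength e) := by
  classical
  obtain ⟨v, hv⟩ := hV
  obtain ⟨T, hTS, f, hf, hfV⟩ := hS.growth hSV hv
    (fun W T => ∃ f : ℝ → E, (∀ s t, s ≤ t → dist (f s) (f t) ≤ t - s) ∧
      (W : Set E) ⊆ f '' Icc 0 (2 * ∑ e ∈ T, edgeLength e))
    ⟨fun _ => v, fun s t h => by simpa using h, by simp⟩ (by
      rintro W T a b _ ha hb _ hab ⟨f, hf, hfW⟩
      -- The vertex `a` is visited at time `c`; the detour from there costs twice the new edge.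
      obtain ⟨c, hc, rfl⟩ := hfW ha
      obtain ⟨g, hg, hfg, hbg⟩ := exists_detour hf hc b
      refine ⟨g, hg, ?_⟩
      rw [Finset.sum_insert hab, mul_add, add_comm, edgeLength_mk]
      intro x hx
      rcases Finset.mem_insert.1 (Finset.mem_coe.1 hx) with rfl | hx
      · exact hbg
      · exact hfg (hfW hx))
  refine ⟨f, hf, hfV.trans (image_mono (Icc_subset_Icc_right ?_))⟩
  have := Finset.sum_le_sum_of_subset_of_nonneg hTS
    (fun e _ _ => edgeLength_nonneg e)
  linarith

/-! ### Paths along a coordinate -/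

/-- A finite set with an almost isometric coordinate is spanned by a path. -/
theorem exists_path {X : Type*} [MetricSpace X] [DecidableEq X] (t : X → ℝ) (ε : ℝ)
    (a : X) (P : Finset X) (ha : ∀ p ∈ P, t a < t p) (b : X) (hab : t a < t b)
    (hb : ∀ p ∈ P, t p < t b) (hinj : ∀ p ∈ P, ∀ q ∈ P, t p = t q → p = q)
    (hd : ∀ x ∈ insert b (insert a P), ∀ y ∈ insert b (insert a P),
      x ≠ y → dist x y ≤ |t x - t y| + ε) :
    ∃ S : Finset (Sym2 X), S ⊆ (insert b (insert a P)).sym2 ∧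
      Spans S (insert b (insert a P)) ∧
      ∑ e ∈ S, edgeLength e ≤ t b - t a + (P.card + 1) * ε := by
  induction hn : P.card generalizing P b with
  | zero =>
    obtain rfl := Finset.card_eq_zero.1 hn
    refine ⟨{s(a, b)}, by simp, ?_, ?_⟩
    · have : EdgeJoined {s(a, b)} a b := .of_mem (by simp)
      intro x hx y hy
      simp only [Finset.mem_insert, insert_empty_eq, Finset.mem_singleton] at hx hy
      rcases hx with rfl | rfl <;> rcases hy with rfl | rfl
      exacts [.refl _ _, this.symm, this, .refl _ _]
    · have := hd b (by simp) a (by simp) (fun h => by simp [h] at hab)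
      rw [abs_of_pos (by linarith), dist_comm] at this
      simpa using this
  | succ n ih =>
    -- The point with the largest coordinate comes last before `b`. Coordinate differences
    -- telescope, and each of the `P.card + 1` edges adds one error `ε`.
    obtain ⟨p, hp, hmax⟩ := P.exists_max_image t (Finset.card_pos.1 (by omega))
    have hcard : (P.erase p).card = n := by rw [Finset.card_erase_of_mem hp]; omega
    have heq : insert p (insert a (P.erase p)) = insert a P := by
      rw [Finset.insert_comm, Finset.insert_erase hp]
    have hsub : insert p (insert a (P.erase p)) ⊆ insert b (insert a P) := by
      rw [heq]; exact Finset.subset_insert _ _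
    obtain ⟨S, hSV, hS, hlen⟩ := ih (P.erase p) (fun q hq => ha q (Finset.mem_of_mem_erase hq)) p
      (ha p hp) (fun q hq => (hmax q (Finset.mem_of_mem_erase hq)).lt_of_ne fun h =>
        (Finset.ne_of_mem_erase hq) (hinj q (Finset.mem_of_mem_erase hq) p hp h))
      (fun q hq q' hq' => hinj q (Finset.mem_of_mem_erase hq) q' (Finset.mem_of_mem_erase hq'))
      (fun x hx y hy => hd x (hsub hx) y (hsub hy)) hcard
    rw [heq] at hSV hS
    have hjoin : EdgeJoined (insert s(p, b) S) p b := .of_mem (Finset.mem_insert_self _ _)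
    have hall : ∀ x ∈ insert b (insert a P), EdgeJoined (insert s(p, b) S) x p := by
      intro x hx
      rcases Finset.mem_insert.1 hx with rfl | hx
      · exact hjoin.symm
      · exact (hS x hx p (Finset.mem_insert_of_mem hp)).mono (Finset.subset_insert _ _)
    refine ⟨insert s(p, b) S, ?_, fun x hx y hy => (hall x hx).trans (hall y hy).symm, ?_⟩
    · refine Finset.insert_subset ?_ (hSV.trans (Finset.sym2_mono (Finset.subset_insert _ _)))
      simp [hp]
    · have hpb := hd p (by simp [hp]) b (by simp) (fun h => (hb p hp).ne (by rw [h]))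
      rw [abs_of_neg (by linarith [hb p hp])] at hpb
      have : ∑ e ∈ insert s(p, b) S, edgeLength e ≤ dist p b + ∑ e ∈ S, edgeLength e := by
        by_cases h : s(p, b) ∈ S
        · rw [Finset.insert_eq_of_mem h]
          linarith [dist_nonneg (x := p) (y := b)]
        · rw [Finset.sum_insert h, edgeLength_mk]
      push_cast
      linarith

/-! ### Refining a minimal spanning edge set -/

/-- The weight `ℓ + min ℓ R` of an edge of length `ℓ`. -/
noncomputable def edgeWeight {X : Type*} [MetricSpace X] (R : ℝ) (e : Sym2 X) : ℝ :=
  edgeLength e + min (edgeLength e) R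

theorem edgeWeight_nonneg {X : Type*} [MetricSpace X] {R : ℝ} (hR : 0 ≤ R) (e : Sym2 X) :
    0 ≤ edgeWeight R e :=
  add_nonneg (edgeLength_nonneg e) (le_min (edgeLength_nonneg e) hR)

theorem edgeWeight_le_two_mul {X : Type*} [MetricSpace X] (R : ℝ) (e : Sym2 X) :
    edgeWeight R e ≤ 2 * edgeLength e := by
  have := min_le_left (edgeLength e) R
  unfold edgeWeight
  linarith

theorem edgeLength_le_edgeWeight {X : Type*} [MetricSpace X] {R : ℝ} (hR : 0 ≤ R) (e : Sym2 X) :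
    edgeLength e ≤ edgeWeight R e :=
  le_add_of_nonneg_right (le_min (edgeLength_nonneg e) hR)

theorem edgeWeight_mono {X : Type*} [MetricSpace X] {R R' : ℝ} (hR : R ≤ R') (e : Sym2 X) :
    edgeWeight R e ≤ edgeWeight R' e :=
  add_le_add le_rfl (min_le_min_left _ hR)

/-- `S` is an edge set without loops that spans `V` and has the least weight. -/
structure IsMinimalSpanning {X : Type*} [MetricSpace X] (R : ℝ) (V : Finset X)
    (S : Finset (Sym2 X)) : Prop where
  subset : S ⊆ V.sym2
  spans : Spans S V
  not_isDiag : ∀ e ∈ S, ¬ e.IsDiag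
  le : ∀ T ⊆ V.sym2, Spans T V → ∑ e ∈ S, edgeWeight R e ≤ ∑ e ∈ T, edgeWeight R e

theorem exists_isMinimalSpanning {X : Type*} [MetricSpace X] {R : ℝ} (hR : 0 ≤ R)
    (V : Finset X) : ∃ S, IsMinimalSpanning R V S := by
  classical
  have hne : (V.sym2.powerset.filter fun S => Spans S V).Nonempty :=
    ⟨V.sym2, by
      simp only [Finset.mem_filter, Finset.mem_powerset, subset_refl, true_and]
      exact fun x hx y hy => .of_mem (Finset.mk_mem_sym2_iff.2 ⟨hx, hy⟩)⟩
  obtain ⟨S, hS, hmin⟩ := Finset.exists_min_image _ (fun S => ∑ e ∈ S, edgeWeight R e) hne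
  simp only [Finset.mem_filter, Finset.mem_powerset] at hS hmin
  refine ⟨S.filter fun e => ¬ e.IsDiag, (Finset.filter_subset _ _).trans hS.1, ?_,
    fun e he => (Finset.mem_filter.1 he).2, fun T hT hTV => le_trans ?_ (hmin T ⟨hT, hTV⟩)⟩
  · refine fun x hx y hy => (hS.2 x hx y hy).of_edges fun a b hab => ?_
    by_cases h : a = b
    · exact h ▸ .refl _ _
    · exact .of_mem (Finset.mem_filter.2 ⟨hab, by simpa using h⟩)
  · exact Finset.sum_le_sum_of_subset_of_nonneg (Finset.filter_subset _ _)
      fun e _ _ => edgeWeight_nonneg hR e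

/-- Strict monotonicity turns minimality of weight into a comparison of lengths. -/
theorem edgeWeight_lt {X : Type*} [MetricSpace X] {R : ℝ} {e e' : Sym2 X}
    (h : edgeLength e < edgeLength e') : edgeWeight R e < edgeWeight R e' :=
  add_lt_add_of_lt_of_le h (min_le_min_right _ h.le)

/-- In a minimal spanning edge set, an edge cannot be replaced by a shorter one that closes a
triangle with a second edge. -/
theorem IsMinimalSpanning.dist_le_of_triangle {X : Type*} [MetricSpace X] {R : ℝ} (hR : 0 ≤ R)
    {V : Finset X} {S : Finset (Sym2 X)} (hS : IsMinimalSpanning R V S) {a b c : X} (hbc : b ≠ c)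
    (hab : s(a, b) ∈ S) (hac : s(a, c) ∈ S) : dist a c ≤ dist b c := by
  classical
  by_contra! hlt
  -- Exchange of `ac` for `bc`: the points `a` and `c` remain joined through `b`.
  set T := insert s(b, c) (S.erase s(a, c)) with hT
  have hb := (Finset.mk_mem_sym2_iff.1 (hS.subset hab)).2
  have hc := (Finset.mk_mem_sym2_iff.1 (hS.subset hac)).2
  have hTV : T ⊆ V.sym2 := Finset.insert_subset (Finset.mk_mem_sym2_iff.2 ⟨hb, hc⟩)
    ((Finset.erase_subset _ _).trans hS.subset)
  have hac' : EdgeJoined T a c := by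
    refine EdgeJoined.trans (y := b) (.of_mem ?_) (.of_mem (Finset.mem_insert_self _ _))
    refine Finset.mem_insert_of_mem (Finset.mem_erase.2 ⟨?_, hab⟩)
    rw [Ne, Sym2.eq_iff]
    rintro (⟨-, h⟩ | ⟨h, h'⟩)
    exacts [hbc h, hbc (h'.trans h)]
  have hTs : Spans T V := by
    refine fun x hx y hy => (hS.spans x hx y hy).of_edges fun u v huv => ?_
    by_cases h : s(u, v) = s(a, c)
    · rcases Sym2.eq_iff.1 h with ⟨rfl, rfl⟩ | ⟨rfl, rfl⟩
      exacts [hac', hac'.symm]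
    · exact .of_mem (Finset.mem_insert_of_mem (Finset.mem_erase.2 ⟨h, huv⟩))
  have h1 := hS.le T hTV hTs
  have h2 : ∑ e ∈ T, edgeWeight R e ≤
      edgeWeight R s(b, c) + ∑ e ∈ S.erase s(a, c), edgeWeight R e := by
    by_cases h : s(b, c) ∈ S.erase s(a, c)
    · rw [hT, Finset.insert_eq_of_mem h]
      linarith [edgeWeight_nonneg hR s(b, c)]
    · rw [hT, Finset.sum_insert h]
  have h3 := Finset.add_sum_erase S (edgeWeight R) hac
  have h4 : edgeWeight R s(b, c) < edgeWeight R s(a, c) := edgeWeight_lt hlt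
  linarith

/-- The number of edges of `F` at the vertex `a`. -/
noncomputable def edgeDegree {X : Type*} (F : Finset (Sym2 X)) (a : X) : ℕ := by
  classical exact (F.filter fun e => a ∈ e).card

/-- Double counting of incidences; without loops each edge has two ends. -/
theorem sum_edgeDegree {X : Type*} {V : Finset X} {F : Finset (Sym2 X)}
    (hF : F ⊆ V.sym2) (hd : ∀ e ∈ F, ¬ e.IsDiag) : ∑ a ∈ V, edgeDegree F a = 2 * F.card := by
  classical
  unfold edgeDegree
  refine (Finset.sum_card_bipartiteAbove_eq_sum_card_bipartiteBelow (s := V) (t := F)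
    (fun a e => a ∈ e)).trans ?_
  rw [Finset.sum_congr rfl (g := fun _ => 2), Finset.sum_const, smul_eq_mul, mul_comm]
  intro e he
  rw [← Sym2.card_toFinset_of_not_isDiag e (hd e he)]
  congr 1
  ext x
  simp only [Finset.bipartiteBelow, Finset.mem_filter, Sym2.mem_toFinset, and_iff_right_iff_imp]
  exact fun hx => Finset.mem_sym2_iff.1 (hF he) x hx

/-! ### Almost isometric coordinates and the passage to the next net -/

/-- `t` is a coordinate on `Y`, isometric up to the error `δ`. -/
def IsCoordinate {X : Type*} [MetricSpace X] (Y : Set X) (δ : ℝ) (t : X → ℝ) : Prop :=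
  (∀ x y, |t x - t y| ≤ dist x y) ∧ ∀ x ∈ Y, ∀ y ∈ Y, x ≠ y → dist x y ≤ |t x - t y| + δ

theorem IsCoordinate.neg {X : Type*} [MetricSpace X] {Y : Set X} {δ : ℝ} {t : X → ℝ}
    (h : IsCoordinate Y δ t) : IsCoordinate Y δ (fun x => -t x) := by
  have e : ∀ x y, |(-t x) - (-t y)| = |t x - t y| := fun x y => by
    rw [← abs_neg]; congr 1; ring
  exact ⟨fun x y => by rw [e]; exact h.1 x y, fun x hx y hy hxy => by rw [e]; exact h.2 x hx y hy hxy⟩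

/-- Two consecutive finite nets of scales `r` and `r / 2`, with almost isometric coordinates near
the points of the first. -/
structure NetStep {X : Type*} [MetricSpace X] (V V' : Finset X) (r : ℝ) (M M' : ℕ)
    (ε : X → ℝ) : Prop where
  pos : 0 < r
  one_le : 1 ≤ M
  subset : V ⊆ V'
  separated : ∀ x ∈ V, ∀ y ∈ V, x ≠ y → r ≤ dist x y
  separated' : ∀ x ∈ V', ∀ y ∈ V', x ≠ y → r / 2 ≤ dist x y
  near : ∀ p ∈ V', ∃ a ∈ V, dist p a ≤ 2 * r
  card_le : ∀ a ∈ V, ∀ P ⊆ V', (∀ p ∈ P, dist p a ≤ 2 * r) → P.card ≤ M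
  card_le' : ∀ a ∈ V, ∀ P ⊆ V, (∀ p ∈ P, dist p a ≤ 16 * M * r) → P.card ≤ M'
  nonneg : ∀ a ∈ V, 0 ≤ ε a
  coord : ∀ a ∈ V, ∃ t, IsCoordinate {x | x ∈ V' ∧ dist x a ≤ 16 * M * r} (ε a * r) t

/-- `p` lies well between `a` and `b`. -/
def MetricBetween {X : Type*} [MetricSpace X] (r : ℝ) (p a b : X) : Prop :=
  dist p a ≤ dist a b - r / 4 ∧ dist p b ≤ dist a b - r / 4

theorem MetricBetween.symm {X : Type*} [MetricSpace X] {r : ℝ} {p a b : X}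
    (h : MetricBetween r p a b) : MetricBetween r p b a :=
  ⟨by rw [dist_comm b]; exact h.2, by rw [dist_comm b]; exact h.1⟩

/-- The slack `r / 4` in betweenness exceeds the coordinate error. -/
theorem IsCoordinate.lt_of_metricBetween {X : Type*} [MetricSpace X] {Y : Set X} {δ r : ℝ}
    {t : X → ℝ} (ht : IsCoordinate Y δ t) (hr : 0 < r) (hδ : δ ≤ r / 16) {p a b : X} (ha : a ∈ Y)
    (hb : b ∈ Y) (hab : t a < t b) (h : MetricBetween r p a b) : t a < t p ∧ t p < t b := by
  have h1 := ht.2 a ha b hb (fun h => hab.ne (by rw [h]))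
  rw [abs_of_neg (by linarith)] at h1
  have h2 := (le_abs_self _).trans (ht.1 p a)
  have h3 := (neg_le_abs _).trans (ht.1 p b)
  constructor <;> linarith [h.1, h.2]

/-- If `p` lay beyond `b`, it would be closer to `b` than to `a`, since `b` is ahead of `a` by
almost `r`. So `p` precedes `b`, and the separation `r / 2` leaves the slack `r / 4` after the
errors. -/
theorem IsCoordinate.metricBetween {X : Type*} [MetricSpace X] {Y : Set X} {δ r : ℝ}
    {t : X → ℝ} (ht : IsCoordinate Y δ t) (hδ : δ ≤ r / 16) {p a b : X} (hp : p ∈ Y)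
    (ha : a ∈ Y) (hb : b ∈ Y) (hpa : r / 2 ≤ dist p a) (hpb : r / 2 ≤ dist p b)
    (hr : 0 < r) (hrab : r ≤ dist a b) (hnear : dist p a ≤ dist p b) (hab : t a < t b)
    (hap : t a < t p) : MetricBetween r p a b := by
  have ne : ∀ {x y : X} {c : ℝ}, 0 < c → c ≤ dist x y → x ≠ y := fun hc h e => by
    rw [e, dist_self] at h; linarith
  have h1 := ht.2 a ha b hb (ne hr hrab)
  have h2 := ht.2 p hp a ha (ne (half_pos hr) hpa)
  have h3 := ht.2 p hp b hb (ne (half_pos hr) hpb)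
  have h4 := ht.1 a b
  have h5 := ht.1 p a
  rw [abs_of_neg (by linarith)] at h1 h4
  rw [abs_of_pos (by linarith)] at h2 h5
  rcases lt_or_ge (t p) (t b) with h | h
  · rw [abs_of_neg (by linarith)] at h3
    constructor <;> linarith
  · rw [abs_of_nonneg (by linarith)] at h3
    linarith

/-- The nearer of `b` and `c` lies almost on the way to the other, so `bc` is shorter than the
longer edge at `a` by almost `r`, against the triangle exchange. -/
theorem IsMinimalSpanning.not_same_side {X : Type*} [MetricSpace X] {R : ℝ} (hR : 0 ≤ R)
    {V : Finset X} {S : Finset (Sym2 X)} (hS : IsMinimalSpanning R V S) {Y : Set X} {δ r : ℝ}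
    {t : X → ℝ} (ht : IsCoordinate Y δ t) (hδ : δ ≤ r / 16)
    (hsep : ∀ x ∈ V, ∀ y ∈ V, x ≠ y → r ≤ dist x y) {a b c : X} (hbc : b ≠ c)
    (hab : s(a, b) ∈ S) (hac : s(a, c) ∈ S) (ha : a ∈ Y) (hb : b ∈ Y) (hc : c ∈ Y)
    (h1 : t a < t b) (h2 : t a < t c) : False := by
  have haV := (Finset.mk_mem_sym2_iff.1 (hS.subset hab)).1
  have hbV := (Finset.mk_mem_sym2_iff.1 (hS.subset hab)).2
  have hcV := (Finset.mk_mem_sym2_iff.1 (hS.subset hac)).2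
  have h3 := hS.dist_le_of_triangle hR hbc hab hac
  have h4 := hS.dist_le_of_triangle hR hbc.symm hac hab
  have h5 := hsep b hbV c hcV hbc
  have h6 := hsep a haV b hbV (fun h => h1.ne (by rw [h]))
  have h6' := hsep a haV c hcV (fun h => h2.ne (by rw [h]))
  have h7 := ht.2 b hb c hc hbc
  have h8 := ht.2 a ha b hb (fun h => h1.ne (by rw [h]))
  have h8' := ht.2 a ha c hc (fun h => h2.ne (by rw [h]))
  have h9 := ht.1 a b
  have h10 := ht.1 a c
  rw [abs_of_neg (by linarith)] at h8 h8' h9 h10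
  rw [dist_comm c b] at h4
  rcases le_total (t b) (t c) with h | h
  · rw [abs_of_nonpos (by linarith)] at h7
    linarith
  · rw [abs_of_nonneg (by linarith)] at h7
    linarith

namespace NetStep

theorem exists_edge {X : Type*} {F : Finset (Sym2 X)} {a : X} {e : Sym2 X} (he : e ∈ F) (ha : a ∈ e) :
    ∃ b, e = s(a, b) ∧ s(a, b) ∈ F := by
  obtain ⟨b, rfl⟩ := Sym2.mem_iff_exists.1 ha
  exact ⟨b, rfl, he⟩

variable {X : Type*} [MetricSpace X] {V V' : Finset X} {r : ℝ} {M M' : ℕ} {ε : X → ℝ}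

theorem radius_nonneg (h : NetStep V V' r M M' ε) : 0 ≤ 16 * M * r := by
  have := h.pos
  positivity

theorem exists_nearest (h : NetStep V V' r M M' ε) :
    ∃ π : X → X, ∀ p ∈ V', π p ∈ V ∧ dist p (π p) ≤ 2 * r ∧ ∀ b ∈ V, dist p (π p) ≤ dist p b := by
  have : ∀ p, ∃ a, p ∈ V' → a ∈ V ∧ dist p a ≤ 2 * r ∧ ∀ b ∈ V, dist p a ≤ dist p b := by
    intro p
    by_cases hp : p ∈ V'
    · obtain ⟨a, ha, hpa⟩ := h.near p hp
      obtain ⟨c, hc, hmin⟩ := V.exists_min_image (dist p) ⟨a, ha⟩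
      exact ⟨c, fun _ => ⟨hc, (hmin a ha).trans hpa, hmin⟩⟩
    · exact ⟨p, fun h => absurd h hp⟩
  choose π hπ using this
  exact ⟨π, hπ⟩

/-- At a flat vertex two distinct short edges of a minimal spanning set lie on opposite sides. -/
theorem opposite (h : NetStep V V' r M M' ε) {S : Finset (Sym2 X)}
    (hS : IsMinimalSpanning (16 * M * r) V S) {a b c : X} (hbc : b ≠ c)
    (hab : s(a, b) ∈ S) (hac : s(a, c) ∈ S) (hb : dist a b ≤ 16 * M * r)
    (hc : dist a c ≤ 16 * M * r) {t : X → ℝ} (hε : ε a ≤ 1 / 16)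
    (ht : IsCoordinate {x | x ∈ V' ∧ dist x a ≤ 16 * M * r} (ε a * r) t) :
    (t b < t a ∧ t a < t c) ∨ (t c < t a ∧ t a < t b) := by
  have hr := h.pos
  have hδ : ε a * r ≤ r / 16 := by
    have := mul_le_mul_of_nonneg_right hε hr.le
    linarith
  have haV := (Finset.mk_mem_sym2_iff.1 (hS.subset hab)).1
  have hbV := (Finset.mk_mem_sym2_iff.1 (hS.subset hab)).2
  have hcV := (Finset.mk_mem_sym2_iff.1 (hS.subset hac)).2
  have haY : a ∈ {x | x ∈ V' ∧ dist x a ≤ 16 * M * r} :=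
    ⟨h.subset haV, by simpa using h.radius_nonneg⟩
  have hbY : b ∈ {x | x ∈ V' ∧ dist x a ≤ 16 * M * r} := ⟨h.subset hbV, by rwa [dist_comm]⟩
  have hcY : c ∈ {x | x ∈ V' ∧ dist x a ≤ 16 * M * r} := ⟨h.subset hcV, by rwa [dist_comm]⟩
  have hne : ∀ {x}, s(a, x) ∈ S → x ∈ V → x ∈ {x | x ∈ V' ∧ dist x a ≤ 16 * M * r} →
      t a ≠ t x := by
    intro x hx hxV hxY he
    have hax : a ≠ x := by simpa using hS.not_isDiag _ hx
    have h1 := h.separated a haV x hxV hax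
    have h2 := ht.2 a haY x hxY hax
    rw [he, sub_self, abs_zero] at h2
    linarith
  have key1 := hS.not_same_side h.radius_nonneg ht hδ h.separated hbc hab hac haY hbY hcY
  have key2 := hS.not_same_side h.radius_nonneg ht.neg hδ h.separated hbc hab hac haY hbY hcY
  simp only [neg_lt_neg_iff] at key2
  rcases lt_or_gt_of_ne (hne hab hbV hbY) with h1 | h1 <;>
    rcases lt_or_gt_of_ne (hne hac hcV hcY) with h2 | h2
  exacts [(key1 h1 h2).elim, .inr ⟨h2, h1⟩, .inl ⟨h1, h2⟩, (key2 h1 h2).elim]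

theorem mem_short {S : Finset (Sym2 X)} {R : ℝ} {a b : X}
    (hab : s(a, b) ∈ S.filter fun e => edgeLength e ≤ R) : s(a, b) ∈ S ∧ dist a b ≤ R := by
  simpa using hab

/-- Among three short edges two would leave `a` on the same side. -/
theorem edgeDegree_le_two (h : NetStep V V' r M M' ε) {S : Finset (Sym2 X)}
    (hS : IsMinimalSpanning (16 * M * r) V S) {a : X} (ha : a ∈ V) (hε : ε a ≤ 1 / 16) :
    edgeDegree (S.filter fun e => edgeLength e ≤ 16 * M * r) a ≤ 2 := by
  classical
  by_contra! hcon
  obtain ⟨t, ht⟩ := h.coord a ha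
  unfold edgeDegree at hcon
  obtain ⟨e₁, h1, e₂, h2, e₃, h3, h12, h13, h23⟩ := Finset.two_lt_card.1 hcon
  simp only [Finset.mem_filter (p := fun e => a ∈ e)] at h1 h2 h3
  obtain ⟨b₁, rfl, hb1⟩ := exists_edge h1.1 h1.2
  obtain ⟨b₂, rfl, hb2⟩ := exists_edge h2.1 h2.2
  obtain ⟨b₃, rfl, hb3⟩ := exists_edge h3.1 h3.2
  obtain ⟨hb1, hd1⟩ := mem_short hb1
  obtain ⟨hb2, hd2⟩ := mem_short hb2
  obtain ⟨hb3, hd3⟩ := mem_short hb3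
  have := h.opposite hS (fun h => h12 (by rw [h])) hb1 hb2 hd1 hd2 hε ht
  have := h.opposite hS (fun h => h13 (by rw [h])) hb1 hb3 hd1 hd3 hε ht
  have := h.opposite hS (fun h => h23 (by rw [h])) hb2 hb3 hd2 hd3 hε ht
  grind

/-- A bound without flatness, needed where `ε a` exceeds `1 / 16`: the ends of short edges lie in
the window counted by `card_le'`. -/
theorem edgeDegree_le (h : NetStep V V' r M M' ε) {S : Finset (Sym2 X)}
    (hS : IsMinimalSpanning (16 * M * r) V S) {a : X} (ha : a ∈ V) :
    edgeDegree (S.filter fun e => edgeLength e ≤ 16 * M * r) a ≤ M' := by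
  classical
  unfold edgeDegree
  refine le_trans ?_ (h.card_le' a ha (V.filter fun b => dist b a ≤ 16 * M * r)
    (Finset.filter_subset _ _) (fun p hp => (Finset.mem_filter.1 hp).2))
  refine (Finset.card_le_card ?_).trans (Finset.card_image_le (f := fun b => s(a, b)))
  intro e he
  rw [Finset.mem_filter] at he
  obtain ⟨b, rfl, hb⟩ := exists_edge he.1 he.2
  obtain ⟨hb, hd⟩ := mem_short hb
  exact Finset.mem_image_of_mem _ (Finset.mem_filter.2
    ⟨(Finset.mk_mem_sym2_iff.1 (hS.subset hb)).2, by rwa [dist_comm]⟩)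

/-- At a flat vertex with two short edges, every new point that has this vertex as a nearest point
lies between the endpoints of a short edge. -/
theorem exists_metricBetween (h : NetStep V V' r M M' ε) {S : Finset (Sym2 X)}
    (hS : IsMinimalSpanning (16 * M * r) V S) {a p : X} (ha : a ∈ V) (hε : ε a ≤ 1 / 16)
    (hdeg : 2 ≤ edgeDegree (S.filter fun e => edgeLength e ≤ 16 * M * r) a) (hp : p ∈ V')
    (hpV : p ∉ V) (hpa : dist p a ≤ 2 * r) (hnear : ∀ b ∈ V, dist p a ≤ dist p b) :
    ∃ b, s(a, b) ∈ S.filter (fun e => edgeLength e ≤ 16 * M * r) ∧ MetricBetween r p a b := by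
  classical
  have hr := h.pos
  have hδ : ε a * r ≤ r / 16 := by
    have := mul_le_mul_of_nonneg_right hε hr.le
    linarith
  obtain ⟨t, ht⟩ := h.coord a ha
  have hM : (1 : ℝ) ≤ M := by exact_mod_cast h.one_le
  have haY : a ∈ {x | x ∈ V' ∧ dist x a ≤ 16 * M * r} :=
    ⟨h.subset ha, by simpa using h.radius_nonneg⟩
  have hpY : p ∈ {x | x ∈ V' ∧ dist x a ≤ 16 * M * r} := ⟨hp, by nlinarith⟩
  have hpa0 : p ≠ a := fun h => hpV (h ▸ ha)
  have hpa' := h.separated' p hp a (h.subset ha) hpa0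
  unfold edgeDegree at hdeg
  obtain ⟨e₁, h1, e₂, h2, h12⟩ := Finset.one_lt_card.1 hdeg
  simp only [Finset.mem_filter (p := fun e => a ∈ e)] at h1 h2
  obtain ⟨b₁, rfl, hb1⟩ := exists_edge h1.1 h1.2
  obtain ⟨b₂, rfl, hb2⟩ := exists_edge h2.1 h2.2
  obtain ⟨hb1', hd1⟩ := mem_short hb1
  obtain ⟨hb2', hd2⟩ := mem_short hb2
  have key : ∀ (t : X → ℝ), IsCoordinate {x | x ∈ V' ∧ dist x a ≤ 16 * M * r} (ε a * r) t →
      ∀ b, s(a, b) ∈ S → dist a b ≤ 16 * M * r → t a < t b → t a < t p →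
        MetricBetween r p a b := by
    intro t ht b hb hd hab hap
    have hbV := (Finset.mk_mem_sym2_iff.1 (hS.subset hb)).2
    exact ht.metricBetween hδ hpY haY ⟨h.subset hbV, by rwa [dist_comm]⟩ hpa'
      (h.separated' p hp b (h.subset hbV) (fun h => hpV (h ▸ hbV))) hr
      (h.separated a ha b hbV (fun h => hab.ne (by rw [h]))) (hnear b hbV) hab hap
  have hside : t a < t p ∨ t p < t a := by
    refine lt_or_gt_of_ne fun he => ?_
    have := ht.2 p hpY a haY hpa0
    rw [he, sub_self, abs_zero] at this
    linarith
  -- The two short edges leave `a` on opposite sides; the one on the side of `p` is taken, after a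
  -- change of sign of the coordinate if necessary.
  rcases h.opposite hS (fun h => h12 (by rw [h])) hb1' hb2' hd1 hd2 hε ht with ⟨h1, h2⟩ | ⟨h1, h2⟩ <;>
    rcases hside with h3 | h3
  · exact ⟨b₂, hb2, key t ht b₂ hb2' hd2 h2 h3⟩
  · exact ⟨b₁, hb1, key _ ht.neg b₁ hb1' hd1 (neg_lt_neg h1) (neg_lt_neg h3)⟩
  · exact ⟨b₁, hb1, key t ht b₁ hb1' hd1 h2 h3⟩
  · exact ⟨b₂, hb2, key _ ht.neg b₂ hb2' hd2 (neg_lt_neg h1) (neg_lt_neg h3)⟩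

/-- The new points between the endpoints of a short edge at a flat vertex can be inserted. -/
theorem exists_insertion [DecidableEq X] (h : NetStep V V' r M M' ε) {a b : X} (ha : a ∈ V)
    (hb : b ∈ V) (hab : a ≠ b) (hd : dist a b ≤ 16 * M * r) (hε : ε a ≤ 1 / 16) (P : Finset X)
    (hP : P ⊆ V') (hPb : ∀ p ∈ P, MetricBetween r p a b) :
    ∃ T : Finset (Sym2 X), T ⊆ V'.sym2 ∧ Spans T (insert b (insert a P)) ∧
      ∑ e ∈ T, edgeLength e ≤ dist a b + (P.card + 1) * (ε a * r) := by
  have hr := h.pos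
  have hδ : ε a * r ≤ r / 16 := by
    have := mul_le_mul_of_nonneg_right hε hr.le
    linarith
  have haY : a ∈ {x | x ∈ V' ∧ dist x a ≤ 16 * M * r} :=
    ⟨h.subset ha, by simpa using h.radius_nonneg⟩
  have hbY : b ∈ {x | x ∈ V' ∧ dist x a ≤ 16 * M * r} := ⟨h.subset hb, by rwa [dist_comm]⟩
  have hPY : ∀ p ∈ P, p ∈ {x | x ∈ V' ∧ dist x a ≤ 16 * M * r} :=
    fun p hp => ⟨hP hp, by linarith [(hPb p hp).1]⟩
  have key : ∀ (t : X → ℝ), IsCoordinate {x | x ∈ V' ∧ dist x a ≤ 16 * M * r} (ε a * r) t →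
      t a < t b → ∃ T : Finset (Sym2 X), T ⊆ V'.sym2 ∧ Spans T (insert b (insert a P)) ∧
      ∑ e ∈ T, edgeLength e ≤ dist a b + (P.card + 1) * (ε a * r) := by
    intro t ht hlt
    have hall : ∀ x ∈ insert b (insert a P), x ∈ {x | x ∈ V' ∧ dist x a ≤ 16 * M * r} := by
      intro x hx
      rcases Finset.mem_insert.1 hx with rfl | hx
      · exact hbY
      rcases Finset.mem_insert.1 hx with rfl | hx
      exacts [haY, hPY x hx]
    obtain ⟨T, hT, hTs, hlen⟩ := exists_path t (ε a * r) a P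
      (fun p hp => (ht.lt_of_metricBetween hr hδ haY hbY hlt (hPb p hp)).1) b hlt
      (fun p hp => (ht.lt_of_metricBetween hr hδ haY hbY hlt (hPb p hp)).2)
      (fun p hp q hq he => by
        by_contra hne
        have h1 := h.separated' p (hP hp) q (hP hq) hne
        have h2 := ht.2 p (hPY p hp) q (hPY q hq) hne
        rw [he, sub_self, abs_zero] at h2
        linarith)
      (fun x hx y hy => ht.2 x (hall x hx) y (hall y hy))
    refine ⟨T, hT.trans (Finset.sym2_mono fun x hx => (hall x hx).1), hTs, hlen.trans ?_⟩
    have := (neg_le_abs _).trans (ht.1 a b)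
    linarith
  obtain ⟨t, ht⟩ := h.coord a ha
  rcases lt_trichotomy (t a) (t b) with hlt | he | hlt
  · exact key t ht hlt
  · have h1 := h.separated a ha b hb hab
    have h2 := ht.2 a haY b hbY hab
    rw [he, sub_self, abs_zero] at h2
    linarith
  · exact key _ ht.neg (neg_lt_neg hlt)

/-- The number of new points that are attached by an edge of their own. -/
theorem card_leaves_le [DecidableEq X] (h : NetStep V V' r M M' ε) {S : Finset (Sym2 X)}
    (hS : IsMinimalSpanning (16 * M * r) V S) {π : X → X}
    (hπ : ∀ p ∈ V', π p ∈ V ∧ dist p (π p) ≤ 2 * r ∧ ∀ b ∈ V, dist p (π p) ≤ dist p b)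
    (P : Finset X) (hP : P ⊆ V' \ V)
    (hPb : ∀ p ∈ P, ε (π p) ≤ 1 / 16 →
      ¬ ∃ b, s(π p, b) ∈ S.filter (fun e => edgeLength e ≤ 16 * M * r) ∧
        MetricBetween r p (π p) b) :
    (P.card : ℝ) ≤ M * (2 + 2 * (S.filter fun e => ¬ edgeLength e ≤ 16 * M * r).card) +
      16 * (M * (1 + M')) * ∑ a ∈ V, ε a := by
  classical
  set F := S.filter fun e => edgeLength e ≤ 16 * M * r with hF
  have hPV' : ∀ p ∈ P, p ∈ V' ∧ p ∉ V := fun p hp => Finset.mem_sdiff.1 (hP hp)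
  have hcard : P.card = ∑ a ∈ V, (P.filter fun p => π p = a).card :=
    Finset.card_eq_sum_card_fiberwise fun p hp => (hπ p (hPV' p hp).1).1
  have hM : (1 : ℝ) ≤ M := by exact_mod_cast h.one_le
  -- A flat vertex with two short edges has no leaves; any other flat vertex has at most `M ≤ M * (2
  -- - degree)`. At the remaining vertices `16 * ε a > 1` pays both for the leaves and for a
  -- possibly negative `2 - degree`.
  have hfib : ∀ a ∈ V, ((P.filter fun p => π p = a).card : ℝ) ≤
      M * (2 - edgeDegree F a) + 16 * (M * (1 + M')) * ε a := by
    intro a ha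
    have h1 : ((P.filter fun p => π p = a).card : ℝ) ≤ M := by
      exact_mod_cast h.card_le a ha _ (fun p hp => (hPV' p (Finset.mem_filter.1 hp).1).1)
        (fun p hp => by
          have hp := Finset.mem_filter.1 hp
          exact hp.2 ▸ (hπ p (hPV' p hp.1).1).2.1)
    have h2 : (edgeDegree F a : ℝ) ≤ M' := Nat.cast_le.2 (h.edgeDegree_le hS ha)
    have h0 := h.nonneg a ha
    by_cases hε : ε a ≤ 1 / 16
    · have h3 : 0 ≤ 16 * (M * (1 + (M' : ℝ))) * ε a := by positivity
      have h4 : edgeDegree F a ≤ 2 := h.edgeDegree_le_two hS ha hε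
      rcases h4.eq_or_lt with h4 | h4
      · have : (P.filter fun p => π p = a) = ∅ := by
          refine Finset.filter_eq_empty_iff.2 fun p hp hpa => ?_
          subst hpa
          have := hπ p (hPV' p hp).1
          exact hPb p hp hε (h.exists_metricBetween hS ha hε h4.ge (hPV' p hp).1
            (hPV' p hp).2 this.2.1 this.2.2)
        rw [this, h4]
        simpa using h3
      · have h5 : (edgeDegree F a : ℝ) ≤ 1 := by exact_mod_cast Nat.lt_succ_iff.1 h4
        nlinarith
    · push Not at hε
      have h3 : (M * (1 + (M' : ℝ))) * 1 ≤ (M * (1 + (M' : ℝ))) * (16 * ε a) :=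
        mul_le_mul_of_nonneg_left (by linarith) (by positivity)
      have h4 : (M : ℝ) * edgeDegree F a ≤ M * M' := mul_le_mul_of_nonneg_left h2 (by linarith)
      nlinarith
  -- The sum of `2 - degree` is `2 * V.card - 2 * F.card`, and `V.card ≤ S.card + 1` bounds it by
  -- two plus twice the number of long edges.
  have hdeg : ∑ a ∈ V, (edgeDegree F a : ℝ) = 2 * F.card := by
    exact_mod_cast sum_edgeDegree (V := V) ((Finset.filter_subset _ _).trans hS.subset)
      (fun e he => hS.not_isDiag e (Finset.mem_filter.1 he).1)
  have hSF : (F.card : ℝ) + (S.filter fun e => ¬ edgeLength e ≤ 16 * M * r).card = S.card := by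
    rw [← Nat.cast_add, hF, Finset.card_filter_add_card_filter_not]
  have hVS : (V.card : ℝ) ≤ S.card + 1 := by exact_mod_cast hS.spans.card_le hS.subset
  rw [hcard, Nat.cast_sum]
  refine (Finset.sum_le_sum hfib).trans ?_
  rw [Finset.sum_add_distrib, ← Finset.mul_sum, ← Finset.mul_sum, Finset.sum_sub_distrib, hdeg,
    Finset.sum_const, nsmul_eq_mul]
  gcongr
  linarith

theorem _root_.Finset.sum_union_le {α : Type*} [DecidableEq α] {w : α → ℝ}
    (hw : ∀ x, 0 ≤ w x) (s t : Finset α) :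
    ∑ x ∈ s ∪ t, w x ≤ ∑ x ∈ s, w x + ∑ x ∈ t, w x := by
  rw [← Finset.sum_union_inter]
  exact le_add_of_nonneg_right (Finset.sum_nonneg fun e _ => hw e)

theorem _root_.Finset.sum_biUnion_le {ι α : Type*} [DecidableEq α] {w : α → ℝ}
    (hw : ∀ x, 0 ≤ w x) (s : Finset ι) (t : ι → Finset α) :
    ∑ x ∈ s.biUnion t, w x ≤ ∑ i ∈ s, ∑ x ∈ t i, w x := by
  classical
  induction s using Finset.induction_on with
  | empty => simp
  | insert i s hi ih =>
    rw [Finset.biUnion_insert, Finset.sum_insert hi]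
    exact (Finset.sum_union_le hw _ _).trans (add_le_add le_rfl ih)

/-- Each point of `V` is the chosen nearest point of at most `M` points. -/
theorem sum_comp_nearest_le [DecidableEq X] (h : NetStep V V' r M M' ε) {π : X → X}
    (hπ : ∀ p ∈ V', π p ∈ V ∧ dist p (π p) ≤ 2 * r ∧ ∀ b ∈ V, dist p (π p) ≤ dist p b)
    (P : Finset X) (hP : P ⊆ V') : ∑ p ∈ P, ε (π p) ≤ M * ∑ a ∈ V, ε a := by
  rw [← Finset.sum_fiberwise_of_maps_to (fun p hp => (hπ p (hP hp)).1), Finset.mul_sum]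
  refine Finset.sum_le_sum fun a ha => ?_
  rw [Finset.sum_congr rfl (g := fun _ => ε a) (by
    intro p hp; rw [(Finset.mem_filter.1 hp).2]), Finset.sum_const, nsmul_eq_mul]
  refine mul_le_mul_of_nonneg_right ?_ (h.nonneg a ha)
  exact_mod_cast h.card_le a ha _ ((Finset.filter_subset _ _).trans hP) (fun p hp => by
    have hp := Finset.mem_filter.1 hp
    exact hp.2 ▸ (hπ p (hP hp.1)).2.1)

/-- The weight of a minimal spanning set grows in a controlled way from one net to the next. -/
theorem exists_spans (h : NetStep V V' r M M' ε) {S : Finset (Sym2 X)}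
    (hS : IsMinimalSpanning (16 * M * r) V S) :
    ∃ T ⊆ V'.sym2, Spans T V' ∧ ∑ e ∈ T, edgeWeight (16 * M * (r / 2)) e ≤
      ∑ e ∈ S, edgeWeight (16 * M * r) e + 8 * M * r +
        (64 * (M * (1 + M')) + 2 * (2 * M + 1) * M) * (r * ∑ a ∈ V, ε a) := by
  classical
  have hr := h.pos
  have hM : (1 : ℝ) ≤ M := by exact_mod_cast h.one_le
  have hR := h.radius_nonneg
  have hR' : 16 * (M : ℝ) * (r / 2) ≤ 16 * M * r := by nlinarith
  have hR0 : 0 ≤ 16 * (M : ℝ) * (r / 2) := by positivity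
  obtain ⟨π, hπ⟩ := h.exists_nearest
  set F := S.filter fun e => edgeLength e ≤ 16 * M * r with hF
  -- the new points that are inserted into an edge, and the others
  set Q : X → Prop := fun p => ε (π p) ≤ 1 / 16 ∧ ∃ b, s(π p, b) ∈ F ∧ MetricBetween r p (π p) b
    with hQ
  set I := (V' \ V).filter Q with hI
  set Lf := (V' \ V).filter fun p => ¬ Q p with hLf
  have hIV : ∀ p ∈ I, p ∈ V' := fun p hp => (Finset.mem_sdiff.1 (Finset.mem_filter.1 hp).1).1
  have hLV : ∀ p ∈ Lf, p ∈ V' := fun p hp => (Finset.mem_sdiff.1 (Finset.mem_filter.1 hp).1).1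
  have hβ : ∀ p, ∃ b, p ∈ I → s(π p, b) ∈ F ∧ MetricBetween r p (π p) b := by
    intro p
    by_cases hp : p ∈ I
    · obtain ⟨b, hb⟩ := (Finset.mem_filter.1 hp).2.2
      exact ⟨b, fun _ => hb⟩
    · exact ⟨p, fun h => absurd h hp⟩
  choose β hβ using hβ
  set φ : X → Sym2 X := fun p => s(π p, β p) with hφ
  set D := I.image φ with hD
  have hDF : D ⊆ F := by
    intro e he
    obtain ⟨p, hp, rfl⟩ := Finset.mem_image.1 he
    exact (hβ p hp).1
  have hDS : D ⊆ S := hDF.trans (Finset.filter_subset _ _)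
  -- the paths that replace the edges of `D`
  have hpath : ∀ e, ∃ T : Finset (Sym2 X), e ∈ D → T ⊆ V'.sym2 ∧
      (∀ x y, (x ∈ e ∨ x ∈ I ∧ φ x = e) → (y ∈ e ∨ y ∈ I ∧ φ y = e) → EdgeJoined T x y) ∧
      ∑ e' ∈ T, edgeLength e' ≤
        edgeLength e + (2 * M + 1) * r * ∑ p ∈ I.filter (fun p => φ p = e), ε (π p) := by
    intro e
    by_cases he : e ∈ D
    swap
    · exact ⟨∅, fun h => absurd h he⟩
    obtain ⟨p, hp, rfl⟩ := Finset.mem_image.1 he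
    set a := π p with ha
    set b := β p with hb
    have hab := (hβ p hp).1
    obtain ⟨habS, habR⟩ := mem_short hab
    have haV := (Finset.mk_mem_sym2_iff.1 (hS.subset habS)).1
    have hbV := (Finset.mk_mem_sym2_iff.1 (hS.subset habS)).2
    have hne : a ≠ b := by simpa using hS.not_isDiag _ habS
    set P := I.filter (fun q => φ q = φ p) with hP
    have hPmem : ∀ q ∈ P, (π q = a ∧ β q = b) ∨ (π q = b ∧ β q = a) := fun q hq =>
      Sym2.eq_iff.1 (Finset.mem_filter.1 hq).2
    have hPb : ∀ q ∈ P, MetricBetween r q a b := by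
      intro q hq
      have h1 := (hβ q (Finset.mem_filter.1 hq).1).2
      rcases hPmem q hq with ⟨h2, h3⟩ | ⟨h2, h3⟩
      · rwa [h2, h3] at h1
      · rw [h2, h3] at h1
        exact h1.symm
    have hPV : P ⊆ V' := fun q hq => hIV q (Finset.mem_filter.1 hq).1
    -- The coordinate at the end `a` serves all points inserted into this edge, including those
    -- whose nearest point is `b`.
    have hεa : ε a ≤ 1 / 16 := (Finset.mem_filter.1 hp).2.1
    obtain ⟨T, hT, hTs, hlen⟩ := h.exists_insertion haV hbV hne habR hεa P hPV hPb
    have hPcard : (P.card : ℝ) ≤ 2 * M := by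
      have h1 : P ⊆ (P.filter fun q => π q = a) ∪ P.filter fun q => π q = b := by
        intro q hq
        simp only [Finset.mem_union, Finset.mem_filter]
        rcases hPmem q hq with ⟨h2, -⟩ | ⟨h2, -⟩
        exacts [.inl ⟨hq, h2⟩, .inr ⟨hq, h2⟩]
      have h2 : ∀ c ∈ V, (P.filter fun q => π q = c).card ≤ M := fun c hc =>
        h.card_le c hc _ ((Finset.filter_subset _ _).trans hPV) (fun q hq => by
          have hq := Finset.mem_filter.1 hq
          exact hq.2 ▸ (hπ q (hPV hq.1)).2.1)
      have h3 := (Finset.card_le_card h1).trans (Finset.card_union_le _ _)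
      have h4 := h2 a haV
      have h5 := h2 b hbV
      exact_mod_cast (show P.card ≤ 2 * M by omega)
    refine ⟨T, fun _ => ⟨hT, ?_, ?_⟩⟩
    · have hmem : ∀ x, (x ∈ φ p ∨ x ∈ I ∧ φ x = φ p) → x ∈ insert b (insert a P) := by
        intro x hx
        simp only [Finset.mem_insert]
        rcases hx with hx | hx
        · rcases Sym2.mem_iff.1 hx with rfl | rfl
          exacts [.inr (.inl rfl), .inl rfl]
        · exact .inr (.inr (Finset.mem_filter.2 hx))
      exact fun x y hx hy => hTs x (hmem x hx) y (hmem y hy)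
    · refine hlen.trans (add_le_add le_rfl ?_)
      have hεP : ε a ≤ ∑ q ∈ P, ε (π q) :=
        Finset.single_le_sum (f := fun q => ε (π q))
          (fun q hq => h.nonneg _ (hπ q (hPV hq)).1) (Finset.mem_filter.2 ⟨hp, rfl⟩)
      have h0 := h.nonneg a haV
      calc ((P.card : ℝ) + 1) * (ε a * r) ≤ (2 * M + 1) * ((∑ q ∈ P, ε (π q)) * r) := by
            gcongr
        _ = _ := by ring
  choose path hpath using hpath
  set T := (S \ D) ∪ D.biUnion path ∪ Lf.image (fun p => s(π p, p)) with hT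
  have hT1 : S \ D ⊆ T := Finset.subset_union_left.trans Finset.subset_union_left
  have hT2 : ∀ e ∈ D, path e ⊆ T := fun e he =>
    (Finset.subset_biUnion_of_mem path he).trans
      (Finset.subset_union_right.trans Finset.subset_union_left)
  have hT3 : Lf.image (fun p => s(π p, p)) ⊆ T := Finset.subset_union_right
  have hVV : V.sym2 ⊆ V'.sym2 := Finset.sym2_mono h.subset
  refine ⟨T, ?_, ?_, ?_⟩
  · refine Finset.union_subset (Finset.union_subset ?_ ?_) ?_
    · exact Finset.sdiff_subset.trans (hS.subset.trans hVV)
    · exact Finset.biUnion_subset.2 fun e he => (hpath e he).1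
    · intro e he
      obtain ⟨p, hp, rfl⟩ := Finset.mem_image.1 he
      exact Finset.mk_mem_sym2_iff.2 ⟨h.subset (hπ p (hLV p hp)).1, hLV p hp⟩
  · have hVT : Spans T V := by
      refine fun x hx y hy => (hS.spans x hx y hy).of_edges fun a b hab => ?_
      by_cases hd : s(a, b) ∈ D
      · exact ((hpath _ hd).2.1 a b (.inl (Sym2.mem_mk_left _ _))
          (.inl (Sym2.mem_mk_right _ _))).mono (hT2 _ hd)
      · exact .of_mem (hT1 (Finset.mem_sdiff.2 ⟨hab, hd⟩))
    have hall : ∀ p ∈ V', ∃ a ∈ V, EdgeJoined T p a := by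
      intro p hp
      by_cases hpV : p ∈ V
      · exact ⟨p, hpV, .refl _ _⟩
      refine ⟨π p, (hπ p hp).1, ?_⟩
      have hpn : p ∈ V' \ V := Finset.mem_sdiff.2 ⟨hp, hpV⟩
      by_cases hq : Q p
      · have hpI : p ∈ I := Finset.mem_filter.2 ⟨hpn, hq⟩
        have hd : φ p ∈ D := Finset.mem_image_of_mem _ hpI
        exact ((hpath _ hd).2.1 p (π p) (.inr ⟨hpI, rfl⟩) (.inl (Sym2.mem_mk_left _ _))).mono
          (hT2 _ hd)
      · exact (EdgeJoined.of_mem (hT3 (Finset.mem_image_of_mem _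
          (Finset.mem_filter.2 ⟨hpn, hq⟩)))).symm
    intro x hx y hy
    obtain ⟨a, ha, hxa⟩ := hall x hx
    obtain ⟨b, hb, hyb⟩ := hall y hy
    exact (hxa.trans (hVT a ha b hb)).trans hyb.symm
  · set w := edgeWeight (X := X) (16 * M * (r / 2)) with hw
    have hw0 : ∀ e, 0 ≤ w e := edgeWeight_nonneg hR0
    have hsum : ∑ e ∈ T, w e ≤ ∑ e ∈ S \ D, w e + ∑ e ∈ D, ∑ e' ∈ path e, w e' +
        ∑ p ∈ Lf, w s(π p, p) := by
      refine (Finset.sum_union_le hw0 _ _).trans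
        (add_le_add ((Finset.sum_union_le hw0 _ _).trans (add_le_add le_rfl ?_)) ?_)
      · exact Finset.sum_biUnion_le hw0 _ _
      · rw [← Finset.biUnion_singleton]
        simpa using Finset.sum_biUnion_le hw0 Lf fun p => {s(π p, p)}
    -- the edges that stay
    have hlong : S.filter (fun e => ¬ edgeLength e ≤ 16 * M * r) ⊆ S \ D := by
      intro e he
      rw [Finset.mem_filter] at he
      exact Finset.mem_sdiff.2 ⟨he.1, fun hd => he.2 (Finset.mem_filter.1 (hDF hd)).2⟩
    -- Halving the cap lowers the weight of every long edge by exactly `8 * M * r`; this is the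
    -- credit for the leaves.
    have h1 : ∑ e ∈ S \ D, w e + (S.filter fun e => ¬ edgeLength e ≤ 16 * M * r).card *
        (8 * M * r) ≤ ∑ e ∈ S \ D, edgeWeight (16 * M * r) e := by
      rw [← nsmul_eq_mul, ← Finset.sum_const, ← Finset.sum_sdiff hlong,
        ← Finset.sum_sdiff (f := edgeWeight (16 * M * r)) hlong, add_assoc,
        ← Finset.sum_add_distrib]
      refine add_le_add (Finset.sum_le_sum fun e _ => edgeWeight_mono hR' e)
        (Finset.sum_le_sum fun e he => ?_)
      have he := (Finset.mem_filter.1 he).2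
      push Not at he
      rw [hw]
      unfold edgeWeight
      rw [min_eq_right he.le, min_eq_right (hR'.trans he.le)]
      linarith
    -- the edges that are refined
    have h2 : ∑ e ∈ D, ∑ e' ∈ path e, w e' ≤ ∑ e ∈ D, edgeWeight (16 * M * r) e +
        2 * (2 * M + 1) * r * (M * ∑ a ∈ V, ε a) := by
      calc ∑ e ∈ D, ∑ e' ∈ path e, w e'
          ≤ ∑ e ∈ D, (edgeWeight (16 * M * r) e +
            2 * (2 * M + 1) * r * ∑ p ∈ I.filter (fun p => φ p = e), ε (π p)) := by
            refine Finset.sum_le_sum fun e he => ?_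
            have h3 : ∑ e' ∈ path e, w e' ≤ 2 * ∑ e' ∈ path e, edgeLength e' := by
              rw [Finset.mul_sum]
              exact Finset.sum_le_sum fun e' _ => edgeWeight_le_two_mul _ e'
            have h4 := (hpath e he).2.2
            -- A short edge is below the cap and weighs twice its length, which covers the weight of
            -- the path replacing it up to the errors.
            have h5 : edgeWeight (16 * M * r) e = 2 * edgeLength e := by
              unfold edgeWeight
              rw [min_eq_left (Finset.mem_filter.1 (hDF he)).2]
              ring
            rw [h5]
            linarith
        _ = ∑ e ∈ D, edgeWeight (16 * M * r) e +
            2 * (2 * M + 1) * r * ∑ p ∈ I, ε (π p) := by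
            rw [Finset.sum_add_distrib, ← Finset.mul_sum, Finset.sum_fiberwise_of_maps_to
              fun p hp => Finset.mem_image_of_mem φ hp]
        _ ≤ _ := by
            gcongr
            exact h.sum_comp_nearest_le hπ I hIV
    -- the new edges
    have h3 : ∑ p ∈ Lf, w s(π p, p) ≤ Lf.card * (4 * r) := by
      rw [← nsmul_eq_mul, ← Finset.sum_const]
      refine Finset.sum_le_sum fun p hp => (edgeWeight_le_two_mul _ _).trans ?_
      rw [edgeLength_mk, dist_comm]
      linarith [(hπ p (hLV p hp)).2.1]
    -- At `4 * r` per leaf the bound is `8 * M * r` plus `8 * M * r` per long edge, up to errors.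
    -- The second part is the credit in `h1`, which explains the cap `16 * M * r`.
    have h4 := h.card_leaves_le hS hπ Lf (Finset.filter_subset _ _) (fun p hp hε hb =>
      (Finset.mem_filter.1 hp).2 ⟨hε, hb⟩)
    have h5 := mul_le_mul_of_nonneg_right h4 (show 0 ≤ 4 * r by linarith)
    have h6 := Finset.sum_sdiff (f := edgeWeight (16 * M * r)) hDS
    linarith

end NetStep

/-- The total length of minimal spanning sets of a sequence of nets is bounded when the errors of
the coordinates are summable. -/
theorem exists_spans_length_le {X : Type*} [MetricSpace X] {V : ℕ → Finset X} {r : ℕ → ℝ}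
    {M M' : ℕ} {ε : ℕ → X → ℝ} (hr : ∀ i, r (i + 1) = r i / 2)
    (h : ∀ i, NetStep (V i) (V (i + 1)) (r i) M M' (ε i)) {C : ℝ}
    (hC : ∀ n, ∑ i ∈ Finset.range n, r i * ∑ a ∈ V i, ε i a ≤ C) :
    ∃ L, ∀ n, ∃ T ⊆ (V n).sym2, Spans T (V n) ∧ ∑ e ∈ T, edgeLength e ≤ L := by
  have hR : ∀ i, 0 ≤ 16 * M * r i := fun i => (h i).radius_nonneg
  choose S hS using fun i => exists_isMinimalSpanning (hR i) (V i)
  set K : ℝ := 64 * (M * (1 + M')) + 2 * (2 * M + 1) * M with hK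
  set W : ℕ → ℝ := fun i => ∑ e ∈ S i, edgeWeight (16 * M * r i) e with hW
  have hstep : ∀ i, W (i + 1) ≤ W i + 8 * M * r i + K * (r i * ∑ a ∈ V i, ε i a) := by
    intro i
    obtain ⟨T, hT, hTs, hle⟩ := (h i).exists_spans (hS i)
    rw [← hr i] at hle
    exact ((hS (i + 1)).le T hT hTs).trans hle
  -- As `r` is halved at each step, the terms `8 * M * r i` telescope to `16 * M * (r 0 - r n)`.
  have hind : ∀ n, W n ≤ W 0 + 16 * M * (r 0 - r n) +
      K * ∑ i ∈ Finset.range n, r i * ∑ a ∈ V i, ε i a := by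
    intro n
    induction n with
    | zero => simp
    | succ n ih =>
      rw [Finset.sum_range_succ, hr n]
      linarith [hstep n]
  refine ⟨W 0 + 16 * M * r 0 + K * C, fun n => ⟨S n, (hS n).subset, (hS n).spans, ?_⟩⟩
  have h1 : ∑ e ∈ S n, edgeLength e ≤ W n :=
    Finset.sum_le_sum fun e _ => edgeLength_le_edgeWeight (hR n) e
  have h2 : K * ∑ i ∈ Finset.range n, r i * ∑ a ∈ V i, ε i a ≤ K * C :=
    mul_le_mul_of_nonneg_left (hC n) (by positivity)
  linarith [hind n, hR n]

/-! ### Weak limits of curves -/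

/-- Banach–Alaoglu, carried back from the dual by Riesz. With an ultrafilter no subsequence is
extracted, so the same limit process works for all parameters of the curves. -/
theorem exists_weak_limit {H : Type*} [NormedAddCommGroup H] [InnerProductSpace ℝ H]
    [CompleteSpace H] {ι : Type*} (U : Ultrafilter ι) (x : ι → H) {R : ℝ}
    (hx : ∀ᶠ i in U, ‖x i‖ ≤ R) :
    ∃ z : H, ∀ y : H, Tendsto (fun i => inner ℝ (x i) y) U (𝓝 (inner ℝ z y)) := by
  have hK := WeakDual.isCompact_closedBall (𝕜 := ℝ) (0 : StrongDual ℝ H) R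
  set u : ι → WeakDual ℝ H := fun i =>
    StrongDual.toWeakDual (InnerProductSpace.toDual ℝ H (x i)) with hu
  obtain ⟨z, -, hz⟩ := hK.ultrafilter_le_nhds (U.map u) (by
    rw [le_principal_iff]
    refine hx.mono fun i hi => ?_
    simp only [hu, mem_preimage, mem_closedBall_zero_iff]
    simpa using hi)
  refine ⟨(InnerProductSpace.toDual ℝ H).symm (WeakDual.toStrongDual z), fun y => ?_⟩
  have h1 : Tendsto (fun i => u i y) U (𝓝 (z y)) :=
    ((WeakDual.eval_continuous y).tendsto z).comp hz
  have h2 : inner ℝ ((InnerProductSpace.toDual ℝ H).symm (WeakDual.toStrongDual z)) y = z y := by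
    simp
  rw [h2]
  exact h1

/-- Weak lower semicontinuity of the norm, by testing against `z - z'`. -/
theorem dist_le_of_weak_limit {H : Type*} [NormedAddCommGroup H] [InnerProductSpace ℝ H]
    {ι : Type*} {l : Filter ι} [l.NeBot] {x x' : ι → H} {z z' : H} {δ : ℝ}
    (hz : ∀ y : H, Tendsto (fun i => inner ℝ (x i) y) l (𝓝 (inner ℝ z y)))
    (hz' : ∀ y : H, Tendsto (fun i => inner ℝ (x' i) y) l (𝓝 (inner ℝ z' y)))
    (h : ∀ᶠ i in l, dist (x i) (x' i) ≤ δ) : dist z z' ≤ δ := by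
  have h1 : inner ℝ (z - z') (z - z') ≤ δ * ‖z - z'‖ := by
    rw [inner_sub_left]
    refine le_of_tendsto ((hz (z - z')).sub (hz' (z - z'))) (h.mono fun i hi => ?_)
    rw [← inner_sub_left]
    refine (real_inner_le_norm _ _).trans ?_
    rw [← dist_eq_norm (x i)]
    gcongr
  rw [real_inner_self_eq_norm_sq] at h1
  rw [dist_eq_norm]
  rcases (norm_nonneg (z - z')).eq_or_lt with h0 | h0
  · rw [← h0]
    obtain ⟨i, hi⟩ := h.exists
    exact dist_nonneg.trans hi
  · nlinarith

theorem isRectifiableCurve_image {H : Type*} [MetricSpace H] [MeasurableSpace H] [BorelSpace H]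
    {f : ℝ → H} {L : ℝ} (hL : 0 ≤ L) (hf : LipschitzOnWith 1 f (Icc 0 L)) :
    IsRectifiableCurve (f '' Icc 0 L) := by
  refine ⟨isCompact_Icc.image_of_continuousOn hf.continuousOn,
    (isConnected_Icc hL).image _ hf.continuousOn, ?_⟩
  refine (hf.hausdorffMeasure_image_le zero_le_one).trans_lt ?_
  rw [hausdorffMeasure_real, Real.volume_Icc]
  simp

/-- A set that is approximated by curves of bounded length is contained in a rectifiable curve. -/
theorem exists_isRectifiableCurve_of_approx {H : Type*} [NormedAddCommGroup H]
    [InnerProductSpace ℝ H] [CompleteSpace H] [MeasurableSpace H] [BorelSpace H] {E : Set H}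
    {L : ℝ} {f : ℕ → ℝ → H} (hf : ∀ n s t, s ≤ t → dist (f n s) (f n t) ≤ t - s)
    (hE : ∀ y ∈ E, ∀ δ > 0, ∀ᶠ n in atTop, ∃ t ∈ Icc 0 L, dist (f n t) y ≤ δ) :
    ∃ Γ, IsRectifiableCurve Γ ∧ E ⊆ Γ := by
  have hf' : ∀ n s t, dist (f n s) (f n t) ≤ |s - t| := by
    intro n s t
    rcases le_total s t with h | h
    · rw [abs_sub_comm, abs_of_nonneg (by linarith)]; exact hf n s t h
    · rw [abs_of_nonneg (by linarith), dist_comm]; exact hf n t s h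
  rcases E.eq_empty_or_nonempty with rfl | ⟨y₀, hy₀⟩
  · exact ⟨_, isRectifiableCurve_image le_rfl ((LipschitzWith.const' (0 : H)).lipschitzOnWith),
      empty_subset _⟩
  have hL : 0 ≤ L := by
    obtain ⟨n, t, ht, -⟩ := (hE y₀ hy₀ 1 one_pos).exists
    exact ht.1.trans ht.2
  set U : Ultrafilter ℕ := Ultrafilter.of atTop with hU
  have hUle : (U : Filter ℕ) ≤ atTop := Ultrafilter.of_le _
  have hlim : ∀ t ∈ Icc 0 L, ∃ z : H, ∀ y : H,
      Tendsto (fun n => inner ℝ (f n t) y) U (𝓝 (inner ℝ z y)) := by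
    intro t ht
    refine exists_weak_limit U (fun n => f n t) (R := L + 1 + ‖y₀‖) ?_
    refine hUle ((hE y₀ hy₀ 1 one_pos).mono fun n ⟨s, hs, hd⟩ => ?_)
    have h1 : ‖f n t‖ ≤ dist (f n t) y₀ + ‖y₀‖ := by
      rw [dist_eq_norm]
      simpa using norm_add_le (f n t - y₀) y₀
    have h2 := dist_triangle (f n t) (f n s) y₀
    have h3 := hf' n t s
    have h4 : |t - s| ≤ L := abs_sub_le_iff.2 ⟨by linarith [ht.2, hs.1], by linarith [hs.2, ht.1]⟩
    linarith
  choose! g hg using hlim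
  have hlip : LipschitzOnWith 1 g (Icc 0 L) := by
    refine LipschitzOnWith.of_dist_le_mul fun s hs t ht => ?_
    rw [NNReal.coe_one, one_mul, Real.dist_eq]
    exact dist_le_of_weak_limit (hg s hs) (hg t ht) (Eventually.of_forall fun n => hf' n s t)
  refine ⟨g '' Icc 0 L, isRectifiableCurve_image hL hlip, fun y hy => ?_⟩
  -- the parameters of the points that approximate `y`
  have hpar : ∀ k : ℕ, ∃ t ∈ Icc 0 L, dist (g t) y ≤ 2 / (k + 1) := by
    intro k
    have hk : (0 : ℝ) < 1 / (k + 1) := by positivity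
    have h1 : ∀ᶠ n in (U : Filter ℕ), ∃ t ∈ Icc 0 L, dist (f n t) y ≤ 1 / (k + 1) :=
      hUle (hE y hy _ hk)
    have : ∀ n, ∃ t, (∃ t ∈ Icc 0 L, dist (f n t) y ≤ 1 / (k + 1)) →
        t ∈ Icc 0 L ∧ dist (f n t) y ≤ 1 / (k + 1) := by
      intro n
      by_cases hn : ∃ t ∈ Icc 0 L, dist (f n t) y ≤ 1 / (k + 1)
      · obtain ⟨t, ht, hd⟩ := hn
        exact ⟨t, fun _ => ⟨ht, hd⟩⟩
      · exact ⟨0, fun h => absurd h hn⟩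
    choose τ hτ using this
    -- The parameters of the approximating points converge along `U`; as the curves are uniformly
    -- Lipschitz, the limit parameter serves all of them with a slightly larger error.
    obtain ⟨t, ht, hlim⟩ := isCompact_Icc.ultrafilter_le_nhds (U.map τ) (by
      rw [le_principal_iff]
      have h2 : ∀ᶠ n in (U : Filter ℕ), τ n ∈ Icc 0 L := h1.mono fun n hn => (hτ n hn).1
      exact h2)
    refine ⟨t, ht, dist_le_of_weak_limit (hg t ht) (fun _ => tendsto_const_nhds) ?_⟩
    have h2 : ∀ᶠ n in (U : Filter ℕ), |τ n - t| < 1 / (k + 1) := by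
      have := hlim (Metric.ball_mem_nhds t hk)
      exact this
    filter_upwards [h1, h2] with n hn hn'
    have h3 := (hτ n hn).2
    have h4 := hf' n t (τ n)
    have h5 := dist_triangle (f n t) (f n (τ n)) y
    rw [abs_sub_comm] at h4
    calc dist (f n t) y ≤ 1 / (k + 1) + 1 / (k + 1) := by linarith
      _ = 2 / (k + 1) := by ring
  have hcl : y ∈ closure (g '' Icc 0 L) := by
    refine Metric.mem_closure_iff.2 fun δ hδ => ?_
    obtain ⟨k, hk⟩ := exists_nat_gt (2 / δ)
    obtain ⟨t, ht, hd⟩ := hpar k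
    refine ⟨g t, ⟨t, ht, rfl⟩, ?_⟩
    rw [dist_comm]
    refine hd.trans_lt ?_
    rw [div_lt_iff₀ (by positivity)]
    rw [div_lt_iff₀ hδ] at hk
    nlinarith
  rwa [(isRectifiableCurve_image hL hlip).1.isClosed.closure_eq] at hcl

/-- A sequence of nets with summable errors converges to a subset of a rectifiable curve. -/
theorem exists_isRectifiableCurve_of_netStep {H : Type*} [NormedAddCommGroup H]
    [InnerProductSpace ℝ H] [CompleteSpace H] [MeasurableSpace H] [BorelSpace H] {E : Set H}
    {V : ℕ → Finset H} {r : ℕ → ℝ} {M M' : ℕ} {ε : ℕ → H → ℝ} (hr : ∀ i, r (i + 1) = r i / 2)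
    (h : ∀ i, NetStep (V i) (V (i + 1)) (r i) M M' (ε i)) {C : ℝ}
    (hC : ∀ n, ∑ i ∈ Finset.range n, r i * ∑ a ∈ V i, ε i a ≤ C)
    (hE : ∀ y ∈ E, ∀ i, ∃ v ∈ V i, dist y v ≤ 2 * r i) :
    ∃ Γ, IsRectifiableCurve Γ ∧ E ⊆ Γ := by
  obtain ⟨L, hL⟩ := exists_spans_length_le hr h hC
  rcases E.eq_empty_or_nonempty with rfl | ⟨y₀, hy₀⟩
  · exact ⟨_, isRectifiableCurve_image le_rfl ((LipschitzWith.const' (0 : H)).lipschitzOnWith),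
      empty_subset _⟩
  have htour : ∀ n, ∃ f : ℝ → H, (∀ s t, s ≤ t → dist (f s) (f t) ≤ t - s) ∧
      (V n : Set H) ⊆ f '' Icc 0 (2 * L) := by
    intro n
    obtain ⟨T, hT, hTs, hlen⟩ := hL n
    obtain ⟨v, hv, -⟩ := hE y₀ hy₀ n
    obtain ⟨f, hf, hfV⟩ := hTs.exists_tour hT ⟨v, hv⟩
    exact ⟨f, hf, hfV.trans (image_mono (Icc_subset_Icc_right (by linarith)))⟩
  choose f hf hfV using htour
  refine exists_isRectifiableCurve_of_approx (L := 2 * L) hf fun y hy δ hδ => ?_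
  have hr' : ∀ i, r i = r 0 * (1 / 2) ^ i := by
    intro i
    induction i with
    | zero => simp
    | succ i ih => rw [hr, ih, pow_succ]; ring
  have hlim : Tendsto (fun i => 2 * r i) atTop (𝓝 0) := by
    rw [funext hr']
    have := (tendsto_pow_atTop_nhds_zero_of_lt_one (r := (1 / 2 : ℝ)) (by norm_num)
      (by norm_num)).const_mul (2 * r 0)
    simpa [mul_assoc] using this
  filter_upwards [hlim.eventually (gt_mem_nhds hδ)] with n hn
  obtain ⟨v, hv, hd⟩ := hE y hy n
  obtain ⟨t, ht, rfl⟩ := hfV n hv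
  exact ⟨t, ht, by rw [dist_comm]; exact hd.trans hn.le⟩

/-! ### Doubling at dyadic scales -/

/-- `μ` is doubling at `x` with constant `M` at the dyadic scales from `2^{-j₀}` on. -/
def IsDyadicDoubling {X : Type*} [MetricSpace X] [MeasurableSpace X] (μ : Measure X)
    (M j₀ : ℕ) (x : X) : Prop :=
  ∀ j, j₀ ≤ j → 0 < μ (closedBall x ((1 / 2) ^ j)) ∧ μ (closedBall x ((1 / 2) ^ j)) < ∞ ∧
    μ (closedBall x (2 * (1 / 2) ^ j)) ≤ M * μ (closedBall x ((1 / 2) ^ j))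

namespace IsDyadicDoubling

variable {X : Type*} [MetricSpace X] [MeasurableSpace X] {μ : Measure X} {M j₀ : ℕ} {x : X}

theorem mono {j₁ : ℕ} (h : IsDyadicDoubling μ M j₀ x) (hj : j₀ ≤ j₁) :
    IsDyadicDoubling μ M j₁ x :=
  fun j hj' => h j (hj.trans hj')

/-- Iterated doubling. As `A` need not be centred at `x`, this also compares balls about
neighbouring points. -/
theorem measure_le (h : IsDyadicDoubling μ M j₀ x) {A : Set X} {j : ℕ} (hj : j₀ ≤ j)
    (hA : A ⊆ closedBall x ((1 / 2) ^ j)) (i : ℕ) {t : ℝ} (ht : (1 / 2) ^ (j + i) ≤ t) :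
    μ A ≤ M ^ i * μ (closedBall x t) := by
  have key : μ (closedBall x ((1 / 2) ^ j)) ≤ M ^ i * μ (closedBall x ((1 / 2) ^ (j + i))) := by
    clear ht
    induction i with
    | zero => simp
    | succ i ih =>
      refine ih.trans ?_
      rw [pow_succ, mul_assoc]
      gcongr
      have := (h (j + (i + 1)) (by omega)).2.2
      rwa [show (2 : ℝ) * (1 / 2) ^ (j + (i + 1)) = (1 / 2) ^ (j + i) by
        rw [← add_assoc, pow_succ]; ring] at this
  refine (measure_mono hA).trans (key.trans ?_)
  gcongr

theorem measure_pos (h : IsDyadicDoubling μ M j₀ x) {t : ℝ} (ht : 0 < t) :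
    0 < μ (closedBall x t) := by
  obtain ⟨n, hn⟩ := exists_pow_lt_of_lt_one ht (show (1 / 2 : ℝ) < 1 by norm_num)
  refine (h (j₀ + n) (by omega)).1.trans_le (measure_mono (closedBall_subset_closedBall ?_))
  refine le_trans ?_ hn.le
  exact pow_le_pow_of_le_one (by norm_num) (by norm_num) (by omega)

theorem measure_lt_top (h : IsDyadicDoubling μ M j₀ x) {A : Set X} {j : ℕ} (hj : j₀ ≤ j)
    (hA : A ⊆ closedBall x ((1 / 2) ^ j)) : μ A < ∞ :=
  (measure_mono hA).trans_lt (h j hj).2.1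

theorem one_le (h : IsDyadicDoubling μ M j₀ x) : 1 ≤ M := by
  by_contra! hM
  obtain rfl : M = 0 := by omega
  have h1 := h.measure_le le_rfl subset_rfl 1 le_rfl
  simp only [Nat.cast_zero, pow_one, zero_mul, nonpos_iff_eq_zero] at h1
  exact (h j₀ le_rfl).1.ne' h1

/-- Separated sets of points with the doubling property are uniformly finite. -/
theorem card_le [BorelSpace X] {P : Finset X} (hP : ∀ p ∈ P, IsDyadicDoubling μ M j₀ p) {j i : ℕ}
    (hj : j₀ ≤ j) (hPx : ∀ p ∈ P, dist p x ≤ (1 / 2) ^ (j + 2))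
    (hsep : ∀ p ∈ P, ∀ q ∈ P, p ≠ q → (1 / 2) ^ (j + 2 + i) ≤ dist p q) :
    P.card ≤ M ^ (i + 4) := by
  rcases P.eq_empty_or_nonempty with rfl | ⟨p₀, hp₀⟩
  · simp
  have e2 : (1 / 2 : ℝ) ^ (j + 2) = (1 / 2) ^ j / 4 := by rw [pow_add]; ring
  have e1 : (1 / 2 : ℝ) ^ (j + 1) = (1 / 2) ^ j / 2 := by rw [pow_add]; ring
  have e4 : (1 / 2 : ℝ) ^ (j + 2 + i + 2) = (1 / 2) ^ (j + 2 + i) / 4 := by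
    rw [pow_add _ (j + 2 + i)]; ring
  have hle : (1 / 2 : ℝ) ^ (j + 2 + i) ≤ (1 / 2) ^ (j + 2) :=
    pow_le_pow_of_le_one (by norm_num) (by norm_num) (by omega)
  have hpos : (0 : ℝ) < (1 / 2) ^ (j + 2 + i) := by positivity
  have hposj : (0 : ℝ) < (1 / 2) ^ j := by positivity
  set m := μ (closedBall x ((1 / 2) ^ (j + 1))) with hm
  have hsub : ∀ p ∈ P, closedBall p ((1 / 2) ^ (j + 2 + i + 2)) ⊆
      closedBall x ((1 / 2) ^ (j + 1)) := fun p hp =>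
    closedBall_subset_closedBall' (by have := hPx p hp; linarith)
  have hsub' : ∀ p ∈ P, closedBall x ((1 / 2) ^ (j + 1)) ⊆ closedBall p ((1 / 2) ^ j) :=
    fun p hp => closedBall_subset_closedBall' (by rw [dist_comm]; have := hPx p hp; linarith)
  have hm0 : m ≠ 0 :=
    (((hP p₀ hp₀).measure_pos (by positivity)).trans_le (measure_mono (hsub p₀ hp₀))).ne'
  have hmt : m ≠ ∞ := ((hP p₀ hp₀).measure_lt_top hj (hsub' p₀ hp₀)).ne
  -- Balls of a quarter of the separation are disjoint, and by `i + 4` doublings each carries a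
  -- definite fraction of `m`.
  have h1 : ∑ p ∈ P, μ (closedBall p ((1 / 2) ^ (j + 2 + i + 2))) ≤ m := by
    rw [← measure_biUnion_finset ?_ fun p _ => isClosed_closedBall.measurableSet]
    · exact measure_mono (iUnion₂_subset hsub)
    · intro p hp q hq hpq
      refine closedBall_disjoint_closedBall ?_
      have := hsep p hp q hq hpq
      linarith
  have h2 : (P.card : ℝ≥0∞) * m ≤ M ^ (i + 4) * m := by
    calc (P.card : ℝ≥0∞) * m = ∑ p ∈ P, m := by simp
      _ ≤ ∑ p ∈ P, M ^ (i + 4) * μ (closedBall p ((1 / 2) ^ (j + 2 + i + 2))) :=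
        Finset.sum_le_sum fun p hp => (hP p hp).measure_le hj (hsub' p hp) (i + 4)
          (le_of_eq (by congr 1; omega))
      _ ≤ _ := by rw [← Finset.mul_sum]; gcongr
  have h3 := (ENNReal.mul_le_mul_iff_left hm0 hmt).1 h2
  exact_mod_cast h3

end IsDyadicDoubling

/-- Almost every point of a set of points with the doubling property is a density point. -/
theorem measure_not_density {X : Type*} [MetricSpace X] [SecondCountableTopology X]
    [MeasurableSpace X] [BorelSpace X] {μ : Measure X} [IsLocallyFiniteMeasure μ]
    [μ.OuterRegular] {M j₀ : ℕ} {E : Set X} (hE : MeasurableSet E) (hμE : μ E ≠ ∞)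
    (hdbl : ∀ x ∈ E, IsDyadicDoubling μ M j₀ x) :
    μ {x ∈ E | ∃ᶠ j : ℕ in atTop, 2 * μ (E ∩ closedBall x ((1 / 2) ^ j)) <
      μ (closedBall x ((1 / 2) ^ j))} = 0 := by
  set Bad := {x ∈ E | ∃ᶠ j : ℕ in atTop, 2 * μ (E ∩ closedBall x ((1 / 2) ^ j)) <
      μ (closedBall x ((1 / 2) ^ j))} with hBad
  have key : ∀ ε : ℝ≥0∞, ε ≠ 0 → μ Bad ≤ 2 * ε := by
    intro ε hε
    obtain ⟨U, hEU, hU, hUlt⟩ := E.exists_isOpen_lt_add hμE hε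
    have hUE : μ (U \ E) ≤ ε := by
      rw [measure_sdiff hEU hE.nullMeasurableSet hμE]
      exact tsub_le_iff_left.2 hUlt.le
    -- Vitali's theorem is applied to the balls inside `U` of which `E` fills less than half; their
    -- centres lie in `E`, so the doubling it requires is available.
    set t : Set (X × ℕ) := {a | a.1 ∈ E ∧ j₀ + 2 ≤ a.2 ∧
      closedBall a.1 ((1 / 2) ^ a.2) ⊆ U ∧ 2 * μ (E ∩ closedBall a.1 ((1 / 2) ^ a.2)) <
        μ (closedBall a.1 ((1 / 2) ^ a.2))} with ht
    obtain ⟨u, hut, huc, hdisj, hcov⟩ := Vitali.exists_disjoint_covering_ae μ Bad t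
      (M ^ 2 : ℕ) (fun a => (1 / 2 : ℝ) ^ a.2) (fun a => a.1)
      (fun a => closedBall a.1 ((1 / 2 : ℝ) ^ a.2)) (fun a _ => subset_rfl) (fun a ha => by
        obtain ⟨j, hj⟩ := Nat.exists_eq_add_of_le ha.2.1
        have h1 := (hdbl _ ha.1).measure_le (A := closedBall a.1 (3 * (1 / 2 : ℝ) ^ a.2))
          (j := j₀ + j) (by omega) (closedBall_subset_closedBall (by
            rw [hj, show j₀ + 2 + j = j₀ + j + 2 by ring, pow_add _ (j₀ + j)]
            have : (0 : ℝ) < (1 / 2) ^ (j₀ + j) := by positivity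
            linarith)) 2 (t := (1 / 2 : ℝ) ^ a.2) (le_of_eq (by rw [hj]; congr 1; ring))
        simpa using h1)
      (fun a _ => ⟨a.1, interior_mono ball_subset_closedBall (by
        rw [isOpen_ball.interior_eq]; exact mem_ball_self (by positivity))⟩)
      (fun a _ => isClosed_closedBall)
      (fun x hx δ hδ => by
        have h1 : ∀ᶠ j : ℕ in atTop, closedBall x ((1 / 2) ^ j) ⊆ U := by
          obtain ⟨η, hη, hηU⟩ := Metric.isOpen_iff.1 hU x (hEU hx.1)
          have := (tendsto_pow_atTop_nhds_zero_of_lt_one (r := (1 / 2 : ℝ)) (by norm_num)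
            (by norm_num)).eventually (gt_mem_nhds hη)
          exact this.mono fun j hj => (closedBall_subset_ball hj).trans hηU
        have h2 := (tendsto_pow_atTop_nhds_zero_of_lt_one (r := (1 / 2 : ℝ)) (by norm_num)
            (by norm_num)).eventually (gt_mem_nhds hδ)
        obtain ⟨j, hj, hjU, hjδ, hj2⟩ :=
          (hx.2.and_eventually (h1.and (h2.and (eventually_ge_atTop (j₀ + 2))))).exists
        exact ⟨(x, j), ⟨hx.1, hj2, hjU, hj⟩, hjδ.le, rfl⟩)
    have hfin : ∀ a ∈ u, μ (closedBall a.1 ((1 / 2) ^ a.2)) ≤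
        2 * μ (closedBall a.1 ((1 / 2) ^ a.2) \ E) := by
      intro a ha
      have ha := hut ha
      have h1 := measure_inter_add_sdiff (μ := μ) (closedBall a.1 ((1 / 2) ^ a.2)) hE
      rw [inter_comm] at h1
      have h2 := ha.2.2.2
      have h3 : μ (closedBall a.1 ((1 / 2) ^ a.2)) ≠ ∞ :=
        ((hdbl _ ha.1) a.2 (by have := ha.2.1; omega)).2.1.ne
      have h4 : μ (E ∩ closedBall a.1 ((1 / 2) ^ a.2)) ≠ ∞ :=
        measure_ne_top_of_subset inter_subset_right h3
      have h5 : μ (E ∩ closedBall a.1 ((1 / 2) ^ a.2)) ≤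
          μ (closedBall a.1 ((1 / 2) ^ a.2) \ E) := by
        rw [← h1, two_mul] at h2
        exact ((ENNReal.add_lt_add_iff_left h4).1 h2).le
      rw [← h1, two_mul]
      gcongr
    calc μ Bad ≤ μ (⋃ a ∈ u, closedBall a.1 ((1 / 2) ^ a.2)) := by
          refine (measure_le_inter_add_sdiff μ Bad (⋃ a ∈ u, closedBall a.1 ((1 / 2) ^ a.2))).trans ?_
          rw [hcov, add_zero]
          exact measure_mono inter_subset_right
      _ ≤ ∑' a : u, μ (closedBall a.1.1 ((1 / 2) ^ a.1.2)) := measure_biUnion_le μ huc _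
      _ ≤ ∑' a : u, 2 * μ (closedBall a.1.1 ((1 / 2) ^ a.1.2) \ E) :=
          ENNReal.tsum_le_tsum fun a => hfin a.1 a.2
      _ = 2 * μ (⋃ a ∈ u, closedBall a.1 ((1 / 2) ^ a.2) \ E) := by
          rw [ENNReal.tsum_mul_left, measure_biUnion huc]
          · exact fun a ha b hb hab => (hdisj ha hb hab).mono sdiff_subset sdiff_subset
          · exact fun a _ => isClosed_closedBall.measurableSet.diff hE
      _ ≤ 2 * μ (U \ E) := by
          gcongr
          exact iUnion₂_subset fun a ha => sdiff_subset_sdiff_left (hut ha).2.2.1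
      _ ≤ 2 * ε := by gcongr
  by_contra h0
  -- The value is at most a quarter of `μ Bad`, and the bound would give `μ Bad ≤ μ Bad / 2`.
  have h1 := key (min 1 (μ Bad / 4)) (by simp [h0])
  have h2 : μ Bad ≠ ∞ := measure_ne_top_of_subset (fun x hx => hx.1) hμE
  have h3 : μ Bad ≤ 2 * (μ Bad / 4) := h1.trans (by gcongr; exact min_le_right _ _)
  have h4 : 2 * (μ Bad / 4) = μ Bad / 2 := by
    rw [show (4 : ℝ≥0∞) = 2 * 2 by norm_num, ← mul_div_assoc, ENNReal.mul_div_mul_left _ _ two_ne_zero (by simp)]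
  rw [h4] at h3
  exact (ENNReal.half_lt_self h0 h2).not_ge h3

/-! ### Lines -/

/-- The distance to the line through `c` with unit direction `u`. -/
noncomputable def lineDist {H : Type*} [NormedAddCommGroup H] [InnerProductSpace ℝ H]
    (c u x : H) : ℝ :=
  ‖(x - c) - (inner ℝ u (x - c) : ℝ) • u‖

section

variable {H : Type*} [NormedAddCommGroup H] [InnerProductSpace ℝ H]

theorem lineDist_nonneg (c u x : H) : 0 ≤ lineDist c u x := norm_nonneg _

@[fun_prop]
theorem continuous_lineDist (c u : H) : Continuous (lineDist c u) := by
  unfold lineDist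
  fun_prop

theorem norm_sq_eq_inner_sq_add {u : H} (hu : ‖u‖ = 1) (w : H) :
    ‖w‖ ^ 2 = (inner ℝ u w : ℝ) ^ 2 + ‖w - (inner ℝ u w : ℝ) • u‖ ^ 2 := by
  rw [norm_sub_sq_real, norm_smul, hu, inner_smul_right, real_inner_comm u w, mul_one,
    Real.norm_eq_abs, sq_abs]
  ring

/-- The component of `x - z` orthogonal to the line is the same for all `z` on the line, and by
Pythagoras its norm is at most the distance from `x` to `z`. -/
theorem exists_lineDist_le_infDist (ℓ : AffineSubspace ℝ H)
    (hℓ : Module.finrank ℝ ℓ.direction = 1) :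
    ∃ c u : H, ‖u‖ = 1 ∧ ∀ x, lineDist c u x ≤ infDist x (ℓ : Set H) := by
  obtain ⟨v, hv0, hv⟩ := finrank_eq_one_iff'.1 hℓ
  have hne : (ℓ : Set H).Nonempty := by
    rw [nonempty_iff_ne_empty]
    intro h
    have : ℓ = ⊥ := by
      rw [← AffineSubspace.coe_eq_bot_iff]; exact h
    rw [this, AffineSubspace.direction_bot, finrank_bot] at hℓ
    exact zero_ne_one hℓ
  obtain ⟨c, hc⟩ := hne
  have hv0' : (v : H) ≠ 0 := by simpa using hv0
  have hvn : ‖(v : H)‖ ≠ 0 := norm_ne_zero_iff.2 hv0'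
  set u : H := ‖(v : H)‖⁻¹ • (v : H) with hu
  have hun : ‖u‖ = 1 := by
    rw [hu, norm_smul, norm_inv, norm_norm, inv_mul_cancel₀ hvn]
  refine ⟨c, u, hun, fun x => (le_infDist ⟨c, hc⟩).2 fun z hz => ?_⟩
  obtain ⟨a, ha⟩ := hv ⟨z -ᵥ c, AffineSubspace.vsub_mem_direction hz hc⟩
  have hz' : z - c = (a * ‖(v : H)‖) • u := by
    have := congrArg Subtype.val ha
    simp only [vsub_eq_sub, Submodule.coe_smul] at this
    rw [hu, mul_smul, smul_inv_smul₀ hvn, this]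
  have huu : inner ℝ u u = (1 : ℝ) := by rw [real_inner_self_eq_norm_sq, hun]; norm_num
  have key : (x - c) - (inner ℝ u (x - c) : ℝ) • u =
      (x - z) - (inner ℝ u (x - z) : ℝ) • u := by
    have h1 : x - c = (x - z) + (a * ‖(v : H)‖) • u := by rw [← hz']; abel
    rw [h1, inner_add_right, inner_smul_right, huu, add_smul, mul_one]
    abel
  have h2 := norm_sq_eq_inner_sq_add hun (x - z)
  unfold lineDist
  rw [key, dist_eq_norm]
  refine abs_le_of_sq_le_sq' ?_ (norm_nonneg _) |>.2
  nlinarith [sq_nonneg (inner ℝ u (x - z) : ℝ)]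

theorem abs_inner_sub_inner_le {u : H} (hu : ‖u‖ = 1) (x y : H) :
    |(inner ℝ u x : ℝ) - inner ℝ u y| ≤ dist x y := by
  rw [← inner_sub_right, dist_eq_norm]
  refine (abs_real_inner_le_norm _ _).trans ?_
  rw [hu, one_mul]

/-- With d the distance and t the coordinate difference, (d - |t|)(d + |t|) is the square of the
orthogonal component of `x - y`, and d + |t| ≥ `s`. The error is quadratic, which is why squared
beta numbers suffice. -/
theorem dist_le_abs_inner_sub_add {c u : H} (hu : ‖u‖ = 1) {x y : H} {s : ℝ} (hs : 0 < s)
    (hxy : s ≤ dist x y) : dist x y ≤ |(inner ℝ u x : ℝ) - inner ℝ u y| +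
      2 * (lineDist c u x ^ 2 + lineDist c u y ^ 2) / s := by
  set w := x - y with hw
  rw [← inner_sub_right]
  rw [dist_eq_norm] at hxy ⊢
  have h1 := norm_sq_eq_inner_sq_add hu w
  have h2 : ‖w - (inner ℝ u w : ℝ) • u‖ ≤ lineDist c u x + lineDist c u y := by
    have : w - (inner ℝ u w : ℝ) • u = ((x - c) - (inner ℝ u (x - c) : ℝ) • u) -
        ((y - c) - (inner ℝ u (y - c) : ℝ) • u) := by
      have : w = (x - c) - (y - c) := by rw [hw]; abel
      rw [this, inner_sub_right u (x - c), sub_smul]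
      abel
    rw [this]
    exact norm_sub_le _ _
  have h3 : ‖w - (inner ℝ u w : ℝ) • u‖ ^ 2 ≤
      2 * (lineDist c u x ^ 2 + lineDist c u y ^ 2) := by
    have := pow_le_pow_left₀ (norm_nonneg _) h2 2
    nlinarith [sq_nonneg (lineDist c u x - lineDist c u y)]
  have h4 : |(inner ℝ u w : ℝ)| ≤ ‖w‖ := by
    refine (abs_real_inner_le_norm _ _).trans ?_
    rw [hu, one_mul]
  rw [← sub_le_iff_le_add', le_div_iff₀ hs]
  have h5 := sq_abs (inner ℝ u w : ℝ)
  have h6 : (‖w‖ - |(inner ℝ u w : ℝ)|) * s ≤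
      (‖w‖ - |(inner ℝ u w : ℝ)|) * (‖w‖ + |(inner ℝ u w : ℝ)|) :=
    mul_le_mul_of_nonneg_left (by linarith [abs_nonneg (inner ℝ u w : ℝ)]) (by linarith)
  nlinarith

end

/-! ### The Jones function on good pieces -/

section

variable {H : Type*} [NormedAddCommGroup H] [MeasurableSpace H] {μ : Measure H}

theorem MultiresolutionFamily.radius_natCast (F : MultiresolutionFamily μ) (k : ℕ) :
    F.radius k = F.lam * (1 / 2) ^ k := by
  unfold MultiresolutionFamily.radius
  rw [zpow_neg, zpow_natCast, one_div, inv_pow]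

theorem MultiresolutionFamily.lam_pos (F : MultiresolutionFamily μ) : 0 < F.lam :=
  one_pos.trans F.one_lt_lam

/-- Open balls of half the separation about the points of a net are disjoint. -/
theorem MultiresolutionFamily.countable_balls [TopologicalSpace.SeparableSpace H]
    (F : MultiresolutionFamily μ) (r : ℝ) : (F.balls r).Countable := by
  have hnet : ∀ k, F.k₀ ≤ k → (F.net k).Countable := by
    intro k hk
    have hpos : (0 : ℝ) < 2 ^ (-k) := by positivity
    refine Set.PairwiseDisjoint.countable_of_isOpen (s := fun y => ball y (2 ^ (-k) / 2))
      ?_ (fun _ _ => isOpen_ball) (fun y _ => ⟨y, mem_ball_self (half_pos hpos)⟩)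
    intro x hx y hy hxy
    refine ball_disjoint_ball ?_
    have := (F.isMaximalNet k hk).separated x hx y hy hxy
    linarith
  refine Set.Countable.mono (s₂ := ⋃ k ∈ {k : ℤ | F.k₀ ≤ k}, (fun y => (k, y)) '' F.net k) ?_ ?_
  · rintro ⟨k, y⟩ ⟨hk, hy, -⟩
    exact mem_iUnion₂.2 ⟨k, hk, ⟨y, hy, rfl⟩⟩
  · exact (to_countable _).biUnion fun k hk => (hnet k hk).image _

/-- The balls of the family of generation at least `k₁` whose centre is close to `E`. -/
def MultiresolutionFamily.ballsNear (F : MultiresolutionFamily μ) (k₁ : ℕ) (E : Set H) :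
    Set (ℕ × H) :=
  {p | k₁ ≤ p.1 ∧ p.2 ∈ F.net p.1 ∧ ∃ x ∈ E, dist x p.2 ≤ (1 / 2) ^ p.1}

/-- The double of a ball of the family. -/
def MultiresolutionFamily.double (F : MultiresolutionFamily μ) (p : ℕ × H) : Set H :=
  closedBall p.2 (2 * (F.lam * (1 / 2) ^ p.1))

/-- The scales at which the estimates hold. -/
structure MultiresolutionFamily.IsFine (F : MultiresolutionFamily μ) (j₀ h k₁ : ℕ) : Prop where
  lam_le : F.lam ≤ 2 ^ h
  le_lam : (1 / 2) ^ h ≤ F.lam - 1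
  k₀_le : F.k₀ ≤ k₁
  radius_le : F.lam * (1 / 2) ^ k₁ ≤ 1
  le : j₀ + h + 2 ≤ k₁

theorem half_pow_mul_two_pow (n i : ℕ) : (1 / 2 : ℝ) ^ (n + i) * 2 ^ i = (1 / 2) ^ n := by
  rw [pow_add, mul_assoc, ← mul_pow]; norm_num

/-- The centre of a ball need not be a doubling point, so all measures are compared through `x`. The
room for a ball about `x` inside the given one comes from `F.lam > 1`. -/
theorem MultiresolutionFamily.IsFine.closedBall_subset {F : MultiresolutionFamily μ} {j₀ h k₁ : ℕ}
    (hF : F.IsFine j₀ h k₁) {p : ℕ × H} (hp : k₁ ≤ p.1) {x : H}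
    (hx : dist x p.2 ≤ (1 / 2) ^ p.1) :
    closedBall p.2 (F.lam * (1 / 2) ^ p.1) ⊆ F.double p ∧
      F.double p ⊆ closedBall x ((1 / 2) ^ (p.1 - (h + 2))) ∧
      closedBall x ((1 / 2) ^ (p.1 + h)) ⊆ closedBall p.2 (F.lam * (1 / 2) ^ p.1) := by
  have hpos : (0 : ℝ) < (1 / 2) ^ p.1 := by positivity
  have hlam := F.lam_pos
  have h1 := hF.le
  have e1 : (1 / 2 : ℝ) ^ (p.1 - (h + 2)) = 4 * 2 ^ h * (1 / 2) ^ p.1 := by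
    have := half_pow_mul_two_pow (p.1 - (h + 2)) (h + 2)
    rw [Nat.sub_add_cancel (by omega)] at this
    rw [← this]; ring
  refine ⟨closedBall_subset_closedBall ?_, closedBall_subset_closedBall' ?_,
    closedBall_subset_closedBall' ?_⟩
  · have : 0 < F.lam * (1 / 2) ^ p.1 := by positivity
    linarith
  · rw [e1, dist_comm]
    have h2 : F.lam * (1 / 2) ^ p.1 ≤ 2 ^ h * (1 / 2) ^ p.1 := by gcongr; exact hF.lam_le
    have h3 : (1 : ℝ) * (1 / 2) ^ p.1 ≤ 2 ^ h * (1 / 2) ^ p.1 := by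
      gcongr; exact one_le_pow₀ (by norm_num)
    linarith
  · have h2 : (1 / 2 : ℝ) ^ (p.1 + h) ≤ (F.lam - 1) * (1 / 2) ^ p.1 := by
      rw [pow_add, mul_comm]; gcongr; exact hF.le_lam
    linarith

theorem MultiresolutionFamily.IsFine.exists_injective {F : MultiresolutionFamily μ}
    {j₀ h k₁ : ℕ} (hF : F.IsFine j₀ h k₁) (E : Set H) :
    ∃ f : F.ballsNear k₁ E → F.balls 1, Function.Injective f ∧
      ∀ p, (f p).1 = ((p.1.1 : ℤ), p.1.2) := by
  refine ⟨fun p => ⟨((p.1.1 : ℤ), p.1.2), ?_, p.2.2.1, ?_⟩, ?_, fun p => rfl⟩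
  · exact hF.k₀_le.trans (Int.ofNat_le.2 p.2.1)
  · rw [F.radius_natCast]
    refine le_trans ?_ hF.radius_le
    have := F.lam_pos
    exact mul_le_mul_of_nonneg_left
      (pow_le_pow_of_le_one (by norm_num) (by norm_num) p.2.1) this.le
  · intro p q hpq
    have h1 := Prod.ext_iff.1 (congrArg Subtype.val hpq)
    exact Subtype.ext (Prod.ext (Int.ofNat_inj.1 h1.1) h1.2)

end

/-- Nested pieces `E₂ ⊆ E₁ ⊆ E₀` on which the measure is uniformly doubling and the Jones function
is bounded, such that `E₀` is dense in measure at the points of `E₁`, and `E₁` at those of `E₂`. -/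
structure GoodPieces {H : Type*} [NormedAddCommGroup H] [InnerProductSpace ℝ H]
    [MeasurableSpace H] (μ : Measure H) (F : MultiresolutionFamily μ) (M j₀ : ℕ) (N : ℝ≥0∞)
    (E₀ E₁ E₂ : Set H) : Prop where
  measurable₀ : MeasurableSet E₀
  ne_top : μ E₀ ≠ ∞
  subset₁ : E₁ ⊆ E₀
  subset₂ : E₂ ⊆ E₁
  subset_X : E₀ ⊆ F.X
  doubling : ∀ x ∈ E₀, IsDyadicDoubling μ M j₀ x
  bound_ne_top : N ≠ ∞
  jones : ∀ x ∈ E₀, jonesFunction μ F 1 x ≤ N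
  density₁ : ∀ x ∈ E₁, ∀ j, j₀ ≤ j →
    μ (closedBall x ((1 / 2) ^ j)) ≤ 2 * μ (E₀ ∩ closedBall x ((1 / 2) ^ j))
  density₂ : ∀ x ∈ E₂, ∀ j, j₀ ≤ j →
    μ (closedBall x ((1 / 2) ^ j)) ≤ 2 * μ (E₁ ∩ closedBall x ((1 / 2) ^ j))

namespace GoodPieces

variable {H : Type*} [NormedAddCommGroup H] [InnerProductSpace ℝ H]
    [MeasurableSpace H] {μ : Measure H} {F : MultiresolutionFamily μ} {M j₀ h k₁ : ℕ} {N : ℝ≥0∞}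
    {E₀ E₁ E₂ : Set H}

theorem double_pos (G : GoodPieces μ F M j₀ N E₀ E₁ E₂) (hF : F.IsFine j₀ h k₁) {p : ℕ × H}
    (hp : p ∈ F.ballsNear k₁ E₁) : 0 < μ (F.double p) ∧ μ (F.double p) < ∞ := by
  obtain ⟨hk, -, x, hx, hd⟩ := hp
  have hdbl := G.doubling x (G.subset₁ hx)
  obtain ⟨h1, h2, h3⟩ := hF.closedBall_subset hk hd
  have := hF.le
  exact ⟨(hdbl.measure_pos (by positivity)).trans_le (measure_mono (h3.trans h1)),
    hdbl.measure_lt_top (j := p.1 - (h + 2)) (by omega) h2⟩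

/-- The part of a ball near `E₁` that lies in `E₀` has comparable measure. -/
theorem measure_closedBall_le (G : GoodPieces μ F M j₀ N E₀ E₁ E₂) (hF : F.IsFine j₀ h k₁)
    {p : ℕ × H} (hp : p ∈ F.ballsNear k₁ E₁) :
    μ (closedBall p.2 (F.lam * (1 / 2) ^ p.1)) ≤
      2 * M ^ (2 * h + 2) * μ (closedBall p.2 (F.lam * (1 / 2) ^ p.1) ∩ E₀) := by
  obtain ⟨hk, -, x, hx, hd⟩ := hp
  have hdbl := G.doubling x (G.subset₁ hx)
  obtain ⟨h1, h2, h3⟩ := hF.closedBall_subset hk hd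
  have := hF.le
  -- There are `2 * h + 2` halvings between the outer and the inner ball about `x`.
  have h4 := hdbl.measure_le (j := p.1 - (h + 2)) (by omega) (h1.trans h2) (2 * h + 2)
    (t := (1 / 2) ^ (p.1 + h)) (le_of_eq (by congr 1; omega))
  refine h4.trans ?_
  have h5 := G.density₁ x hx (p.1 + h) (by omega)
  calc (M : ℝ≥0∞) ^ (2 * h + 2) * μ (closedBall x ((1 / 2) ^ (p.1 + h)))
      ≤ M ^ (2 * h + 2) * (2 * μ (E₀ ∩ closedBall x ((1 / 2) ^ (p.1 + h)))) := by gcongr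
    _ ≤ M ^ (2 * h + 2) * (2 * μ (closedBall p.2 (F.lam * (1 / 2) ^ p.1) ∩ E₀)) := by
        rw [inter_comm]; gcongr
    _ = _ := by ring

variable [BorelSpace H] [TopologicalSpace.SeparableSpace H]

/-- Termwise integration of the Jones function over `E₀`. -/
theorem tsum_balls_ne_top (G : GoodPieces μ F M j₀ N E₀ E₁ E₂) :
    ∑' p : F.balls 1, betaTwoSq μ (closedBall p.1.2 (2 * F.radius p.1.1)) *
      (ENNReal.ofReal (diam (closedBall p.1.2 (F.radius p.1.1))) /
        μ (closedBall p.1.2 (F.radius p.1.1))) * μ (closedBall p.1.2 (F.radius p.1.1) ∩ E₀) ≠ ∞ := by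
  have : Countable (F.balls 1) := (F.countable_balls 1).to_subtype
  have h1 : ∫⁻ x in E₀, jonesFunction μ F 1 x ∂μ ≤ N * μ E₀ := by
    rw [← setLIntegral_const]
    exact setLIntegral_mono' G.measurable₀ G.jones
  unfold jonesFunction at h1
  rw [lintegral_tsum fun p => by
    exact (measurable_const.indicator isClosed_closedBall.measurableSet).aemeasurable] at h1
  refine ne_top_of_le_ne_top (ENNReal.mul_ne_top G.bound_ne_top G.ne_top) (le_trans ?_ h1)
  refine ENNReal.tsum_le_tsum fun p => ?_
  rw [lintegral_indicator_const isClosed_closedBall.measurableSet,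
    Measure.restrict_apply isClosed_closedBall.measurableSet]

/-- Near `E₁` the density of `E₀` absorbs the factor `μ (B ∩ E₀) / μ B`, and `diam B` is at least
`2^{-k}`. -/
theorem tsum_beta_ne_top [Nontrivial H] (G : GoodPieces μ F M j₀ N E₀ E₁ E₂)
    (hF : F.IsFine j₀ h k₁) :
    ∑' p : F.ballsNear k₁ E₁, betaTwoSq μ (F.double p) * ENNReal.ofReal ((1 / 2) ^ p.1.1) ≠ ∞ := by
  obtain ⟨f, hf, hfp⟩ := hF.exists_injective E₁
  have hC : (2 * M ^ (2 * h + 2) : ℝ≥0∞) ≠ ∞ :=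
    ENNReal.mul_ne_top (by simp) (ENNReal.pow_ne_top (ENNReal.natCast_ne_top M))
  refine ne_top_of_le_ne_top (ENNReal.mul_ne_top hC G.tsum_balls_ne_top) ?_
  refine le_trans ?_ (mul_le_mul_right (ENNReal.tsum_comp_le_tsum_of_injective hf _) _)
  rw [← ENNReal.tsum_mul_left]
  refine ENNReal.tsum_le_tsum fun p => ?_
  simp only [hfp, F.radius_natCast]
  set B := closedBall p.1.2 (F.lam * (1 / 2) ^ p.1.1) with hB
  have h1 := G.measure_closedBall_le hF p.2
  have hlam := F.one_lt_lam
  have hB0 : μ B ≠ 0 := by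
    obtain ⟨hk, -, x, hx, hd⟩ := p.2
    exact (((G.doubling x (G.subset₁ hx)).measure_pos (by positivity)).trans_le
      (measure_mono (hF.closedBall_subset hk hd).2.2)).ne'
  have hBt : μ B ≠ ∞ := by
    obtain ⟨hk, -, x, hx, hd⟩ := id p.2
    exact ((measure_mono (hF.closedBall_subset hk hd).1).trans_lt (G.double_pos hF p.2).2).ne
  have h2 : ENNReal.ofReal ((1 / 2) ^ p.1.1) ≤ ENNReal.ofReal (diam B) := by
    rw [hB, diam_closedBall_eq _ (by positivity)]
    refine ENNReal.ofReal_le_ofReal ?_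
    have : (0 : ℝ) < (1 / 2) ^ p.1.1 := by positivity
    nlinarith
  calc betaTwoSq μ (F.double p) * ENNReal.ofReal ((1 / 2) ^ p.1.1)
      ≤ betaTwoSq μ (F.double p) * (ENNReal.ofReal (diam B) / μ B * μ B) := by
        rw [ENNReal.div_mul_cancel hB0 hBt]; gcongr
    _ ≤ betaTwoSq μ (F.double p) * (ENNReal.ofReal (diam B) / μ B *
          (2 * M ^ (2 * h + 2) * μ (B ∩ E₀))) := by gcongr
    _ = _ := by unfold MultiresolutionFamily.double; ring

/-- Lines that are almost optimal for the beta numbers of the balls near `E₁`. -/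
theorem exists_lines [Nontrivial H] (G : GoodPieces μ F M j₀ N E₀ E₁ E₂)
    (hF : F.IsFine j₀ h k₁) :
    ∃ c u : ℕ × H → H, (∀ p ∈ F.ballsNear k₁ E₁, ‖u p‖ = 1) ∧
      ∑' p : F.ballsNear k₁ E₁, 2 ^ p.1.1 * (∫⁻ x in F.double p,
        ENNReal.ofReal (lineDist (c p) (u p) x ^ 2) ∂μ) / μ (F.double p) ≠ ∞ := by
  obtain ⟨f, hf, -⟩ := hF.exists_injective E₁
  have : Countable (F.balls 1) := (F.countable_balls 1).to_subtype
  have : Countable (F.ballsNear k₁ E₁) := hf.countable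
  -- The infimum over lines need not be attained; summable positive errors are allowed.
  obtain ⟨η, hη0, hη⟩ := ENNReal.exists_pos_sum_of_countable' one_ne_zero (F.ballsNear k₁ E₁)
  have hlam := F.lam_pos
  have hβ : ∀ p : F.ballsNear k₁ E₁, betaTwoSq μ (F.double p) ≠ ∞ := by
    intro p hp
    have h1 := ENNReal.ne_top_of_tsum_ne_top (G.tsum_beta_ne_top hF) p
    rw [hp, ENNReal.top_mul (by positivity)] at h1
    exact h1 rfl
  have hline : ∀ p : F.ballsNear k₁ E₁, ∃ c u : H, ‖u‖ = 1 ∧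
      2 ^ p.1.1 * (∫⁻ x in F.double p, ENNReal.ofReal (lineDist c u x ^ 2) ∂μ) / μ (F.double p) ≤
        ENNReal.ofReal ((4 * F.lam) ^ 2) *
          (betaTwoSq μ (F.double p) * ENNReal.ofReal ((1 / 2) ^ p.1.1) + η p) := by
    intro p
    have hμ := G.double_pos hF p.2
    have h1 : betaTwoSq μ (F.double p) < betaTwoSq μ (F.double p) + η p :=
      ENNReal.lt_add_right (hβ p) (hη0 p).ne'
    nth_rewrite 1 [betaTwoSq] at h1
    rw [if_neg hμ.1.ne'] at h1
    simp only [iInf_lt_iff] at h1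
    obtain ⟨ℓ, hℓ, h1⟩ := h1
    obtain ⟨c, u, hu, hcu⟩ := exists_lineDist_le_infDist ℓ hℓ
    refine ⟨c, u, hu, ?_⟩
    have hdiam : diam (F.double p) = 4 * F.lam * (1 / 2) ^ p.1.1 := by
      unfold MultiresolutionFamily.double
      rw [diam_closedBall_eq _ (by positivity)]
      ring
    have hd0 : 0 < diam (F.double p) := by rw [hdiam]; positivity
    have h2 : ∀ x, ENNReal.ofReal (lineDist c u x ^ 2) ≤ ENNReal.ofReal (diam (F.double p) ^ 2) *
        ENNReal.ofReal ((infDist x (ℓ : Set H) / diam (F.double p)) ^ 2) := by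
      intro x
      rw [← ENNReal.ofReal_mul (by positivity), ← mul_pow, mul_div_cancel₀ _ hd0.ne']
      exact ENNReal.ofReal_le_ofReal (pow_le_pow_left₀ (lineDist_nonneg _ _ _) (hcu x) 2)
    have h3 : ∫⁻ x in F.double p, ENNReal.ofReal (lineDist c u x ^ 2) ∂μ ≤
        ENNReal.ofReal (diam (F.double p) ^ 2) * ∫⁻ x in F.double p,
          ENNReal.ofReal ((infDist x (ℓ : Set H) / diam (F.double p)) ^ 2) ∂μ := by
      rw [← lintegral_const_mul' _ _ ENNReal.ofReal_ne_top]
      exact lintegral_mono h2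
    have h4 : (2 : ℝ≥0∞) ^ p.1.1 * ENNReal.ofReal (diam (F.double p) ^ 2) =
        ENNReal.ofReal ((4 * F.lam) ^ 2) * ENNReal.ofReal ((1 / 2) ^ p.1.1) := by
      rw [hdiam, ← ENNReal.ofReal_mul (by positivity), ← ENNReal.ofReal_ofNat 2,
        ← ENNReal.ofReal_pow (by norm_num), ← ENNReal.ofReal_mul (by positivity)]
      congr 1
      have : (2 : ℝ) ^ p.1.1 * (1 / 2) ^ p.1.1 = 1 := by rw [← mul_pow]; norm_num
      linear_combination (4 * F.lam) ^ 2 * (1 / 2) ^ p.1.1 * this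
    calc 2 ^ p.1.1 * (∫⁻ x in F.double p, ENNReal.ofReal (lineDist c u x ^ 2) ∂μ) / μ (F.double p)
        ≤ 2 ^ p.1.1 * (ENNReal.ofReal (diam (F.double p) ^ 2) * ∫⁻ x in F.double p,
          ENNReal.ofReal ((infDist x (ℓ : Set H) / diam (F.double p)) ^ 2) ∂μ) /
            μ (F.double p) := by gcongr
      _ = ENNReal.ofReal ((4 * F.lam) ^ 2) * ENNReal.ofReal ((1 / 2) ^ p.1.1) *
          ((∫⁻ x in F.double p,
            ENNReal.ofReal ((infDist x (ℓ : Set H) / diam (F.double p)) ^ 2) ∂μ) /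
              μ (F.double p)) := by rw [← mul_assoc, h4, mul_div_assoc]
      _ ≤ ENNReal.ofReal ((4 * F.lam) ^ 2) * ENNReal.ofReal ((1 / 2) ^ p.1.1) *
          (betaTwoSq μ (F.double p) + η p) := by gcongr
      _ ≤ _ := by
          rw [mul_assoc, mul_add, mul_comm (ENNReal.ofReal ((1 / 2) ^ p.1.1))]
          gcongr
          refine mul_le_of_le_one_left zero_le ?_
          rw [← ENNReal.ofReal_one]
          exact ENNReal.ofReal_le_ofReal (pow_le_one₀ (by norm_num) (by norm_num))
  choose c u hu hcu using hline
  classical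
  refine ⟨fun p => if hp : p ∈ F.ballsNear k₁ E₁ then c ⟨p, hp⟩ else 0,
    fun p => if hp : p ∈ F.ballsNear k₁ E₁ then u ⟨p, hp⟩ else 0, fun p hp => ?_, ?_⟩
  · simp only [hp, dite_true]
    exact hu _
  · have h1 : ∑' p : F.ballsNear k₁ E₁, ENNReal.ofReal ((4 * F.lam) ^ 2) *
          (betaTwoSq μ (F.double p) * ENNReal.ofReal ((1 / 2) ^ p.1.1) + η p) ≠ ∞ := by
      rw [ENNReal.tsum_mul_left, ENNReal.tsum_add]
      exact ENNReal.mul_ne_top ENNReal.ofReal_ne_top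
        (ENNReal.add_ne_top.2 ⟨G.tsum_beta_ne_top hF, (hη.trans ENNReal.one_lt_top).ne⟩)
    refine ne_top_of_le_ne_top h1 (ENNReal.tsum_le_tsum fun p => ?_)
    simp only [Subtype.coe_prop, dite_true, Subtype.coe_eta]
    exact hcu p

end GoodPieces

/-! ### Nets adapted to the lines -/

section

variable {H : Type*} [NormedAddCommGroup H] [InnerProductSpace ℝ H] [MeasurableSpace H]
  {μ : Measure H}

/-- The weighted squared distance to the line attached to a ball, on the double of the ball. -/
noncomputable def lineCost (F : MultiresolutionFamily μ) (c u : ℕ × H → H) (p : ℕ × H) (x : H) :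
    ℝ≥0∞ :=
  (F.double p).indicator (fun x => 2 ^ p.1 * ENNReal.ofReal (lineDist (c p) (u p) x ^ 2)) x

/-- The sum of the weighted squared distances over the balls of generation at least `k`. -/
noncomputable def tailCost (F : MultiresolutionFamily μ) (k₁ : ℕ) (E : Set H) (c u : ℕ × H → H)
    (k : ℕ) (x : H) : ℝ≥0∞ :=
  ∑' p : F.ballsNear k₁ E, if k ≤ p.1.1 then lineCost F c u p x else 0

theorem lintegral_lineCost [BorelSpace H] (F : MultiresolutionFamily μ) (c u : ℕ × H → H)
    (p : ℕ × H) : ∫⁻ x, lineCost F c u p x ∂μ =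
      2 ^ p.1 * ∫⁻ x in F.double p, ENNReal.ofReal (lineDist (c p) (u p) x ^ 2) ∂μ := by
  unfold lineCost
  rw [lintegral_indicator (show MeasurableSet (F.double p) from isClosed_closedBall.measurableSet),
    lintegral_const_mul' _ _ (by simp)]

theorem measurable_lineCost [BorelSpace H] (F : MultiresolutionFamily μ) (c u : ℕ × H → H)
    (p : ℕ × H) : Measurable (lineCost F c u p) := by
  unfold lineCost
  refine Measurable.indicator ?_ isClosed_closedBall.measurableSet
  refine Measurable.const_mul ?_ _
  exact (ENNReal.continuous_ofReal.comp
    ((continuous_lineDist _ _).pow 2)).measurable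

theorem measurable_tailCost [BorelSpace H] {F : MultiresolutionFamily μ} {k₁ : ℕ} {E : Set H}
    [Countable (F.ballsNear k₁ E)] (c u : ℕ × H → H) (k : ℕ) :
    Measurable (tailCost F k₁ E c u k) := by
  unfold tailCost
  refine Measurable.tsum fun p => ?_
  split_ifs
  exacts [measurable_lineCost F c u p, measurable_const]

/-- Balls whose double misses `A` contribute nothing; for the others the integral over `A` is
replaced by the full one. -/
theorem setLIntegral_tailCost_le [BorelSpace H] {F : MultiresolutionFamily μ} {k₁ : ℕ} {E : Set H}
    [Countable (F.ballsNear k₁ E)] (c u : ℕ × H → H) (k : ℕ) (A : Set H) :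
    ∫⁻ x in A, tailCost F k₁ E c u k x ∂μ ≤ ∑' p : F.ballsNear k₁ E,
      {p : ℕ × H | k ≤ p.1 ∧ (F.double p ∩ A).Nonempty}.indicator (fun p =>
        2 ^ p.1 * ∫⁻ x in F.double p, ENNReal.ofReal (lineDist (c p) (u p) x ^ 2) ∂μ) p := by
  unfold tailCost
  rw [lintegral_tsum fun p => by
    split_ifs
    exacts [(measurable_lineCost F c u p).aemeasurable, aemeasurable_const]]
  refine ENNReal.tsum_le_tsum fun p => ?_
  by_cases hk : k ≤ p.1.1
  swap
  · simp [hk]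
  simp only [hk, if_true]
  by_cases hA : (F.double p ∩ A).Nonempty
  · rw [indicator_of_mem (show p.1 ∈ {p : ℕ × H | k ≤ p.1 ∧ (F.double p ∩ A).Nonempty} from
      ⟨hk, hA⟩), ← lintegral_lineCost]
    exact setLIntegral_le_lintegral _ _
  · have h1 : ∀ x ∈ A, lineCost F c u p x = 0 := fun x hx =>
      indicator_of_notMem (fun h => hA ⟨x, h, hx⟩) _
    have h2 := setLIntegral_mono (μ := μ) measurable_const fun x hx => (h1 x hx).le
    refine h2.trans ?_
    simp

end

/-- The points of a net that do not belong to the previous one. -/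
noncomputable def newPoints {X : Type*} (V : ℕ → Finset X) : ℕ → Finset X
  | 0 => V 0
  | i + 1 => by classical exact V (i + 1) \ V i

/-- A sequence of nets of the set `E`, with points in `E₁`, whose new points are close to the lines
of all smaller balls on average. -/
structure AdaptedNets {H : Type*} [NormedAddCommGroup H] [InnerProductSpace ℝ H]
    [MeasurableSpace H] (μ : Measure H) (F : MultiresolutionFamily μ) (M k₁ m : ℕ) (E₁ E : Set H)
    (c u : ℕ × H → H) (V : ℕ → Finset H) : Prop where
  subset : ∀ i, ∀ v ∈ V i, v ∈ E₁
  mono : ∀ i, V i ⊆ V (i + 1)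
  separated : ∀ i, ∀ v ∈ V i, ∀ w ∈ V i, v ≠ w → (1 / 2) ^ (k₁ + m + i) ≤ dist v w
  covers : ∀ i, ∀ y ∈ E, ∃ v ∈ V i, dist y v ≤ 2 * (1 / 2) ^ (k₁ + m + i)
  near : ∀ i, ∀ v ∈ V (i + 1), ∃ w ∈ V i, dist v w ≤ 2 * (1 / 2) ^ (k₁ + m + i)
  cost : ∀ i, ∀ v ∈ newPoints V i, tailCost F k₁ E₁ c u (k₁ + i) v *
      μ (closedBall v ((1 / 2) ^ (k₁ + m + i + 1))) ≤
    2 * M ^ 2 * ∫⁻ x in closedBall v ((1 / 2) ^ (k₁ + m + i + 1)),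
      tailCost F k₁ E₁ c u (k₁ + i) x ∂μ

namespace GoodPieces

variable {H : Type*} [NormedAddCommGroup H] [InnerProductSpace ℝ H]
  [MeasurableSpace H] {μ : Measure H} {F : MultiresolutionFamily μ} {M j₀ h k₁ : ℕ} {N : ℝ≥0∞}
  {E₀ E₁ E₂ : Set H}

/-- Near every point of `E₂` there is a point of `E₁` at which a given function is at most a
multiple of its average. -/
theorem exists_le_average (G : GoodPieces μ F M j₀ N E₀ E₁ E₂) {g : H → ℝ≥0∞} (hg : Measurable g)
    {y : H} (hy : y ∈ E₂) {n : ℕ} (hn : j₀ ≤ n) :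
    ∃ v ∈ E₁, dist v y ≤ (1 / 2) ^ (n + 2) ∧ g v * μ (closedBall v ((1 / 2) ^ (n + 1))) ≤
      2 * M ^ 2 * ∫⁻ x in closedBall v ((1 / 2) ^ (n + 1)), g x ∂μ := by
  have hdbl := G.doubling y (G.subset₁ (G.subset₂ hy))
  set P := E₁ ∩ closedBall y ((1 / 2) ^ (n + 2)) with hP
  have hd := G.density₂ y hy (n + 2) (by omega)
  have hP0 : μ P ≠ 0 := by
    intro h0
    rw [h0, mul_zero, nonpos_iff_eq_zero] at hd
    exact (hdbl (n + 2) (by omega)).1.ne' hd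
  have hPt : μ P ≠ ∞ := measure_ne_top_of_subset inter_subset_right
    (hdbl (n + 2) (by omega)).2.1.ne
  -- Some point of `P` is at most the average over `P`; density at `y` and doubling make `μ P`
  -- comparable to the measure of the ball about `v`.
  obtain ⟨v, hv, hle⟩ := exists_le_setLAverage hP0 hPt (hg.aemeasurable (μ := μ.restrict P))
  have hvy : dist v y ≤ (1 / 2) ^ (n + 2) := hv.2
  have e1 : (1 / 2 : ℝ) ^ (n + 1) = (1 / 2) ^ n / 2 := by rw [pow_add]; ring
  have e2 : (1 / 2 : ℝ) ^ (n + 2) = (1 / 2) ^ n / 4 := by rw [pow_add]; ring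
  have hpos : (0 : ℝ) < (1 / 2) ^ n := by positivity
  refine ⟨v, hv.1, hvy, ?_⟩
  rw [setLAverage_eq] at hle
  have h1 : μ (closedBall v ((1 / 2) ^ (n + 1))) ≤ 2 * M ^ 2 * μ P := by
    refine (hdbl.measure_le hn (closedBall_subset_closedBall' (by linarith)) 2 le_rfl).trans ?_
    calc (M : ℝ≥0∞) ^ 2 * μ (closedBall y ((1 / 2) ^ (n + 2))) ≤ M ^ 2 * (2 * μ P) := by gcongr
      _ = _ := by ring
  have h2 : P ⊆ closedBall v ((1 / 2) ^ (n + 1)) :=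
    inter_subset_right.trans (closedBall_subset_closedBall' (by rw [dist_comm]; linarith))
  calc g v * μ (closedBall v ((1 / 2) ^ (n + 1)))
      ≤ (∫⁻ x in P, g x ∂μ) / μ P * (2 * M ^ 2 * μ P) := by gcongr
    _ = 2 * M ^ 2 * ((∫⁻ x in P, g x ∂μ) / μ P * μ P) := by ring
    _ = 2 * M ^ 2 * ∫⁻ x in P, g x ∂μ := by rw [ENNReal.div_mul_cancel hP0 hPt]
    _ ≤ _ := by gcongr

variable [BorelSpace H]

/-- Extension of a net to the next scale. -/
theorem exists_net_extension (G : GoodPieces μ F M j₀ N E₀ E₁ E₂) {g : H → ℝ≥0∞}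
    (hg : Measurable g) {z : H} {n i : ℕ} (hn : j₀ ≤ n) (W : Finset H) (hW : ∀ v ∈ W, v ∈ E₁)
    (hWz : ∀ v ∈ W, dist v z ≤ (1 / 2) ^ (n + 2))
    (hsep : ∀ v ∈ W, ∀ w ∈ W, v ≠ w → (1 / 2) ^ (n + 2 + i + 1) ≤ dist v w) :
    ∃ A : Finset H, W ⊆ A ∧ (∀ v ∈ A, v ∈ E₁) ∧
      (∀ v ∈ A, dist v z ≤ (1 / 2) ^ (n + 2)) ∧
      (∀ v ∈ A, ∀ w ∈ A, v ≠ w → (1 / 2) ^ (n + 2 + i + 1) ≤ dist v w) ∧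
      (∀ y ∈ E₂ ∩ closedBall z ((1 / 2) ^ (n + 3)), ∃ v ∈ A,
        dist y v ≤ 5 / 4 * (1 / 2) ^ (n + 2 + i + 1)) ∧
      ∀ v ∈ A, v ∉ W → (∃ y ∈ E₂ ∩ closedBall z ((1 / 2) ^ (n + 3)),
          dist v y ≤ (1 / 2) ^ (n + 2 + i + 1 + 2)) ∧
        g v * μ (closedBall v ((1 / 2) ^ (n + 2 + i + 1 + 1))) ≤
          2 * M ^ 2 * ∫⁻ x in closedBall v ((1 / 2) ^ (n + 2 + i + 1 + 1)), g x ∂μ := by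
  classical
  set Q : Finset H → Prop := fun A => W ⊆ A ∧ (∀ v ∈ A, v ∈ E₁) ∧
      (∀ v ∈ A, dist v z ≤ (1 / 2) ^ (n + 2)) ∧
      (∀ v ∈ A, ∀ w ∈ A, v ≠ w → (1 / 2) ^ (n + 2 + i + 1) ≤ dist v w) ∧
      ∀ v ∈ A, v ∉ W → (∃ y ∈ E₂ ∩ closedBall z ((1 / 2) ^ (n + 3)),
          dist v y ≤ (1 / 2) ^ (n + 2 + i + 1 + 2)) ∧
        g v * μ (closedBall v ((1 / 2) ^ (n + 2 + i + 1 + 1))) ≤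
          2 * M ^ 2 * ∫⁻ x in closedBall v ((1 / 2) ^ (n + 2 + i + 1 + 1)), g x ∂μ with hQ
  have hQW : Q W := ⟨subset_rfl, hW, hWz, hsep, fun v hv hv' => absurd hv hv'⟩
  -- Packing bounds the cardinalities, so a largest admissible extension exists.
  have hbdd : BddAbove {k | ∃ A, Q A ∧ A.card = k} := by
    refine ⟨M ^ (i + 1 + 4), ?_⟩
    rintro _ ⟨A, ⟨-, hA, hAz, hAs, -⟩, rfl⟩
    exact IsDyadicDoubling.card_le (x := z) (fun p hp => G.doubling p (G.subset₁ (hA p hp))) hn hAz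
      (i := i + 1) hAs
  obtain ⟨A, hA, hcard⟩ := Nat.sSup_mem (s := {k | ∃ A, Q A ∧ A.card = k}) ⟨_, W, hQW, rfl⟩ hbdd
  refine ⟨A, hA.1, hA.2.1, hA.2.2.1, hA.2.2.2.1, fun y hy => ?_, hA.2.2.2.2⟩
  obtain ⟨v, hv, hvy, hvg⟩ := G.exists_le_average hg hy.1 (n := n + 2 + i + 1) (by omega)
  set ρ : ℝ := (1 / 2) ^ (n + 2 + i + 1) with hρ
  have hρ2 : (1 / 2 : ℝ) ^ (n + 2 + i + 1 + 2) = ρ / 4 := by rw [pow_add, ← hρ]; ring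
  have hρ0 : 0 < ρ := by positivity
  -- Otherwise the good point `v` could be added. As it is within `ρ / 4` of `y`, the covering
  -- constant is `5 / 4`.
  suffices hex : ∃ w ∈ A, dist v w < ρ by
    obtain ⟨w, hw, hvw⟩ := hex
    refine ⟨w, hw, ?_⟩
    rw [dist_comm] at hvy
    linarith [dist_triangle y v w]
  by_contra! hfar
  have hvA : v ∉ A := fun hvA => by
    have := hfar v hvA
    rw [dist_self] at this
    linarith
  have hQv : Q (insert v A) := by
    refine ⟨hA.1.trans (Finset.subset_insert _ _), ?_, ?_, ?_, ?_⟩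
    · intro w hw
      rcases Finset.mem_insert.1 hw with rfl | hw
      exacts [hv, hA.2.1 w hw]
    · intro w hw
      rcases Finset.mem_insert.1 hw with rfl | hw
      · have h1 := mem_closedBall.1 hy.2
        have h2 : (1 / 2 : ℝ) ^ (n + 3) = (1 / 2) ^ (n + 2) / 2 := by rw [pow_succ]; ring
        have h3 : ρ ≤ (1 / 2) ^ (n + 2) :=
          pow_le_pow_of_le_one (by norm_num) (by norm_num) (by omega)
        linarith [dist_triangle w y z]
      · exact hA.2.2.1 w hw
    · intro a ha b hb hab
      rcases Finset.mem_insert.1 ha with ha' | ha' <;>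
        rcases Finset.mem_insert.1 hb with hb' | hb'
      · exact absurd (ha'.trans hb'.symm) hab
      · exact ha' ▸ hfar b hb'
      · rw [dist_comm]; exact hb' ▸ hfar a ha'
      · exact hA.2.2.2.1 a ha' b hb' hab
    · intro w hw hwW
      rcases Finset.mem_insert.1 hw with rfl | hw
      · exact ⟨⟨y, hy, hvy⟩, hvg⟩
      · exact hA.2.2.2.2 w hw hwW
  have hle := le_csSup hbdd ⟨insert v A, hQv, rfl⟩
  rw [Finset.card_insert_of_notMem hvA, ← hcard] at hle
  omega

theorem exists_adaptedNets [TopologicalSpace.SeparableSpace H]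
    (G : GoodPieces μ F M j₀ N E₀ E₁ E₂) (hF : F.IsFine j₀ h k₁) (m : ℕ)
    (c u : ℕ × H → H) (z : H)
    (hne : (E₂ ∩ closedBall z ((1 / 2) ^ (k₁ + m + 1))).Nonempty) :
    ∃ V, AdaptedNets μ F M k₁ m E₁ (E₂ ∩ closedBall z ((1 / 2) ^ (k₁ + m + 1))) c u V := by
  classical
  obtain ⟨f, hf, -⟩ := hF.exists_injective E₁
  have : Countable (F.balls 1) := (F.countable_balls 1).to_subtype
  have : Countable (F.ballsNear k₁ E₁) := hf.countable
  have hmeas := fun k => measurable_tailCost (F := F) (k₁ := k₁) (E := E₁) c u k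
  have hle := hF.le
  obtain ⟨n, hn⟩ := Nat.exists_eq_add_of_le (show 2 ≤ k₁ + m by omega)
  have hkn : k₁ + m = n + 2 := by omega
  set E := E₂ ∩ closedBall z ((1 / 2) ^ (k₁ + m + 1)) with hE
  -- the invariant of the construction
  set Inv : ℕ → Finset H → Prop := fun i A => (∀ v ∈ A, v ∈ E₁) ∧
    (∀ v ∈ A, dist v z ≤ (1 / 2) ^ (n + 2)) ∧
    (∀ v ∈ A, ∀ w ∈ A, v ≠ w → (1 / 2) ^ (k₁ + m + i) ≤ dist v w) ∧
    (∀ y ∈ E, ∃ v ∈ A, dist y v ≤ 5 / 4 * (1 / 2) ^ (k₁ + m + i)) with hInv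
  have hstep : ∀ i A, ∃ B, Inv i A → Inv (i + 1) B ∧ A ⊆ B ∧ ∀ v ∈ B, v ∉ A →
      (∃ y ∈ E, dist v y ≤ (1 / 2) ^ (k₁ + m + i + 1 + 2)) ∧
      tailCost F k₁ E₁ c u (k₁ + (i + 1)) v * μ (closedBall v ((1 / 2) ^ (k₁ + m + (i + 1) + 1))) ≤
        2 * M ^ 2 * ∫⁻ x in closedBall v ((1 / 2) ^ (k₁ + m + (i + 1) + 1)),
          tailCost F k₁ E₁ c u (k₁ + (i + 1)) x ∂μ := by
    intro i A
    by_cases hA : Inv i A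
    swap
    · exact ⟨A, fun h => absurd h hA⟩
    obtain ⟨B, h1, h2, h3, h4, h5, h6⟩ := G.exists_net_extension (hmeas (k₁ + (i + 1))) (z := z)
      (n := n) (i := i) (by omega) A hA.1 hA.2.1 (fun v hv w hw hvw => by
        refine le_trans ?_ (hA.2.2.1 v hv w hw hvw)
        rw [hkn]
        exact pow_le_pow_of_le_one (by norm_num) (by norm_num) (by omega))
    refine ⟨B, fun _ => ⟨⟨h2, h3, ?_, ?_⟩, h1, ?_⟩⟩
    · rw [hkn]; exact h4
    · rw [hE, hkn]; exact h5
    · rw [hE, hkn]; exact h6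
  choose next hnext using hstep
  obtain ⟨y₀, hy₀⟩ := hne
  obtain ⟨v₀, hv₀, hvy₀, hvg₀⟩ := G.exists_le_average (hmeas k₁) hy₀.1 (n := k₁ + m) (by omega)
  -- One point suffices at the start: any point of `E` is within one scale of `y₀`, and `v₀` within
  -- a quarter of it.
  set V : ℕ → Finset H := fun i => Nat.rec {v₀} (fun i A => next i A) i with hV
  have hρ1 : (1 / 2 : ℝ) ^ (k₁ + m + 1) = (1 / 2) ^ (k₁ + m) / 2 := by rw [pow_succ]; ring
  have hρ2 : (1 / 2 : ℝ) ^ (k₁ + m + 2) = (1 / 2) ^ (k₁ + m) / 4 := by rw [pow_add]; ring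
  have hρ0 : (0 : ℝ) < (1 / 2) ^ (k₁ + m) := by positivity
  have hI : ∀ i, Inv i (V i) := by
    intro i
    induction i with
    | zero =>
      refine ⟨by simpa [hV] using hv₀, ?_, ?_, ?_⟩
      · intro v hv
        obtain rfl : v = v₀ := by simpa [hV] using hv
        have := mem_closedBall.1 hy₀.2
        rw [← hkn]
        linarith [dist_triangle v y₀ z]
      · intro v hv w hw hvw
        obtain rfl : v = v₀ := by simpa [hV] using hv
        obtain rfl : w = v := by simpa [hV] using hw
        exact absurd rfl hvw
      · intro y hy
        refine ⟨v₀, by simp [hV], ?_⟩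
        have h1 := mem_closedBall.1 hy₀.2
        have h2 := mem_closedBall.1 hy.2
        rw [dist_comm] at h1 hvy₀
        have h3 := dist_triangle y z y₀
        have h4 := dist_triangle y y₀ v₀
        rw [add_zero]
        linarith
    | succ i ih => exact (hnext i (V i) ih).1
  have hS : ∀ i, _ := fun i => (hnext i (V i) (hI i)).2
  have hVs : ∀ i, V (i + 1) = next i (V i) := fun i => rfl
  refine ⟨V, fun i => (hI i).1, fun i => (hS i).1, fun i => (hI i).2.2.1,
    fun i y hy => ?_, fun i v hv => ?_, fun i v hv => ?_⟩
  · obtain ⟨v, hv, hd⟩ := (hI i).2.2.2 y hy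
    refine ⟨v, hv, hd.trans ?_⟩
    gcongr
    norm_num
  · by_cases hvi : v ∈ V i
    · exact ⟨v, hvi, by rw [dist_self]; positivity⟩
    obtain ⟨⟨y, hy, hd⟩, -⟩ := (hS i).2 v hv hvi
    obtain ⟨w, hw, hd'⟩ := (hI i).2.2.2 y hy
    refine ⟨w, hw, ?_⟩
    have h1 : (1 / 2 : ℝ) ^ (k₁ + m + i + 1 + 2) = (1 / 2) ^ (k₁ + m + i) / 8 := by
      rw [pow_add, pow_succ]; ring
    have h2 : (0 : ℝ) < (1 / 2) ^ (k₁ + m + i) := by positivity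
    linarith [dist_triangle v y w]
  · cases i with
    | zero =>
      obtain rfl : v = v₀ := by simpa [hV, newPoints] using hv
      exact hvg₀
    | succ i =>
      have hv' : v ∈ V (i + 1) ∧ v ∉ V i := by simpa [newPoints] using hv
      exact ((hS i).2 v hv'.1 hv'.2).2

end GoodPieces

/-! ### Summation over the new points -/

/-- Telescoping with step `q`: what survives is at most the last `q` values. -/
theorem sum_add_sub_le {f : ℕ → ℝ} (hf : Monotone f) (h0 : ∀ i, 0 ≤ f i) (q l : ℕ) :
    ∑ i ∈ Finset.range (l + 1), (f (i + q) - f i) ≤ q * f (l + q) := by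
  induction q with
  | zero => simp
  | succ q ih =>
    have h1 : ∑ i ∈ Finset.range (l + 1), (f (i + (q + 1)) - f i) =
        ∑ i ∈ Finset.range (l + 1), (f (i + 1 + q) - f (i + q)) +
          ∑ i ∈ Finset.range (l + 1), (f (i + q) - f i) := by
      rw [← Finset.sum_add_distrib]
      refine Finset.sum_congr rfl fun i _ => ?_
      rw [add_assoc, add_comm 1 q]
      ring
    rw [h1, Finset.sum_range_sub fun i => f (i + q)]
    have h2 := mul_le_mul_of_nonneg_left (hf (show l + q ≤ l + (q + 1) by omega))
      (Nat.cast_nonneg (α := ℝ) q)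
    have h3 := h0 (0 + q)
    rw [show l + 1 + q = l + (q + 1) by ring]
    push_cast
    linarith

/-- If a decreasing sequence drops by a definite proportion after each index of `K`, then the
reciprocals over `K` are dominated by the last one. -/
theorem sum_ratio_le {a : ℕ → ℝ} (hpos : ∀ i, 0 < a i) (ha : Antitone a) {A : ℝ} (hA : 0 ≤ A)
    {q l : ℕ} {K : Finset ℕ} (hK : K ⊆ Finset.range (l + 1))
    (hdrop : ∀ i ∈ K, a i ≤ A * (a i - a (i + q))) :
    ∑ i ∈ K, a l / a i ≤ A * (q * (a l / a (l + q))) := by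
  set f : ℕ → ℝ := fun i => (a i)⁻¹ with hf
  have hfm : Monotone f := fun i j hij => inv_anti₀ (hpos j) (ha hij)
  have hf0 : ∀ i, 0 ≤ f i := fun i => (inv_pos.2 (hpos i)).le
  -- A proportional drop of `a` is a proportional jump of its reciprocal: the right side is at least
  -- `f (i + q)`.
  have h1 : ∀ i ∈ K, f i ≤ A * (f (i + q) - f i) := by
    intro i hi
    have h2 := hdrop i hi
    have h3 : a (i + q) ≤ a i := ha (by omega)
    have hp := hpos i
    have hp' := hpos (i + q)
    have h4 : f (i + q) - f i = (a i - a (i + q)) / (a (i + q) * a i) := by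
      rw [hf]; field_simp
    rw [h4, hf, ← mul_div_assoc, le_div_iff₀ (by positivity)]
    have h5 : (a i)⁻¹ * (a (i + q) * a i) = a (i + q) := by field_simp
    simp only [h5]
    linarith
  calc ∑ i ∈ K, a l / a i = a l * ∑ i ∈ K, f i := by
        rw [Finset.mul_sum]; exact Finset.sum_congr rfl fun i _ => div_eq_mul_inv _ _
    _ ≤ a l * ∑ i ∈ K, A * (f (i + q) - f i) := by
        gcongr with i hi
        · exact (hpos l).le
        · exact h1 i hi
    _ ≤ a l * ∑ i ∈ Finset.range (l + 1), A * (f (i + q) - f i) := by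
        refine mul_le_mul_of_nonneg_left (Finset.sum_le_sum_of_subset_of_nonneg hK fun i _ _ => ?_)
          (hpos l).le
        exact mul_nonneg hA (sub_nonneg.2 (hfm (by omega)))
    _ ≤ a l * (A * (q * f (l + q))) := by
        rw [← Finset.mul_sum]
        gcongr
        · exact (hpos l).le
        · exact sum_add_sub_le hfm hf0 q l
    _ = _ := by rw [hf, div_eq_mul_inv]; ring

theorem newPoints_subset {X : Type*} (V : ℕ → Finset X) (i : ℕ) : newPoints V i ⊆ V i := by
  classical
  cases i with
  | zero => exact subset_rfl
  | succ i => exact Finset.sdiff_subset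

/-- The shift `h + 4` of the first generation is used here: both the double and the ball about `v`
have half of the allowed distance to spend. -/
theorem MultiresolutionFamily.IsFine.dist_le_of_near {H : Type*} [NormedAddCommGroup H]
    [MeasurableSpace H] {μ : Measure H} {F : MultiresolutionFamily μ} {j₀ h κ m : ℕ}
    (hF : F.IsFine j₀ h (κ + (h + 4))) {p : ℕ × H}
    (hp : κ + (h + 4) ≤ p.1) {x : H} (hx : dist x p.2 ≤ (1 / 2) ^ p.1) {i : ℕ}
    (hi : κ + (h + 4) + i ≤ p.1) {v : H}
    (hv : (F.double p ∩ closedBall v ((1 / 2) ^ (κ + (h + 4) + m + i + 1))).Nonempty) :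
    dist v x ≤ (1 / 2) ^ (κ + i + 1) := by
  obtain ⟨y, hy, hyv⟩ := hv
  have h1 := mem_closedBall.1 ((hF.closedBall_subset hp hx).2.1 hy)
  have h2 : (1 / 2 : ℝ) ^ (p.1 - (h + 2)) ≤ (1 / 2) ^ (κ + i + 2) :=
    pow_le_pow_of_le_one (by norm_num) (by norm_num) (by omega)
  have h3 : (1 / 2 : ℝ) ^ (κ + (h + 4) + m + i + 1) ≤ (1 / 2) ^ (κ + i + 2) :=
    pow_le_pow_of_le_one (by norm_num) (by norm_num) (by omega)
  have h4 : (1 / 2 : ℝ) ^ (κ + i + 2) = (1 / 2) ^ (κ + i + 1) / 2 := by rw [pow_succ]; ring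
  have h5 := mem_closedBall.1 hyv
  rw [dist_comm] at h5
  linarith [dist_triangle v y x]

namespace GoodPieces

variable {H : Type*} [NormedAddCommGroup H] [InnerProductSpace ℝ H]
  [MeasurableSpace H] {μ : Measure H} {F : MultiresolutionFamily μ} {M j₀ h κ m : ℕ} {N : ℝ≥0∞}
  {E₀ E₁ E₂ E : Set H} {c u : ℕ × H → H} {V : ℕ → Finset H}

/-- A new point near `x` forces the measure of the balls about `x` to drop. -/
theorem measure_drop [BorelSpace H] (G : GoodPieces μ F M j₀ N E₀ E₁ E₂)
    (A : AdaptedNets μ F M (κ + (h + 4)) m E₁ E c u V) (hκ : j₀ + 1 ≤ κ) {x v : H} {i : ℕ}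
    (hv : v ∈ newPoints V (i + 1)) (hvx : dist v x ≤ (1 / 2) ^ (κ + (i + 1) + 1)) :
    μ (closedBall x ((1 / 2) ^ (κ + (i + 1)))) ≤ M ^ (h + m + 8) *
      (μ (closedBall x ((1 / 2) ^ (κ + (i + 1)))) -
        μ (closedBall x ((1 / 2) ^ (κ + (i + 1) + (h + m + 7))))) := by
  classical
  have hv' : v ∈ V (i + 1) ∧ v ∉ V i := by simpa [newPoints] using hv
  obtain ⟨w, hw, hvw⟩ := A.near i v hv'.1
  have hsep := A.separated (i + 1) v hv'.1 w (A.mono i hw) (fun h => hv'.2 (h ▸ hw))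
  set R : ℝ := (1 / 2) ^ (κ + (i + 1)) with hR
  set ρ : ℝ := (1 / 2) ^ (κ + (h + 4) + m + (i + 1)) with hρ
  have hR0 : 0 < R := by positivity
  have hρ0 : 0 < ρ := by positivity
  have hρR : ρ ≤ R / 16 := by
    have : R / 16 = (1 / 2) ^ (κ + (i + 1) + 4) := by rw [pow_add, ← hR]; ring
    rw [this]
    exact pow_le_pow_of_le_one (by norm_num) (by norm_num) (by omega)
  have e1 : (1 / 2 : ℝ) ^ (κ + (h + 4) + m + i) = 2 * ρ := by
    rw [hρ, ← add_assoc (κ + (h + 4) + m), pow_succ]; ring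
  have e2 : (1 / 2 : ℝ) ^ (κ + (i + 1) + 1) = R / 2 := by rw [pow_succ]; ring
  have e3 : (1 / 2 : ℝ) ^ (κ + (i + 1) + (h + m + 7)) = ρ / 8 := by
    rw [hρ, show κ + (i + 1) + (h + m + 7) = κ + (h + 4) + m + (i + 1) + 3 by ring,
      pow_add _ (κ + (h + 4) + m + (i + 1))]
    ring
  have e4 : (1 / 2 : ℝ) ^ (κ + i) = 2 * R := by rw [hR, ← add_assoc, pow_succ]; ring
  rw [e1] at hvw
  rw [e2] at hvx
  -- The points `v` and `w` are at least `ρ` apart, so one of them is at least `ρ / 2` away from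
  -- `x`; a small ball about it is the measure that is lost.
  obtain ⟨w', hw', hd1, hd2⟩ : ∃ w' ∈ E₁, ρ / 2 ≤ dist w' x ∧ dist w' x ≤ R / 2 + 4 * ρ := by
    rcases le_or_gt (ρ / 2) (dist v x) with hle | hlt
    · exact ⟨v, A.subset _ v hv'.1, hle, by linarith⟩
    · refine ⟨w, A.subset _ w hw, ?_, ?_⟩
      · linarith [dist_triangle v x w, dist_comm x w]
      · linarith [dist_triangle w v x, dist_comm v w]
  have hdbl := G.doubling w' (G.subset₁ hw')
  have hsub : closedBall x R ⊆ closedBall w' ((1 / 2) ^ (κ + i)) := by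
    rw [e4]
    exact closedBall_subset_closedBall' (by rw [dist_comm]; linarith)
  have h1 := hdbl.measure_le (by omega) hsub (h + m + 8) (t := ρ / 8)
    (le_of_eq (by rw [← e3]; congr 1; ring))
  have hfin : μ (closedBall x R) ≠ ∞ := (hdbl.measure_lt_top (by omega) hsub).ne
  have hdisj : Disjoint (closedBall w' (ρ / 8)) (closedBall x (ρ / 8)) :=
    closedBall_disjoint_closedBall (by linarith)
  have h2 : μ (closedBall w' (ρ / 8)) + μ (closedBall x (ρ / 8)) ≤ μ (closedBall x R) := by
    rw [← measure_union hdisj isClosed_closedBall.measurableSet]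
    exact measure_mono (union_subset (closedBall_subset_closedBall' (by linarith))
      (closedBall_subset_closedBall (by linarith)))
  rw [e3]
  refine h1.trans ?_
  gcongr
  refine ENNReal.le_sub_of_add_le_right ?_ h2
  exact measure_ne_top_of_subset (closedBall_subset_closedBall (by linarith)) hfin

/-- For a fixed ball, the new points of larger scales near it have summable relative weight. -/
theorem sum_measure_ratio_le [BorelSpace H] (G : GoodPieces μ F M j₀ N E₀ E₁ E₂)
    (hF : F.IsFine j₀ h (κ + (h + 4))) (A : AdaptedNets μ F M (κ + (h + 4)) m E₁ E c u V)
    (hκ : j₀ + 1 ≤ κ) {p : ℕ × H} (hp : p ∈ F.ballsNear (κ + (h + 4)) E₁) {l : ℕ}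
    (hl : p.1 = κ + (h + 4) + l) :
    ∑ i ∈ Finset.range (l + 1), ∑ v ∈ newPoints V i,
      {v | (F.double p ∩ closedBall v ((1 / 2) ^ (κ + (h + 4) + m + i + 1))).Nonempty}.indicator
        (fun v => μ (F.double p) / μ (closedBall v ((1 / 2) ^ (κ + (h + 4) + m + i + 1)))) v ≤
      ENNReal.ofReal (M ^ (h + m + 7) * M ^ (h + m + 7) *
        (1 + M ^ (h + m + 8) * ((h + m + 7 : ℕ) * M ^ (h + m + 7)))) := by
  classical
  obtain ⟨hk, -, x, hx, hxp⟩ := hp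
  have hdbl := G.doubling x (G.subset₁ hx)
  set q := h + m + 7 with hq
  set r : ℕ → ℝ := fun i => (1 / 2) ^ (κ + (h + 4) + m + i + 1) with hr
  set a : ℕ → ℝ := fun i => (μ (closedBall x ((1 / 2) ^ (κ + i)))).toReal with ha
  have hafin : ∀ i, μ (closedBall x ((1 / 2) ^ (κ + i))) ≠ ∞ := fun i =>
    (hdbl (κ + i) (by omega)).2.1.ne
  have hapos : ∀ i, 0 < a i := fun i =>
    ENNReal.toReal_pos (hdbl (κ + i) (by omega)).1.ne' (hafin i)
  have haof : ∀ i, ENNReal.ofReal (a i) = μ (closedBall x ((1 / 2) ^ (κ + i))) := fun i =>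
    ENNReal.ofReal_toReal (hafin i)
  have hanti : Antitone a := fun i j hij => ENNReal.toReal_mono (hafin i) (measure_mono
    (closedBall_subset_closedBall
      (pow_le_pow_of_le_one (by norm_num) (by norm_num) (by omega))))
  have hM : (1 : ℝ) ≤ M := by exact_mod_cast hdbl.one_le
  -- the new points near the ball
  set P : ℕ → Finset H := fun i => (newPoints V i).filter fun v =>
    (F.double p ∩ closedBall v (r i)).Nonempty with hP
  have hPV : ∀ i, ∀ v ∈ P i, v ∈ V i := fun i v hv =>
    newPoints_subset V i (Finset.mem_filter.1 hv).1
  have hPx : ∀ i ∈ Finset.range (l + 1), ∀ v ∈ P i, dist v x ≤ (1 / 2) ^ (κ + i + 1) := by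
    intro i hi v hv
    have := Finset.mem_range.1 hi
    exact hF.dist_le_of_near hk hxp (m := m) (by omega) (Finset.mem_filter.1 hv).2
  have hcard : ∀ i ∈ Finset.range (l + 1), (P i).card ≤ M ^ q := by
    intro i hi
    obtain ⟨j, hj⟩ := Nat.exists_eq_add_of_le (show 1 ≤ κ by omega)
    have := IsDyadicDoubling.card_le (P := P i) (x := x) (j := j + i) (i := h + m + 3)
      (fun v hv => G.doubling v (G.subset₁ (A.subset i v (hPV i v hv)))) (by omega)
      (fun v hv => by
        have := hPx i hi v hv
        rwa [show κ + i + 1 = j + i + 2 by omega] at this)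
      (fun v hv w hw hvw => by
        have := A.separated i v (hPV i v hv) w (hPV i w hw) hvw
        rwa [show κ + (h + 4) + m + i = j + i + 2 + (h + m + 3) by omega] at this)
    exact this
  have hterm : ∀ i ∈ Finset.range (l + 1), ∀ v ∈ P i,
      μ (F.double p) / μ (closedBall v (r i)) ≤ ENNReal.ofReal (M ^ q * (a l / a i)) := by
    intro i hi v hv
    have hdv := G.doubling v (G.subset₁ (A.subset i v (hPV i v hv)))
    have hvx := hPx i hi v hv
    have hi' := Finset.mem_range.1 hi
    obtain ⟨j, hj⟩ := Nat.exists_eq_add_of_le (show 1 ≤ κ by omega)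
    have e1 : (1 / 2 : ℝ) ^ (κ + i + 1) = (1 / 2) ^ (κ + i) / 2 := by rw [pow_succ]; ring
    have e2 : (1 / 2 : ℝ) ^ (j + i) = 2 * (1 / 2) ^ (κ + i) := by
      rw [show κ + i = j + i + 1 by omega, pow_succ]; ring
    have h0 : (0 : ℝ) < (1 / 2) ^ (κ + i) := by positivity
    have h1 := hdv.measure_le (A := closedBall x ((1 / 2) ^ (κ + i))) (j := j + i) (by omega)
      (by rw [e2]; exact closedBall_subset_closedBall' (by rw [dist_comm]; linarith)) q
      (t := r i) (by
        rw [hr]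
        exact pow_le_pow_of_le_one (by norm_num) (by norm_num) (by omega))
    have h2 : μ (F.double p) ≤ ENNReal.ofReal (a l) := by
      rw [haof]
      refine measure_mono ((hF.closedBall_subset hk hxp).2.1.trans
        (closedBall_subset_closedBall ?_))
      exact pow_le_pow_of_le_one (by norm_num) (by norm_num) (by omega)
    have hv0 : μ (closedBall v (r i)) ≠ 0 := (hdv.measure_pos (by positivity)).ne'
    have hvt : μ (closedBall v (r i)) ≠ ∞ := (hdv (κ + (h + 4) + m + i + 1) (by omega)).2.1.ne
    rw [ENNReal.div_le_iff hv0 hvt]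
    refine h2.trans ?_
    rw [← haof] at h1
    have h3 : a l = a l / a i * a i := by rw [div_mul_cancel₀ _ (hapos i).ne']
    have h4 : 0 ≤ a l / a i := (div_pos (hapos l) (hapos i)).le
    calc ENNReal.ofReal (a l) = ENNReal.ofReal (a l / a i) * ENNReal.ofReal (a i) := by
          rw [← ENNReal.ofReal_mul h4, ← h3]
      _ ≤ ENNReal.ofReal (a l / a i) * (M ^ q * μ (closedBall v (r i))) := by gcongr
      _ = _ := by
          rw [ENNReal.ofReal_mul (by positivity), ENNReal.ofReal_pow (by positivity),
            ENNReal.ofReal_natCast]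
          ring
  -- Only scales with a new point near the ball count, and from scale one on these force a drop.
  -- Scale zero, whose points have no predecessor, contributes at most `1`.
  set K := (Finset.range (l + 1)).filter fun i => (P i).Nonempty with hK
  have hsum1 : ∑ i ∈ K, a l / a i ≤ 1 + M ^ (q + 1) * (q * M ^ q) := by
    have h1 : ∑ i ∈ K.filter (fun i => i ≠ 0), a l / a i ≤
        M ^ (q + 1) * (q * (a l / a (l + q))) := by
      refine sum_ratio_le hapos hanti (by positivity)
        ((Finset.filter_subset _ _).trans (Finset.filter_subset _ _)) fun i hi => ?_
      simp only [hK, Finset.mem_filter] at hi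
      obtain ⟨⟨hil, v, hv⟩, hi0⟩ := hi
      obtain ⟨i, rfl⟩ := Nat.exists_eq_succ_of_ne_zero hi0
      have h2 := G.measure_drop A hκ (Finset.mem_filter.1 hv).1 (hPx _ hil v hv)
      have h3 : κ + (i + 1 + q) = κ + (i + 1) + q := by ring
      rw [← hq, show h + m + 8 = q + 1 by omega, ← h3, ← haof, ← haof,
        ← ENNReal.ofReal_sub _ (hapos _).le, ← ENNReal.ofReal_natCast M,
        ← ENNReal.ofReal_pow (by positivity), ← ENNReal.ofReal_mul (by positivity)] at h2
      refine (ENNReal.ofReal_le_ofReal_iff ?_).1 h2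
      exact mul_nonneg (by positivity) (sub_nonneg.2 (hanti (by omega)))
    have h2 : a l / a (l + q) ≤ M ^ q := by
      rw [div_le_iff₀ (hapos _)]
      have h3 := hdbl.measure_le (j := κ + l) (by omega) subset_rfl q
        (t := (1 / 2) ^ (κ + (l + q))) (le_of_eq (by congr 1; ring))
      rw [← haof, ← haof, ← ENNReal.ofReal_natCast M, ← ENNReal.ofReal_pow (by positivity),
        ← ENNReal.ofReal_mul (by positivity)] at h3
      exact (ENNReal.ofReal_le_ofReal_iff (mul_nonneg (by positivity) (hapos _).le)).1 h3
    have h3 : ∑ i ∈ K.filter (fun i => ¬ i ≠ 0), a l / a i ≤ 1 := by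
      have hsub : K.filter (fun i => ¬ i ≠ 0) ⊆ {0} := by
        intro i hi
        simpa using (Finset.mem_filter.1 hi).2
      refine (Finset.sum_le_sum_of_subset_of_nonneg hsub fun i _ _ =>
        (div_pos (hapos l) (hapos i)).le).trans ?_
      rw [Finset.sum_singleton, div_le_one (hapos 0)]
      exact hanti (Nat.zero_le _)
    rw [← Finset.sum_filter_add_sum_filter_not K (fun i => i ≠ 0), add_comm]
    refine add_le_add h3 (h1.trans ?_)
    gcongr
  calc ∑ i ∈ Finset.range (l + 1), ∑ v ∈ newPoints V i,
        {v | (F.double p ∩ closedBall v (r i)).Nonempty}.indicator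
          (fun v => μ (F.double p) / μ (closedBall v (r i))) v
      = ∑ i ∈ Finset.range (l + 1), ∑ v ∈ P i, μ (F.double p) / μ (closedBall v (r i)) := by
        refine Finset.sum_congr rfl fun i _ => ?_
        rw [hP, Finset.sum_filter]
        exact Finset.sum_congr rfl fun v _ => by simp [indicator_apply]
    _ = ∑ i ∈ K, ∑ v ∈ P i, μ (F.double p) / μ (closedBall v (r i)) := by
        rw [hK, Finset.sum_filter]
        refine Finset.sum_congr rfl fun i _ => ?_
        split_ifs with hne
        · rfl
        · rw [Finset.not_nonempty_iff_eq_empty.1 hne, Finset.sum_empty]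
    _ ≤ ∑ i ∈ K, ENNReal.ofReal (M ^ q * M ^ q * (a l / a i)) := by
        refine Finset.sum_le_sum fun i hi => ?_
        have hi' := (Finset.mem_filter.1 hi).1
        refine (Finset.sum_le_sum (hterm i hi')).trans ?_
        rw [Finset.sum_const, nsmul_eq_mul, mul_assoc, ← ENNReal.ofReal_natCast,
          ← ENNReal.ofReal_mul (by positivity)]
        refine ENNReal.ofReal_le_ofReal (mul_le_mul_of_nonneg_right ?_ ?_)
        · exact_mod_cast hcard i hi'
        · exact mul_nonneg (by positivity) (div_pos (hapos l) (hapos i)).le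
    _ = ENNReal.ofReal (M ^ q * M ^ q * ∑ i ∈ K, a l / a i) := by
        rw [Finset.mul_sum, ENNReal.ofReal_sum_of_nonneg]
        exact fun i _ => mul_nonneg (by positivity) (div_pos (hapos l) (hapos i)).le
    _ ≤ _ :=
        ENNReal.ofReal_le_ofReal (mul_le_mul_of_nonneg_left hsum1 (by positivity))

end GoodPieces

namespace GoodPieces

variable {H : Type*} [NormedAddCommGroup H] [InnerProductSpace ℝ H]
  [MeasurableSpace H] {μ : Measure H} {F : MultiresolutionFamily μ} {M j₀ h κ m : ℕ} {N : ℝ≥0∞}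
  {E₀ E₁ E₂ E : Set H} {c u : ℕ × H → H} {V : ℕ → Finset H} [BorelSpace H]

/-- Inserting `μ (F.double p)` in numerator and denominator separates the normalised line error of a
ball from the measure ratio, whose sum is controlled independently of the lines. -/
theorem tailCost_le [TopologicalSpace.SeparableSpace H] (G : GoodPieces μ F M j₀ N E₀ E₁ E₂)
    (hF : F.IsFine j₀ h (κ + (h + 4))) (A : AdaptedNets μ F M (κ + (h + 4)) m E₁ E c u V)
    (hκ : j₀ + 1 ≤ κ) {i : ℕ} {v : H} (hv : v ∈ newPoints V i) :
    tailCost F (κ + (h + 4)) E₁ c u (κ + (h + 4) + i) v ≤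
      2 * M ^ 2 * ∑' p : F.ballsNear (κ + (h + 4)) E₁,
        2 ^ p.1.1 * (∫⁻ x in F.double p, ENNReal.ofReal (lineDist (c p) (u p) x ^ 2) ∂μ) /
            μ (F.double p) *
          if κ + (h + 4) + i ≤ p.1.1 then
            {v | (F.double p ∩ closedBall v ((1 / 2) ^ (κ + (h + 4) + m + i + 1))).Nonempty}.indicator
              (fun v => μ (F.double p) / μ (closedBall v ((1 / 2) ^ (κ + (h + 4) + m + i + 1)))) v
          else 0 := by
  obtain ⟨f, hf, -⟩ := hF.exists_injective E₁
  have : Countable (F.balls 1) := (F.countable_balls 1).to_subtype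
  have : Countable (F.ballsNear (κ + (h + 4)) E₁) := hf.countable
  have hdv := G.doubling v (G.subset₁ (A.subset i v (newPoints_subset V i hv)))
  set B := closedBall v ((1 / 2) ^ (κ + (h + 4) + m + i + 1)) with hB
  have hv0 : μ B ≠ 0 := (hdv.measure_pos (by positivity)).ne'
  have hvt : μ B ≠ ∞ := (hdv (κ + (h + 4) + m + i + 1) (by omega)).2.1.ne
  have h1 := (A.cost i v hv).trans (mul_le_mul_right (setLIntegral_tailCost_le c u _ B) _)
  rw [← ENNReal.le_div_iff_mul_le (.inl hv0) (.inl hvt)] at h1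
  refine h1.trans ?_
  rw [mul_div_assoc, ENNReal.div_eq_inv_mul, ← ENNReal.tsum_mul_left]
  refine mul_le_mul_right (ENNReal.tsum_le_tsum fun p => ?_) _
  have hp := G.double_pos hF p.2
  by_cases hk : κ + (h + 4) + i ≤ p.1.1
  swap
  · simp [hk]
  by_cases hn : (F.double p ∩ B).Nonempty
  swap
  · simp [hn]
  rw [indicator_of_mem (show p.1 ∈ {p : ℕ × H | κ + (h + 4) + i ≤ p.1 ∧
    (F.double p ∩ B).Nonempty} from ⟨hk, hn⟩), if_pos hk, indicator_of_mem (by exact hn)]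
  rw [← mul_div_assoc, ENNReal.div_mul_cancel hp.1.ne' hp.2.ne, ENNReal.div_eq_inv_mul]

/-- The total cost of the new points is finite. -/
theorem tsum_tailCost_ne_top [TopologicalSpace.SeparableSpace H]
    (G : GoodPieces μ F M j₀ N E₀ E₁ E₂)
    (hF : F.IsFine j₀ h (κ + (h + 4))) (A : AdaptedNets μ F M (κ + (h + 4)) m E₁ E c u V)
    (hκ : j₀ + 1 ≤ κ)
    (hcu : ∑' p : F.ballsNear (κ + (h + 4)) E₁, 2 ^ p.1.1 * (∫⁻ x in F.double p,
        ENNReal.ofReal (lineDist (c p) (u p) x ^ 2) ∂μ) / μ (F.double p) ≠ ∞) :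
    ∑' i, ∑ v ∈ newPoints V i, tailCost F (κ + (h + 4)) E₁ c u (κ + (h + 4) + i) v ≠ ∞ := by
  set w : F.ballsNear (κ + (h + 4)) E₁ → ℝ≥0∞ := fun p => 2 ^ p.1.1 * (∫⁻ x in F.double p,
        ENNReal.ofReal (lineDist (c p) (u p) x ^ 2) ∂μ) / μ (F.double p) with hw
  set s : ℕ → F.ballsNear (κ + (h + 4)) E₁ → H → ℝ≥0∞ := fun i p =>
    {v | (F.double p ∩ closedBall v ((1 / 2) ^ (κ + (h + 4) + m + i + 1))).Nonempty}.indicator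
      (fun v => μ (F.double p) / μ (closedBall v ((1 / 2) ^ (κ + (h + 4) + m + i + 1)))) with hs
  set C : ℝ≥0∞ := ENNReal.ofReal (M ^ (h + m + 7) * M ^ (h + m + 7) *
        (1 + M ^ (h + m + 8) * ((h + m + 7 : ℕ) * M ^ (h + m + 7)))) with hC
  have hC2 : (2 * M ^ 2 : ℝ≥0∞) ≠ ∞ :=
    ENNReal.mul_ne_top (by simp) (ENNReal.pow_ne_top (ENNReal.natCast_ne_top M))
  refine ne_top_of_le_ne_top
    (ENNReal.mul_ne_top hC2 (ENNReal.mul_ne_top hcu (show C ≠ ∞ from ENNReal.ofReal_ne_top))) ?_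
  calc ∑' i, ∑ v ∈ newPoints V i, tailCost F (κ + (h + 4)) E₁ c u (κ + (h + 4) + i) v
      ≤ ∑' i, ∑ v ∈ newPoints V i, 2 * M ^ 2 * ∑' p : F.ballsNear (κ + (h + 4)) E₁,
          w p * if κ + (h + 4) + i ≤ p.1.1 then s i p v else 0 :=
        ENNReal.tsum_le_tsum fun i => Finset.sum_le_sum fun v hv => G.tailCost_le hF A hκ hv
    _ = 2 * M ^ 2 * ∑' p : F.ballsNear (κ + (h + 4)) E₁, w p *
          ∑' i, if κ + (h + 4) + i ≤ p.1.1 then ∑ v ∈ newPoints V i, s i p v else 0 := by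
        simp_rw [← Finset.mul_sum, ENNReal.tsum_mul_left]
        congr 1
        simp_rw [← ENNReal.tsum_mul_left (a := w _)]
        rw [ENNReal.tsum_comm]
        refine tsum_congr fun i => ?_
        rw [← Summable.tsum_finsetSum fun _ _ => ENNReal.summable]
        refine tsum_congr fun p => ?_
        rw [← Finset.mul_sum]
        split_ifs <;> simp
    _ ≤ 2 * M ^ 2 * ∑' p : F.ballsNear (κ + (h + 4)) E₁, w p * C := by
        gcongr with p
        -- A ball of generation `l` above the first enters only the tails of the scales `i ≤ l`.
        obtain ⟨l, hl⟩ := Nat.exists_eq_add_of_le p.2.1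
        rw [tsum_eq_sum (s := Finset.range (l + 1)) fun i hi => by
          rw [Finset.mem_range] at hi
          rw [if_neg (by omega)]]
        refine le_trans (Finset.sum_le_sum fun i _ => ?_)
          (G.sum_measure_ratio_le hF A hκ p.2 hl)
        split_ifs
        exacts [le_rfl, zero_le]
    _ = _ := by rw [ENNReal.tsum_mul_right]

end GoodPieces

/-! ### From the costs of the new points to coordinates with summable errors -/

theorem sum_le_sum_newPoints {X : Type*} (V : ℕ → Finset X) (f : X → ℝ≥0∞) (n : ℕ) :
    ∑ x ∈ V n, f x ≤ ∑ j ∈ Finset.range (n + 1), ∑ x ∈ newPoints V j, f x := by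
  classical
  induction n with
  | zero => simp [newPoints]
  | succ n ih =>
    rw [Finset.sum_range_succ]
    have h1 : V (n + 1) ⊆ V n ∪ newPoints V (n + 1) := by
      intro x hx
      by_cases h : x ∈ V n
      · exact Finset.mem_union_left _ h
      · exact Finset.mem_union_right _ (by simpa [newPoints] using ⟨hx, h⟩)
    refine (Finset.sum_le_sum_of_subset h1).trans ?_
    exact le_self_add.trans ((Finset.sum_union_inter).le.trans (add_le_add ih le_rfl))

namespace AdaptedNets

variable {H : Type*} [NormedAddCommGroup H] [InnerProductSpace ℝ H]
  [MeasurableSpace H] {μ : Measure H} {F : MultiresolutionFamily μ} {M k₁ m : ℕ}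
  {E₁ E : Set H} {c u : ℕ × H → H} {V : ℕ → Finset H}

/-- The cost of the points of all nets, each with the balls of its own scale, is bounded by the
cost of the new points with all smaller balls. -/
theorem tsum_cost_le :
    ∑' i, ∑ x ∈ V (i + 1), ∑' p : F.ballsNear k₁ E₁,
        (if p.1.1 = k₁ + (i + 1) then lineCost F c u p x else 0) ≤
      ∑' i, ∑ v ∈ newPoints V i, tailCost F k₁ E₁ c u (k₁ + i) v := by
  set T : ℕ → H → ℝ≥0∞ := fun i x => ∑' p : F.ballsNear k₁ E₁,
    (if p.1.1 = k₁ + (i + 1) then lineCost F c u p x else 0) with hT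
  calc ∑' i, ∑ x ∈ V (i + 1), T i x
      ≤ ∑' i, ∑' j, if j ≤ i + 1 then ∑ x ∈ newPoints V j, T i x else 0 := by
        refine ENNReal.tsum_le_tsum fun i => ?_
        rw [tsum_eq_sum (s := Finset.range (i + 1 + 1)) fun j hj => by
          rw [Finset.mem_range] at hj
          rw [if_neg (by omega)]]
        refine (sum_le_sum_newPoints V (T i) (i + 1)).trans (le_of_eq ?_)
        refine Finset.sum_congr rfl fun j hj => ?_
        rw [Finset.mem_range] at hj
        rw [if_pos (by omega)]
    _ = ∑' j, ∑ x ∈ newPoints V j, ∑' i, if j ≤ i + 1 then T i x else 0 := by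
        rw [ENNReal.tsum_comm]
        refine tsum_congr fun j => ?_
        rw [← Summable.tsum_finsetSum fun _ _ => ENNReal.summable]
        refine tsum_congr fun i => ?_
        split_ifs <;> simp
    _ ≤ _ := by
        refine ENNReal.tsum_le_tsum fun j => Finset.sum_le_sum fun x _ => ?_
        have h1 : ∀ i, (if j ≤ i + 1 then T i x else 0) = ∑' p : F.ballsNear k₁ E₁,
            if j ≤ i + 1 ∧ p.1.1 = k₁ + (i + 1) then lineCost F c u p x else 0 := by
          intro i
          by_cases hj : j ≤ i + 1 <;> simp [hj, hT]
        simp_rw [h1]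
        rw [ENNReal.tsum_comm]
        unfold tailCost
        refine ENNReal.tsum_le_tsum fun p => ?_
        by_cases hp : k₁ + j ≤ p.1.1
        · rw [if_pos hp]
          -- A ball is used by the net of one index only. In generation `k₁` the truncated
          -- subtraction gives `0`, where the term vanishes too.
          rw [tsum_eq_single (p.1.1 - k₁ - 1) fun i hi => if_neg (by omega)]
          split_ifs
          exacts [le_rfl, zero_le]
        · rw [if_neg hp, nonpos_iff_eq_zero, ENNReal.tsum_eq_zero]
          exact fun i => if_neg (by omega)

end AdaptedNets

namespace GoodPieces

variable {H : Type*} [NormedAddCommGroup H] [InnerProductSpace ℝ H]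
  [MeasurableSpace H] {μ : Measure H} {F : MultiresolutionFamily μ} {M j₀ h k₁ m : ℕ} {N : ℝ≥0∞}
  {E₀ E₁ E₂ E : Set H} {c u : ℕ × H → H} {V : ℕ → Finset H}

theorem exists_ballsNear (G : GoodPieces μ F M j₀ N E₀ E₁ E₂) (hF : F.IsFine j₀ h k₁) {k : ℕ}
    (hk : k₁ ≤ k) {a : H} (ha : a ∈ E₁) :
    ∃ y, (k, y) ∈ F.ballsNear k₁ E₁ ∧ dist a y ≤ (1 / 2) ^ k := by
  have h1 : F.k₀ ≤ k := hF.k₀_le.trans (Int.ofNat_le.2 hk)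
  obtain ⟨y, hy, hd⟩ := (F.isMaximalNet k h1).covers a (G.subset_X (G.subset₁ ha))
  rw [zpow_neg, zpow_natCast, ← inv_pow, ← one_div] at hd
  exact ⟨y, ⟨hk, hy, a, ha, hd⟩, hd⟩

variable [BorelSpace H]

/-- Consecutive nets have almost isometric coordinates, with summable errors. -/
theorem exists_netStep [TopologicalSpace.SeparableSpace H] (G : GoodPieces μ F M j₀ N E₀ E₁ E₂)
    (hF : F.IsFine j₀ h k₁) (hk₁ : j₀ + 4 ≤ k₁) {s : ℕ} (hs : 16 * M ^ 6 ≤ 2 ^ s)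
    (A : AdaptedNets μ F M k₁ (s + 1) E₁ E c u V) (hu : ∀ p ∈ F.ballsNear k₁ E₁, ‖u p‖ = 1)
    (hM : 1 ≤ M)
    (hsum : ∑' i, ∑ v ∈ newPoints V i, tailCost F k₁ E₁ c u (k₁ + i) v ≠ ∞) :
    ∃ (ε : ℕ → H → ℝ) (C : ℝ),
      (∀ i, NetStep (V i) (V (i + 1)) ((1 / 2) ^ (k₁ + (s + 1) + i)) (M ^ 6) (M ^ (s + 4)) (ε i)) ∧
      ∀ n, ∑ i ∈ Finset.range n, (1 / 2 : ℝ) ^ (k₁ + (s + 1) + i) * ∑ a ∈ V i, ε i a ≤ C := by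
  classical
  have hdbl : ∀ i, ∀ v ∈ V i, IsDyadicDoubling μ M j₀ v := fun i v hv =>
    G.doubling v (G.subset₁ (A.subset i v hv))
  set r : ℕ → ℝ := fun i => (1 / 2) ^ (k₁ + (s + 1) + i) with hr
  have hr0 : ∀ i, 0 < r i := fun i => by positivity
  have hr1 : ∀ i, r (i + 1) = r i / 2 := fun i => by
    rw [hr]; simp only; rw [← add_assoc, pow_succ]; ring
  -- The nets are finer than the balls by `s` more generations, so that the window of a net step
  -- fits into the double of a ball of generation `k₁ + (i + 1)`.
  have hwin : ∀ i, 16 * ((M ^ 6 : ℕ) : ℝ) * r i ≤ (1 / 2) ^ (k₁ + (i + 1)) := by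
    intro i
    have h1 : (1 / 2 : ℝ) ^ (k₁ + (i + 1)) = 2 ^ s * r i := by
      rw [hr]; simp only
      rw [show k₁ + (s + 1) + i = k₁ + (i + 1) + s by ring, pow_add _ _ s, mul_comm, mul_assoc,
        ← mul_pow]
      norm_num
    rw [h1]
    gcongr
    exact_mod_cast hs
  -- the ball attached to a point of a net
  have hball : ∀ i a, ∃ y, a ∈ V i →
      (k₁ + (i + 1), y) ∈ F.ballsNear k₁ E₁ ∧ dist a y ≤ (1 / 2) ^ (k₁ + (i + 1)) := by
    intro i a
    by_cases ha : a ∈ V i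
    · obtain ⟨y, hy⟩ := G.exists_ballsNear hF (k := k₁ + (i + 1)) (by omega) (A.subset i a ha)
      exact ⟨y, fun _ => hy⟩
    · exact ⟨a, fun h => absurd h ha⟩
  choose y hy using hball
  set b : ℕ → H → ℕ × H := fun i a => (k₁ + (i + 1), y i a) with hb
  set D : ℕ → H → Finset H := fun i a => (V (i + 1)).filter fun x => x ∈ F.double (b i a) with hD
  set d : ℕ → H → H → ℝ := fun i a x => lineDist (c (b i a)) (u (b i a)) x ^ 2 with hd
  have hd0 : ∀ i a x, 0 ≤ d i a x := fun i a x => sq_nonneg _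
  -- Two points of the finer net have coordinate error at most twice their squared line distances
  -- divided by `r i / 2`, which is `ε i a * r i` for this choice.
  set ε : ℕ → H → ℝ := fun i a => 4 / r i ^ 2 * ∑ x ∈ D i a, d i a x with hε
  have hε0 : ∀ i a, 0 ≤ ε i a := fun i a =>
    mul_nonneg (by have := hr0 i; positivity) (Finset.sum_nonneg fun x _ => hd0 i a x)
  have hpack : ∀ i, ∀ P ⊆ V i, ∀ z : H, (∀ p ∈ P, dist p z ≤ (1 / 2) ^ (k₁ + (i + 1))) →
      P.card ≤ M ^ (s + 4) := by
    intro i P hP z hz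
    obtain ⟨j, hj⟩ := Nat.exists_eq_add_of_le (show 2 ≤ k₁ + (i + 1) by omega)
    exact IsDyadicDoubling.card_le (x := z) (j := j) (i := s)
      (fun p hp => hdbl i p (hP hp)) (by omega)
      (fun p hp => by have := hz p hp; rwa [hj, add_comm 2] at this)
      (fun p hp q hq hpq => by
        have := A.separated i p (hP hp) q (hP hq) hpq
        rwa [show k₁ + (s + 1) + i = j + 2 + s by omega] at this)
  set S : ℝ≥0∞ := ∑' i, ∑ v ∈ newPoints V i, tailCost F k₁ E₁ c u (k₁ + i) v with hS
  set C : ℝ≥0∞ := 2 ^ (s + 2) * (M ^ (s + 4) * S) with hC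
  have hCt : C ≠ ∞ := ENNReal.mul_ne_top (ENNReal.pow_ne_top (by simp))
    (ENNReal.mul_ne_top (ENNReal.pow_ne_top (ENNReal.natCast_ne_top M)) hsum)
  refine ⟨ε, C.toReal, fun i => ?_, fun n => ?_⟩
  · refine ⟨hr0 i, Nat.one_le_pow _ _ hM, A.mono i, A.separated i, ?_, A.near i, ?_, ?_,
      fun a _ => hε0 i a, ?_⟩
    · intro x hx z hz hxz
      have := A.separated (i + 1) x hx z hz hxz
      exact (hr1 i).symm.le.trans this
    · intro a ha P hP hPa
      -- Radius `2 * r i` and separation `r i / 2` are two halvings apart, hence the exponent `2 +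
      -- 4`.
      obtain ⟨j, hj⟩ := Nat.exists_eq_add_of_le (show 3 ≤ k₁ + (s + 1) + i by omega)
      refine IsDyadicDoubling.card_le (x := a) (j := j) (i := 2)
        (fun p hp => hdbl _ p (hP hp)) (by omega) (fun p hp => ?_) (fun p hp q hq hpq => ?_)
      · have := hPa p hp
        rw [hj, show 3 + j = j + 2 + 1 by ring, pow_succ] at this
        linarith
      · have := A.separated (i + 1) p (hP hp) q (hP hq) hpq
        rwa [← add_assoc, hj, show 3 + j + 1 = j + 2 + 2 by ring] at this
    · intro a ha P hP hPa
      exact hpack i P hP a fun p hp => (hPa p hp).trans (hwin i)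
    · intro a ha
      have hb' := hy i a ha
      have hunit := hu _ hb'.1
      refine ⟨fun x => inner ℝ (u (b i a)) x, fun x z => abs_inner_sub_inner_le hunit x z, ?_⟩
      rintro x ⟨hx, hxa⟩ z ⟨hz, hza⟩ hxz
      have hmem : ∀ x ∈ V (i + 1), dist x a ≤ 16 * ((M ^ 6 : ℕ) : ℝ) * r i → x ∈ D i a := by
        intro x hx hxa
        refine Finset.mem_filter.2 ⟨hx, mem_closedBall.2 ?_⟩
        have h1 := hxa.trans (hwin i)
        have h2 := hb'.2
        have h3 := dist_triangle x a (y i a)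
        have h4 : (0 : ℝ) < (1 / 2) ^ (k₁ + (i + 1)) := by positivity
        have h5 := F.one_lt_lam
        have h6 : dist x (y i a) ≤ 2 * (1 * (1 / 2) ^ (k₁ + (i + 1))) := by linarith
        refine h6.trans ?_
        gcongr
      have hsep := A.separated (i + 1) x hx z hz hxz
      have hpos := hr0 (i + 1)
      refine (dist_le_abs_inner_sub_add hunit (c := c (b i a)) hpos hsep).trans ?_
      gcongr
      have h1 : d i a x + d i a z ≤ ∑ x ∈ D i a, d i a x := by
        rw [← Finset.sum_pair hxz]
        refine Finset.sum_le_sum_of_subset_of_nonneg ?_ fun x _ _ => hd0 i a x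
        intro v hv
        rcases Finset.mem_insert.1 hv with rfl | hv
        · exact hmem _ hx hxa
        · rw [Finset.mem_singleton.1 hv]; exact hmem _ hz hza
      have h2 := hr0 i
      have h3 : ε i a * r i = 2 * (∑ x ∈ D i a, d i a x) / r (i + 1) := by
        rw [hε, hr1]; field_simp; ring
      rw [show (1 / 2 : ℝ) ^ (k₁ + (s + 1) + i) = r i from rfl, h3]
      gcongr
  · refine (ENNReal.ofReal_le_iff_le_toReal hCt).1 ?_
    have hcost : ∀ i a, ENNReal.ofReal (r i * ε i a) =
        2 ^ (s + 2) * ∑ x ∈ V (i + 1), lineCost F c u (b i a) x := by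
      intro i a
      have h1 : r i * ε i a = ∑ x ∈ D i a, 4 / r i * d i a x := by
        rw [hε]
        show r i * (4 / r i ^ 2 * ∑ x ∈ D i a, d i a x) = _
        rw [Finset.mul_sum, Finset.mul_sum]
        refine Finset.sum_congr rfl fun x _ => ?_
        have := hr0 i
        field_simp
      have h2 : 4 / r i = 2 ^ (s + 2) * 2 ^ (k₁ + (i + 1)) := by
        rw [hr]; simp only
        rw [one_div, inv_pow, div_inv_eq_mul, ← pow_add,
          show s + 2 + (k₁ + (i + 1)) = 2 + (k₁ + (s + 1) + i) by ring,
          pow_add 2 2 (k₁ + (s + 1) + i)]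
        norm_num
      rw [h1, ENNReal.ofReal_sum_of_nonneg fun x _ =>
        mul_nonneg (by have := hr0 i; positivity) (hd0 i a x), hD, Finset.sum_filter,
        Finset.mul_sum]
      refine Finset.sum_congr rfl fun x _ => ?_
      unfold lineCost
      rw [indicator_apply, h2]
      split_ifs
      · rw [ENNReal.ofReal_mul (by positivity), ENNReal.ofReal_mul (by positivity),
          ENNReal.ofReal_pow (by norm_num), ENNReal.ofReal_pow (by norm_num),
          ENNReal.ofReal_ofNat, mul_assoc]
      · rw [mul_zero]
    -- Net points sharing a ball are close to its centre, so by packing at most `M ^ (s + 4)` of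
    -- them share it.
    have hmult : ∀ i, ∑ a ∈ V i, ∑ x ∈ V (i + 1), lineCost F c u (b i a) x ≤
        M ^ (s + 4) * ∑ x ∈ V (i + 1), ∑' p : F.ballsNear k₁ E₁,
          (if p.1.1 = k₁ + (i + 1) then lineCost F c u p x else 0) := by
      intro i
      rw [Finset.sum_comm, Finset.mul_sum]
      refine Finset.sum_le_sum fun x _ => ?_
      rw [← Finset.sum_fiberwise_of_maps_to
        (fun a ha => Finset.mem_image_of_mem (b i) ha)]
      have h1 : ∀ p ∈ (V i).image (b i), ∑ a ∈ V i with b i a = p, lineCost F c u (b i a) x ≤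
          M ^ (s + 4) * lineCost F c u p x := by
        intro p hp
        rw [Finset.sum_congr rfl (g := fun _ => lineCost F c u p x) (by
          intro a ha; rw [(Finset.mem_filter.1 ha).2]), Finset.sum_const, nsmul_eq_mul]
        gcongr
        have := hpack i ((V i).filter fun a => b i a = p) (Finset.filter_subset _ _) p.2
          (fun a ha => by
            have ha := Finset.mem_filter.1 ha
            rw [← ha.2]
            exact (hy i a ha.1).2)
        exact_mod_cast this
      refine (Finset.sum_le_sum h1).trans ?_
      rw [← Finset.mul_sum]
      gcongr
      rw [tsum_subtype (F.ballsNear k₁ E₁)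
        (fun p => if p.1 = k₁ + (i + 1) then lineCost F c u p x else 0)]
      refine le_trans (le_of_eq ?_) (ENNReal.sum_le_tsum ((V i).image (b i)))
      refine Finset.sum_congr rfl fun p hp => ?_
      obtain ⟨a, ha, rfl⟩ := Finset.mem_image.1 hp
      rw [indicator_of_mem (hy i a ha).1, if_pos rfl]
    rw [ENNReal.ofReal_sum_of_nonneg fun i _ =>
      mul_nonneg (hr0 i).le (Finset.sum_nonneg fun a _ => hε0 i a)]
    calc ∑ i ∈ Finset.range n, ENNReal.ofReal (r i * ∑ a ∈ V i, ε i a)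
        = ∑ i ∈ Finset.range n, 2 ^ (s + 2) *
            ∑ a ∈ V i, ∑ x ∈ V (i + 1), lineCost F c u (b i a) x := by
          refine Finset.sum_congr rfl fun i _ => ?_
          rw [Finset.mul_sum, ENNReal.ofReal_sum_of_nonneg fun a _ =>
            mul_nonneg (hr0 i).le (hε0 i a), Finset.mul_sum]
          exact Finset.sum_congr rfl fun a _ => hcost i a
      _ ≤ ∑ i ∈ Finset.range n, 2 ^ (s + 2) * (M ^ (s + 4) * ∑ x ∈ V (i + 1),
            ∑' p : F.ballsNear k₁ E₁,
              (if p.1.1 = k₁ + (i + 1) then lineCost F c u p x else 0)) :=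
          Finset.sum_le_sum fun i _ => mul_le_mul_right (hmult i) _
      _ ≤ 2 ^ (s + 2) * (M ^ (s + 4) * ∑' i, ∑ x ∈ V (i + 1), ∑' p : F.ballsNear k₁ E₁,
              (if p.1.1 = k₁ + (i + 1) then lineCost F c u p x else 0)) := by
          rw [← Finset.mul_sum, ← Finset.mul_sum]
          exact mul_le_mul_right (mul_le_mul_right (ENNReal.sum_le_tsum _) _) _
      _ ≤ C := mul_le_mul_right (mul_le_mul_right AdaptedNets.tsum_cost_le _) _

/-- Small pieces of `E₂` are contained in rectifiable curves. -/
theorem exists_isRectifiableCurve [TopologicalSpace.SeparableSpace H] [CompleteSpace H]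
    [Nontrivial H] (G : GoodPieces μ F M j₀ N E₀ E₁ E₂) :
    ∃ δ > 0, ∀ z, ∃ Γ, IsRectifiableCurve Γ ∧ E₂ ∩ closedBall z δ ⊆ Γ := by
  have hlam := F.one_lt_lam
  obtain ⟨h₁, hh₁⟩ := pow_unbounded_of_one_lt F.lam (one_lt_two (α := ℝ))
  obtain ⟨h₂, hh₂⟩ := exists_pow_lt_of_lt_one (sub_pos.2 hlam) (show (1 / 2 : ℝ) < 1 by norm_num)
  obtain ⟨s, hs⟩ := pow_unbounded_of_one_lt (16 * M ^ 6) (one_lt_two (α := ℕ))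
  obtain ⟨k₂, hk₂⟩ := exists_pow_lt_of_lt_one (inv_pos.2 F.lam_pos)
    (show (1 / 2 : ℝ) < 1 by norm_num)
  set h := h₁ + h₂ with hh
  -- Beyond the doubling scale and the first generation, with radii at most one; for negative `F.k₀`
  -- the last summand is zero.
  set κ := j₀ + 1 + k₂ + F.k₀.toNat with hκ
  have hF : F.IsFine j₀ h (κ + (h + 4)) := by
    refine ⟨?_, ?_, ?_, ?_, by omega⟩
    · exact hh₁.le.trans (pow_le_pow_right₀ one_le_two (by omega))
    · exact le_trans (pow_le_pow_of_le_one (by norm_num) (by norm_num) (by omega)) hh₂.le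
    · have := Int.self_le_toNat F.k₀
      push_cast
      omega
    · have h1 : (1 / 2 : ℝ) ^ (κ + (h + 4)) ≤ F.lam⁻¹ :=
        le_trans (pow_le_pow_of_le_one (by norm_num) (by norm_num) (by omega)) hk₂.le
      calc F.lam * (1 / 2) ^ (κ + (h + 4)) ≤ F.lam * F.lam⁻¹ :=
            mul_le_mul_of_nonneg_left h1 F.lam_pos.le
        _ = 1 := mul_inv_cancel₀ F.lam_pos.ne'
  refine ⟨(1 / 2) ^ (κ + (h + 4) + (s + 1) + 1), by positivity, fun z => ?_⟩
  rcases (E₂ ∩ closedBall z ((1 / 2) ^ (κ + (h + 4) + (s + 1) + 1))).eq_empty_or_nonempty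
    with he | hne
  · rw [he]
    exact ⟨_, isRectifiableCurve_image le_rfl ((LipschitzWith.const' (0 : H)).lipschitzOnWith),
      empty_subset _⟩
  obtain ⟨c, u, hu, hcu⟩ := G.exists_lines hF
  obtain ⟨V, A⟩ := G.exists_adaptedNets hF (s + 1) c u z hne
  have hM : 1 ≤ M := by
    obtain ⟨x, hx, -⟩ := hne
    exact (G.doubling x (G.subset₁ (G.subset₂ hx))).one_le
  obtain ⟨ε, C, hnet, hC⟩ := G.exists_netStep hF (by omega) hs.le A hu hM
    (G.tsum_tailCost_ne_top hF A (by omega) hcu)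
  refine exists_isRectifiableCurve_of_netStep (fun i => ?_) hnet hC fun y hy i => A.covers i y hy
  rw [← add_assoc, pow_succ]
  ring

end GoodPieces

/-! ### Measurability, exhaustion by good pieces and the conclusion -/

theorem measurable_measure_closedBall {X : Type*} [MetricSpace X] [SecondCountableTopology X]
    [MeasurableSpace X] [BorelSpace X] (μ : Measure X) [SFinite μ] (r : ℝ) :
    Measurable fun x => μ (closedBall x r) := by
  have h : MeasurableSet {p : X × X | dist p.2 p.1 ≤ r} :=
    (isClosed_le (continuous_snd.dist continuous_fst) continuous_const).measurableSet
  exact measurable_measure_prodMk_left h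

theorem measurableSet_isDyadicDoubling {X : Type*} [MetricSpace X] [SecondCountableTopology X]
    [MeasurableSpace X] [BorelSpace X] (μ : Measure X) [SFinite μ] (M j₀ : ℕ) :
    MeasurableSet {x | IsDyadicDoubling μ M j₀ x} := by
  have h := measurable_measure_closedBall μ
  simp only [IsDyadicDoubling, ofPred_forall]
  refine MeasurableSet.iInter fun j => MeasurableSet.iInter fun _ => ?_
  exact (measurableSet_lt measurable_const (h _)).inter
    ((measurableSet_lt (h _) measurable_const).inter
      (measurableSet_le (h _) ((h _).const_mul _)))

theorem measurable_jonesFunction {H : Type*} [NormedAddCommGroup H] [InnerProductSpace ℝ H]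
    [TopologicalSpace.SeparableSpace H] [MeasurableSpace H] [BorelSpace H] {μ : Measure H}
    (F : MultiresolutionFamily μ) (r : ℝ) : Measurable (jonesFunction μ F r) := by
  have := (F.countable_balls r).to_subtype
  unfold jonesFunction
  exact Measurable.tsum fun p =>
    measurable_const.indicator isClosed_closedBall.measurableSet

/-- The points of `E` at which `E` fills half of all dyadic balls from the scale `2^{-j₁}` on. -/
def densityPoints {X : Type*} [MetricSpace X] [MeasurableSpace X] (μ : Measure X) (E : Set X)
    (j₁ : ℕ) : Set X :=
  E ∩ {x | ∀ j, j₁ ≤ j →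
    μ (closedBall x ((1 / 2) ^ j)) ≤ 2 * μ (E ∩ closedBall x ((1 / 2) ^ j))}

theorem measurableSet_densityPoints {X : Type*} [MetricSpace X] [SecondCountableTopology X]
    [MeasurableSpace X] [BorelSpace X] (μ : Measure X) [SFinite μ] {E : Set X}
    (hE : MeasurableSet E) (j₁ : ℕ) : MeasurableSet (densityPoints μ E j₁) := by
  refine hE.inter ?_
  simp only [ofPred_forall]
  refine MeasurableSet.iInter fun j => MeasurableSet.iInter fun _ => ?_
  refine measurableSet_le (measurable_measure_closedBall μ _) (Measurable.const_mul ?_ _)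
  have h := measurable_measure_closedBall (μ.restrict E) ((1 / 2) ^ j)
  simp only [Measure.restrict_apply isClosed_closedBall.measurableSet] at h
  simpa only [inter_comm E] using h

theorem measure_sdiff_iUnion_densityPoints {X : Type*} [MetricSpace X]
    [SecondCountableTopology X] [MeasurableSpace X] [BorelSpace X] {μ : Measure X}
    [IsLocallyFiniteMeasure μ] [μ.OuterRegular] {M j₀ : ℕ} {E : Set X} (hE : MeasurableSet E)
    (hμE : μ E ≠ ∞) (hdbl : ∀ x ∈ E, IsDyadicDoubling μ M j₀ x) :
    μ (E \ ⋃ j₁, densityPoints μ E j₁) = 0 := by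
  refine measure_mono_null ?_ (measure_not_density hE hμE hdbl)
  rintro x ⟨hx, hn⟩
  refine ⟨hx, ?_⟩
  by_contra h
  simp only [not_frequently, not_lt, eventually_atTop] at h
  obtain ⟨j₁, h⟩ := h
  exact hn (mem_iUnion.2 ⟨j₁, hx, h⟩)

/-- Outer regularity at a singleton, which is compact and so of finite measure. -/
theorem isLocallyFiniteMeasure_of_regular {X : Type*} [TopologicalSpace X] [MeasurableSpace X]
    (μ : Measure X) [μ.Regular] : IsLocallyFiniteMeasure μ := by
  refine ⟨fun x => ?_⟩
  obtain ⟨U, hxU, hU, hlt⟩ := ({x} : Set X).exists_isOpen_lt_of_lt (μ := μ) ∞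
    isCompact_singleton.measure_lt_top
  exact ⟨U, hU.mem_nhds (hxU rfl), hlt⟩

/-- Positive and eventually finite ball measures make the quotient genuine, so a finite upper limit
gives doubling at all small dyadic radii. -/
theorem IsDoublingAt.exists_isDyadicDoubling {X : Type*} [MetricSpace X] [MeasurableSpace X]
    {μ : Measure X} [IsLocallyFiniteMeasure μ] {x : X} (h : IsDoublingAt μ x)
    (hx : ∀ r > 0, 0 < μ (closedBall x r)) : ∃ M j₀, IsDyadicDoubling μ M j₀ x := by
  obtain ⟨C, hC, hCt⟩ := ENNReal.lt_iff_exists_nnreal_btwn.1 h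
  obtain ⟨M, hM⟩ := exists_nat_ge C
  obtain ⟨U, hU, hUt⟩ := μ.finiteAt_nhds x
  have h1 := eventually_lt_of_limsup_lt hC
  have h2 : ∀ᶠ r : ℝ in 𝓝[>] 0, closedBall x r ⊆ U := by
    obtain ⟨η, hη, hηU⟩ := Metric.mem_nhds_iff.1 hU
    filter_upwards [nhdsWithin_le_nhds (gt_mem_nhds hη)] with r hr
    exact (closedBall_subset_ball hr).trans hηU
  have h3 : Tendsto (fun j : ℕ => (1 / 2 : ℝ) ^ j) atTop (𝓝[>] 0) :=
    tendsto_nhdsWithin_iff.2 ⟨tendsto_pow_atTop_nhds_zero_of_lt_one (by norm_num) (by norm_num),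
      Eventually.of_forall fun j => by simp⟩
  obtain ⟨j₀, hj₀⟩ := eventually_atTop.1 (h3.eventually (h1.and h2))
  refine ⟨M, j₀, fun j hj => ?_⟩
  obtain ⟨h4, h5⟩ := hj₀ j hj
  have h6 := hx ((1 / 2) ^ j) (by positivity)
  have h7 : μ (closedBall x ((1 / 2) ^ j)) < ∞ := (measure_mono h5).trans_lt hUt
  refine ⟨h6, h7, ?_⟩
  refine ((ENNReal.div_le_iff h6.ne' h7.ne).1 h4.le).trans ?_
  gcongr
  exact_mod_cast hM

/-- Each such point has a null neighbourhood, and the space is second countable. -/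
theorem measure_setOf_measure_closedBall_eq_zero {X : Type*} [MetricSpace X]
    [SecondCountableTopology X] [MeasurableSpace X] (μ : Measure X) :
    μ {x | ∃ r > 0, μ (closedBall x r) = 0} = 0 := by
  refine measure_null_of_locally_null _ fun x ⟨r, hr, h⟩ => ?_
  exact ⟨closedBall x r, mem_nhdsWithin_of_mem_nhds (closedBall_mem_nhds x hr), h⟩

/-- `A` is covered, up to a null set, by countably many rectifiable curves. -/
def IsCurveCovered {H : Type*} [MetricSpace H] [MeasurableSpace H] [BorelSpace H]
    (μ : Measure H) (A : Set H) : Prop :=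
  ∃ S : Set (Set H), S.Countable ∧ S ⊆ {Γ | IsRectifiableCurve Γ} ∧ μ (A \ ⋃₀ S) = 0

namespace IsCurveCovered

variable {H : Type*} [MetricSpace H] [MeasurableSpace H] [BorelSpace H] {μ : Measure H}

theorem iUnion {ι : Type*} [Countable ι] {A : ι → Set H} (h : ∀ i, IsCurveCovered μ (A i)) :
    IsCurveCovered μ (⋃ i, A i) := by
  choose S hc hS h0 using h
  refine ⟨⋃ i, S i, countable_iUnion hc, iUnion_subset hS, ?_⟩
  rw [iUnion_sdiff]
  refine measure_iUnion_null fun i => measure_mono_null ?_ (h0 i)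
  exact sdiff_subset_sdiff_right (sUnion_mono (subset_iUnion S i))

theorem of_null {A B : Set H} (hB : IsCurveCovered μ B) (h : μ (A \ B) = 0) :
    IsCurveCovered μ A := by
  obtain ⟨S, hc, hS, h0⟩ := hB
  refine ⟨S, hc, hS, measure_mono_null ?_ (measure_union_null h h0)⟩
  intro x hx
  by_cases hxB : x ∈ B
  · exact Or.inr ⟨hxB, hx.2⟩
  · exact Or.inl ⟨hx.1, hxB⟩

theorem of_subset {A Γ : Set H} (hΓ : IsRectifiableCurve Γ) (h : A ⊆ Γ) : IsCurveCovered μ A :=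
  ⟨{Γ}, countable_singleton _, by simpa using hΓ, by
    rw [sUnion_singleton, sdiff_eq_empty.2 h, measure_empty]⟩

theorem isOneRectifiable {A : Set H} (h : IsCurveCovered μ A) :
    IsOneRectifiable (μ.restrict A) := by
  obtain ⟨S, hc, hS, h0⟩ := h
  refine ⟨S, hc, hS, ?_⟩
  rw [Measure.restrict_apply
    (MeasurableSet.sUnion hc fun Γ hΓ => (hS hΓ).1.isClosed.measurableSet).compl]
  rwa [inter_comm, ← sdiff_eq]

end IsCurveCovered

/-- The radius `δ` is uniform, so balls about a dense sequence cover the piece. -/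
theorem GoodPieces.isCurveCovered {H : Type*} [NormedAddCommGroup H] [InnerProductSpace ℝ H]
    [CompleteSpace H] [TopologicalSpace.SeparableSpace H] [Nontrivial H]
    [MeasurableSpace H] [BorelSpace H] {μ : Measure H} {F : MultiresolutionFamily μ} {M j₀ : ℕ}
    {N : ℝ≥0∞} {E₀ E₁ E₂ : Set H} (G : GoodPieces μ F M j₀ N E₀ E₁ E₂) : IsCurveCovered μ E₂ := by
  obtain ⟨δ, hδ, h⟩ := G.exists_isRectifiableCurve
  choose Γ hΓ hE using h
  refine (IsCurveCovered.iUnion fun n => IsCurveCovered.of_subset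
    (hΓ (TopologicalSpace.denseSeq H n)) (hE _)).of_null ?_
  refine measure_mono_null (t := ∅) ?_ measure_empty
  rintro x ⟨hx, hn⟩
  obtain ⟨n, hn'⟩ := (TopologicalSpace.denseRange_denseSeq H).exists_dist_lt x hδ
  exact hn (mem_iUnion.2 ⟨n, hx, hn'.le⟩)

/-- Density points are taken twice: once to bound the beta sum near `E₁`, once to choose net points
in `E₁` by averaging. Each passage loses a null set. -/
theorem isCurveCovered_of_isDyadicDoubling {H : Type*} [NormedAddCommGroup H]
    [InnerProductSpace ℝ H] [CompleteSpace H] [TopologicalSpace.SeparableSpace H] [Nontrivial H]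
    [MeasurableSpace H] [BorelSpace H] {μ : Measure H} [IsLocallyFiniteMeasure μ]
    [μ.OuterRegular] {F : MultiresolutionFamily μ} {M j₀ : ℕ} {N : ℝ≥0∞} (hN : N ≠ ∞)
    {E : Set H} (hE : MeasurableSet E) (hμE : μ E ≠ ∞) (hX : E ⊆ F.X)
    (hdbl : ∀ x ∈ E, IsDyadicDoubling μ M j₀ x) (hJ : ∀ x ∈ E, jonesFunction μ F 1 x ≤ N) :
    IsCurveCovered μ E := by
  have := UniformSpace.secondCountable_of_separable H
  have hsub : ∀ (A : Set H) j, densityPoints μ A j ⊆ A := fun A j => inter_subset_left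
  refine (IsCurveCovered.iUnion fun j₁ => ?_).of_null
    (measure_sdiff_iUnion_densityPoints hE hμE hdbl)
  have hE₁ := measurableSet_densityPoints μ hE j₁
  refine (IsCurveCovered.iUnion fun j₂ => ?_).of_null
    (measure_sdiff_iUnion_densityPoints hE₁ (measure_ne_top_of_subset (hsub _ _) hμE)
      fun x hx => hdbl x (hsub _ _ hx))
  have G : GoodPieces μ F M (max j₀ (max j₁ j₂)) N E (densityPoints μ E j₁)
      (densityPoints μ (densityPoints μ E j₁) j₂) :=
    { measurable₀ := hE
      ne_top := hμE
      subset₁ := hsub _ _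
      subset₂ := hsub _ _
      subset_X := hX
      doubling := fun x hx => (hdbl x hx).mono (le_max_left _ _)
      bound_ne_top := hN
      jones := hJ
      density₁ := fun x hx j hj => hx.2 j (by omega)
      density₂ := fun x hx j hj => hx.2 j (by omega) }
  exact G.isCurveCovered

theorem mainTheorem5 {H : Type*} [NormedAddCommGroup H] [InnerProductSpace ℝ H]
    [CompleteSpace H] [TopologicalSpace.SeparableSpace H] [Nontrivial H]
    [MeasurableSpace H] [BorelSpace H]
    (μ : Measure H) [μ.Regular] (F : MultiresolutionFamily μ) :
    IsOneRectifiable (μ.restrict {x : H | IsDoublingAt μ x ∧ jonesFunction μ F 1 x < ∞}) := by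
  have := UniformSpace.secondCountable_of_separable H
  have := isLocallyFiniteMeasure_of_regular μ
  -- The set `F.X` need not be measurable; a measurable null set containing its complement is
  -- removed instead.
  set Z := toMeasurable μ F.Xᶜ
  have hZ : μ Z = 0 := by rw [measure_toMeasurable, F.carries]
  have hZX : Zᶜ ⊆ F.X := compl_subset_comm.1 (subset_toMeasurable μ F.Xᶜ)
  -- The indices are the doubling constant, the scale from which it holds, the bound for the Jones
  -- function, and a set of finite measure.
  let E : ℕ × ℕ × ℕ × ℕ → Set H := fun q => Zᶜ ∩ ({x | IsDyadicDoubling μ q.1 q.2.1 x} ∩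
    ({x | jonesFunction μ F 1 x ≤ q.2.2.1} ∩ spanningSets μ q.2.2.2))
  have hE : ∀ q, IsCurveCovered μ (E q) := fun q =>
    isCurveCovered_of_isDyadicDoubling (N := q.2.2.1) (ENNReal.natCast_ne_top _)
      ((measurableSet_toMeasurable _ _).compl.inter
        ((measurableSet_isDyadicDoubling μ _ _).inter
          ((measurableSet_le (measurable_jonesFunction F 1) measurable_const).inter
            (measurableSet_spanningSets μ _))))
      (measure_ne_top_of_subset (fun x hx => hx.2.2.2) (measure_spanningSets_lt_top μ _).ne)
      (fun x hx => hZX hx.1) (fun x hx => hx.2.1) (fun x hx => hx.2.2.1)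
  refine ((IsCurveCovered.iUnion hE).of_null ?_).isOneRectifiable
  refine measure_mono_null ?_
    (measure_union_null hZ (measure_setOf_measure_closedBall_eq_zero μ))
  rintro x ⟨⟨hd, hJ⟩, hx⟩
  by_contra! hn
  rw [mem_union, not_or] at hn
  obtain ⟨M, j₀, hM⟩ := hd.exists_isDyadicDoubling fun r hr =>
    pos_iff_ne_zero.2 fun h => hn.2 ⟨r, hr, h⟩
  obtain ⟨N, hN⟩ := ENNReal.exists_nat_gt hJ.ne
  refine hx (mem_iUnion.2 ⟨(M, j₀, N, spanningSetsIndex μ x), hn.1, hM, hN.le, ?_⟩)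
  exact mem_spanningSetsIndex μ x
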